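/- Let $U,H$ be separable real Hilbert spaces, $Q$ a symmetric non-negative trace class operator on $U$, $T>0$, and let $W=(W_t)_{t\ge 0}$ be a $Q$-Wiener process on a probability space $(\Omega,\mathcal F,\mathbb P)$: $W_0=0$, $W$ has almost surely continuous paths and independent increments, and $W_t-W_s\sim\mathcal N(0,(t-s)Q)$ for $0\le s\le t$. Let $(\mathcal F_t)_{t\in[0,T]}$ be the filtration generated by $W$, augmented by the $\mathbb P$-null sets and made right-continuous. Let $U_0=Q^{1/2}(U)$ with the inner product $\langle Q^{-1/2}u,Q^{-1/2}v\rangle_U$ ($Q^{-1/2}$ the pseudo-inverse of $Q^{1/2}$), and let $L^0_2=L_2(U_0;H)$ be the space of Hilbert--Schmidt operators from $U_0$ to $H$. Let $\mathscr P_T$ be the $\sigma$-algebra on $[0,T]\times\Omega$ generated by the sets $(s,t]\times F$ with $0\le s<t\le T$, $F\in\mathcal F_s$, and $\{0\}\times F$ with $F\in\mathcal F_0$; a process is predictable if it is $\mathscr P_T$-measurable. Let $\mathscr H^2_T(W)$ be the set of predictable $\varphi:[0,T]\times\Omega\to L^0_2$ with $\|\varphi\|^2_{\mathscr H^2_T}=\mathbb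 E\int_0^T\|\varphi_s\|^2_{L^0_2}\,ds<\infty$, and $\mathscr H_T(W)$ the set of predictable $\varphi$ with $\int_0^T\|\varphi_s\|^2_{L^0_2}\,ds<\infty$ almost surely. A simple process is $\psi_t=\psi_0\mathbf 1_{\{0\}}(t)+\sum_{m=0}^{N}\psi_m\mathbf 1_{(t_m,t_{m+1}]}(t)$ with $0=t_0<\dots<t_{N+1}=T$ and $\mathcal F_{t_m}$-measurable $\psi_m:\Omega\to L(U;H)$ taking finitely many values; it is regarded as $L^0_2$-valued by restriction to $U_0$, and its integral is $\psi\cdot W_t=\sum_{m=0}^N\psi_m(W_{t_{m+1}\wedge t}-W_{t_m\wedge t})$. All martingales are with respect to $(\mathcal F_t)$ and vanish at $0$. 1. For every simple $\psi$, $\psi\cdot W$ is an (almost surely) continuous square integrable $H$-valued martingale and $\mathbb E\|\psi\cdot W_t\|_H^2=\mathbb E\int_0^t\|\psi_s\|^2_{L^0_2}\,ds$ for all $t\in[0,T]$. 2. Let $\varphi\in\mathscr H^2_T(W)$. Then there are simple processes $\psi^n$ with $\|\varphi-\psi^n\|_{\mathscr H^2_T}\to0$, and there is a process $\varphi\cdot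 W=\int_0^{\cdot}\varphi_s\,dW_s$, unique up to modification and, among processes with almost surely continuous paths, up to indistinguishability, such that $\sup_{t\le T}\mathbb E\|\psi^n\cdot W_t-\varphi\cdot W_t\|_H^2\to0$ for every such sequence (if the limit relation holds for one such sequence, it identifies the integral). It has a version with continuous paths, which is a continuous square integrable $H$-valued martingale and satisfies $\mathbb E\|\varphi\cdot W_t\|_H^2=\mathbb E\int_0^t\|\varphi_s\|^2_{L^0_2}\,ds$ for all $t\in[0,T]$. 3. Let $\varphi\in\mathscr H_T(W)$ and, for $n\ge0$, let $\tau_n=\inf\{t\in[0,T]:\int_0^t\|\varphi_s\|^2_{L^0_2}\,ds\ge n\}$ (with $\inf\emptyset=\infty$, i.e. no stopping on $[0,T]$). Then the $\tau_n$ are stopping times which, almost surely, are non-decreasing in $n$ and eventually equal to $\infty$; $\mathbf 1_{[0,\tau_n]}\varphi\in\mathscr H^2_T(W)$; and there is a process $\varphi\cdot W$ with continuous paths such that, for every $n$, the stopped process $\varphi\cdot W_{\cdot\wedge\tau_n}$ is the stochastic integral of $\mathbf 1_{[0,\tau_n]}\varphi$ in the sense of 2, and is a continuous square integrable martingale. In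 particular $\varphi\cdot W$ is a continuous local martingale. Moreover, for every stopping time $\sigma$ with $\mathbf 1_{[0,\sigma]}\varphi\in\mathscr H^2_T(W)$, $\varphi\cdot W_{\cdot\wedge\sigma}$ is the stochastic integral of $\mathbf 1_{[0,\sigma]}\varphi$ (so for $\varphi\in\mathscr H^2_T(W)$ the two definitions agree), and any process with almost surely continuous paths which has the stopping property above for all members of some localizing sequence (stopping times $\sigma_n$ with $\mathbf 1_{[0,\sigma_n]}\varphi\in\mathscr H^2_T(W)$ that, almost surely, are non-decreasing and eventually equal to $\infty$) is indistinguishable from $\varphi\cdot W$. -/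

import Mathlib

open MeasureTheory ProbabilityTheory Filter Topology
open scoped NNReal ENNReal RealInnerProductSpace

noncomputable section

/-! ### Trace class and Hilbert–Schmidt operators -/

/-- A bounded operator `A` is of trace class (nuclear) if `A x = ∑ₖ aₖ(x) bₖ` for bounded linear
functionals `aₖ` and vectors `bₖ` with `∑ₖ ‖aₖ‖ ‖bₖ‖ < ∞`. -/
def IsTraceClass {E F : Type*} [NormedAddCommGroup E] [NormedSpace ℝ E]
    [NormedAddCommGroup F] [NormedSpace ℝ F] (A : E →L[ℝ] F) : Prop :=
  ∃ (a : ℕ → StrongDual ℝ E) (b : ℕ → F), Summable (fun k => ‖a k‖ * ‖b k‖) ∧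
    ∀ x, HasSum (fun k => a k x • b k) (A x)

section HilbertSchmidt

/-- The index set of a chosen orthonormal basis of a Hilbert space. -/
def hsIndex (E : Type*) [NormedAddCommGroup E] [InnerProductSpace ℝ E] [CompleteSpace E] :
    Set E :=
  (exists_hilbertBasis ℝ E).choose

/-- A chosen orthonormal basis of a Hilbert space. -/
def hsBasis (E : Type*) [NormedAddCommGroup E] [InnerProductSpace ℝ E] [CompleteSpace E] :
    HilbertBasis (hsIndex E) ℝ E :=
  (exists_hilbertBasis ℝ E).choose_spec.choose

variable {E F : Type*} [NormedAddCommGroup E] [InnerProductSpace ℝ E] [CompleteSpace E]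
  [NormedAddCommGroup F] [InnerProductSpace ℝ F]

/-- The squared Hilbert–Schmidt norm `∑ᵢ ‖A eᵢ‖²`, with values in `[0, ∞]`.
It does not depend on the orthonormal basis `(eᵢ)`, see `hsENormSq_eq_tsum`. -/
def hsENormSq (A : E →L[ℝ] F) : ℝ≥0∞ := ∑' i, ‖A (hsBasis E i)‖ₑ ^ 2

theorem HilbertBasis.tsum_enorm_inner_sq {ι : Type*} (b : HilbertBasis ι ℝ E) (x : E) :
    ∑' i, ‖⟪b i, x⟫‖ₑ ^ 2 = ‖x‖ₑ ^ 2 := by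
  have h : HasSum (fun i => ‖⟪b i, x⟫‖ ^ 2) (‖x‖ ^ 2) := by
    have h := b.hasSum_inner_mul_inner x x
    rw [real_inner_self_eq_norm_sq] at h
    have h3 : (fun i => ‖⟪b i, x⟫‖ ^ 2) = fun i => ⟪x, b i⟫ * ⟪b i, x⟫ := by
      funext i
      rw [Real.norm_eq_abs, sq_abs, sq, real_inner_comm x (b i)]
    rwa [h3]
  have h2 := ENNReal.ofReal_tsum_of_nonneg (fun i => by positivity) h.summable
  rw [h.tsum_eq] at h2
  simp_rw [← ofReal_norm, ← ENNReal.ofReal_pow (norm_nonneg _)]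
  exact h2.symm

theorem tsum_enorm_sq_eq_adjoint [CompleteSpace F] {ι κ : Type*} (b : HilbertBasis ι ℝ E)
    (c : HilbertBasis κ ℝ F) (A : E →L[ℝ] F) :
    ∑' i, ‖A (b i)‖ₑ ^ 2 = ∑' j, ‖A.adjoint (c j)‖ₑ ^ 2 := by
  calc ∑' i, ‖A (b i)‖ₑ ^ 2
      = ∑' i, ∑' j, ‖⟪c j, A (b i)⟫‖ₑ ^ 2 := by
        simp_rw [HilbertBasis.tsum_enorm_inner_sq]
    _ = ∑' j, ∑' i, ‖⟪c j, A (b i)⟫‖ₑ ^ 2 := ENNReal.tsum_comm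
    _ = ∑' j, ∑' i, ‖⟪b i, A.adjoint (c j)⟫‖ₑ ^ 2 := by
        simp_rw [ContinuousLinearMap.adjoint_inner_right, real_inner_comm]
    _ = _ := by simp_rw [HilbertBasis.tsum_enorm_inner_sq]

theorem hsENormSq_eq_tsum [CompleteSpace F] {ι : Type*} (b : HilbertBasis ι ℝ E)
    (A : E →L[ℝ] F) : hsENormSq A = ∑' i, ‖A (b i)‖ₑ ^ 2 := by
  rw [hsENormSq, tsum_enorm_sq_eq_adjoint _ (hsBasis F), tsum_enorm_sq_eq_adjoint b (hsBasis F)]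

theorem hsENormSq_lt_top_iff (A : E →L[ℝ] F) :
    hsENormSq A < ∞ ↔ Memℓp (fun i : hsIndex E => A (hsBasis E i)) 2 := by
  rw [memℓp_gen_iff (by norm_num), hsENormSq, lt_top_iff_ne_top]
  simp only [ENNReal.toReal_ofNat, Real.rpow_ofNat]
  have h : ∀ i, ‖A (hsBasis E i)‖ₑ ^ 2 = ((‖A (hsBasis E i)‖₊ ^ 2 : ℝ≥0) : ℝ≥0∞) := fun i => by
    rw [ENNReal.coe_pow]; rfl
  simp_rw [h, ENNReal.tsum_coe_ne_top_iff_summable, ← NNReal.summable_coe]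
  simp

variable (E F) in
/-- The Hilbert–Schmidt operators, as a linear subspace of the bounded operators. -/
def hilbertSchmidtSubmodule : Submodule ℝ (E →L[ℝ] F) where
  carrier := {A | Memℓp (fun i : hsIndex E => A (hsBasis E i)) 2}
  add_mem' hA hB := hA.add hB
  zero_mem' := zero_memℓp
  smul_mem' r _ hA := hA.const_smul r

variable (E F) in
/-- The space `L₂(E; F)` of Hilbert–Schmidt operators, normed by the Hilbert–Schmidt norm. -/
def HilbertSchmidt : Type _ := hilbertSchmidtSubmodule E F

namespace HilbertSchmidt

instance : AddCommGroup (HilbertSchmidt E F) :=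
  inferInstanceAs (AddCommGroup (hilbertSchmidtSubmodule E F))

instance : Module ℝ (HilbertSchmidt E F) :=
  inferInstanceAs (Module ℝ (hilbertSchmidtSubmodule E F))

/-- The bounded operator underlying a Hilbert–Schmidt operator. -/
def toCLM : HilbertSchmidt E F →ₗ[ℝ] (E →L[ℝ] F) := (hilbertSchmidtSubmodule E F).subtype

/-- The family `(A eᵢ)ᵢ`, as an element of `ℓ²`. -/
def toLp : HilbertSchmidt E F →ₗ[ℝ] lp (fun _ : hsIndex E => F) 2 where
  toFun A := ⟨fun i => A.toCLM (hsBasis E i), A.2⟩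
  map_add' _ _ := rfl
  map_smul' _ _ := rfl

theorem toLp_injective : Function.Injective (toLp : HilbertSchmidt E F →ₗ[ℝ] _) := by
  intro A B h
  apply Subtype.ext
  have h2 : ∀ i, A.toCLM (hsBasis E i) = B.toCLM (hsBasis E i) := fun i =>
    congrFun (congrArg Subtype.val h) i
  refine ContinuousLinearMap.ext_on (s := Set.range (hsBasis E)) ?_ ?_
  · exact Submodule.dense_iff_topologicalClosure_eq_top.2 (hsBasis E).dense_span
  · rintro _ ⟨i, rfl⟩
    exact h2 i

instance : NormedAddCommGroup (HilbertSchmidt E F) :=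
  NormedAddCommGroup.induced _ _ toLp toLp_injective

instance : InnerProductSpace ℝ (HilbertSchmidt E F) := InnerProductSpace.induced toLp

theorem enorm_sq (A : HilbertSchmidt E F) : ‖A‖ₑ ^ 2 = hsENormSq A.toCLM := by
  have h : HasSum (fun i => ‖A.toCLM (hsBasis E i)‖ ^ 2) (‖A‖ ^ 2) := by
    have h := lp.hasSum_norm (p := 2) (by norm_num) (toLp A)
    simp only [ENNReal.toReal_ofNat, Real.rpow_ofNat] at h
    exact h
  have h2 := ENNReal.ofReal_tsum_of_nonneg (fun i => by positivity) h.summable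
  rw [h.tsum_eq] at h2
  simp_rw [hsENormSq, ← ofReal_norm, ← ENNReal.ofReal_pow (norm_nonneg _)]
  exact h2

end HilbertSchmidt

end HilbertSchmidt

/-! ### The reproducing kernel space of a covariance operator -/

section ReproducingKernel

variable {U : Type*} [NormedAddCommGroup U] [InnerProductSpace ℝ U] [CompleteSpace U]

open scoped Classical in
/-- The positive square root `Q^{1/2}` of a bounded operator, which exists and is unique whenever
`Q` is positive (symmetric and non-negative); the value `0` is used otherwise. -/
def posSqrt (Q : U →L[ℝ] U) : U →L[ℝ] U :=
  if h : ∃ R : U →L[ℝ] U, R.IsPositive ∧ R ∘L R = Q then h.choose else 0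

/-- `Ker(Q^{1/2})`. -/
def sqrtKer (Q : U →L[ℝ] U) : Submodule ℝ U := LinearMap.ker (posSqrt Q).toLinearMap

instance (Q : U →L[ℝ] U) : CompleteSpace (sqrtKer Q) :=
  (posSqrt Q).isClosed_ker.completeSpace_coe

/-- The linear space `U₀ = Q^{1/2}(U)`. -/
def RKSpace (Q : U →L[ℝ] U) : Type _ := LinearMap.range (posSqrt Q).toLinearMap

namespace RKSpace

variable (Q : U →L[ℝ] U)

instance : AddCommGroup (RKSpace Q) :=
  inferInstanceAs (AddCommGroup (LinearMap.range (posSqrt Q).toLinearMap))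

instance : Module ℝ (RKSpace Q) :=
  inferInstanceAs (Module ℝ (LinearMap.range (posSqrt Q).toLinearMap))

/-- `Q^{1/2}`, as a map from `Ker(Q^{1/2})ᗮ` to `U₀`. -/
def sqrtRestrict : (sqrtKer Q)ᗮ →ₗ[ℝ] RKSpace Q :=
  (posSqrt Q).toLinearMap.rangeRestrict ∘ₗ (sqrtKer Q)ᗮ.subtype

theorem sqrtRestrict_bijective : Function.Bijective (sqrtRestrict Q) := by
  constructor
  · rw [injective_iff_map_eq_zero]
    intro x hx
    have h1 : (x : U) ∈ sqrtKer Q := congrArg Subtype.val hx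
    exact Subtype.ext (inner_self_eq_zero (𝕜 := ℝ).1 (x.2 _ h1))
  · rintro ⟨_, x, rfl⟩
    obtain ⟨y, hy, z, hz, rfl⟩ := (sqrtKer Q).exists_add_mem_mem_orthogonal x
    refine ⟨⟨z, hz⟩, Subtype.ext ?_⟩
    have : posSqrt Q y = 0 := hy
    change posSqrt Q z = posSqrt Q (y + z)
    simp [this]

/-- The pseudo-inverse `Q^{-1/2} : U₀ → Ker(Q^{1/2})ᗮ`: it maps `u` to the unique preimage of `u`
under `Q^{1/2}` that is orthogonal to the kernel, that is, to the preimage of minimal norm. -/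
def pinv : RKSpace Q ≃ₗ[ℝ] (sqrtKer Q)ᗮ :=
  (LinearEquiv.ofBijective (sqrtRestrict Q) (sqrtRestrict_bijective Q)).symm

/-- `U₀` is normed by `‖u‖ = ‖Q^{-1/2} u‖`. -/
instance : NormedAddCommGroup (RKSpace Q) :=
  NormedAddCommGroup.induced _ _ (pinv Q) (pinv Q).injective

/-- `U₀` carries the inner product `⟪Q^{-1/2} u, Q^{-1/2} v⟫`. -/
instance : InnerProductSpace ℝ (RKSpace Q) := InnerProductSpace.induced (pinv Q)

instance : CompleteSpace (RKSpace Q) :=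
  (LinearIsometryEquiv.mk (pinv Q) (fun _ => rfl)).toIsometryEquiv.completeSpace

theorem posSqrt_pinv (u : RKSpace Q) : posSqrt Q (pinv Q u) = u.1 :=
  congrArg Subtype.val
    ((LinearEquiv.ofBijective (sqrtRestrict Q) (sqrtRestrict_bijective Q)).apply_symm_apply u)

/-- The inclusion `U₀ → U`, which is bounded. -/
def incl : RKSpace Q →L[ℝ] U :=
  LinearMap.mkContinuous (LinearMap.range (posSqrt Q).toLinearMap).subtype ‖posSqrt Q‖ fun u => by
    change ‖u.1‖ ≤ ‖posSqrt Q‖ * ‖pinv Q u‖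
    rw [← posSqrt_pinv Q u]
    exact (posSqrt Q).le_opNorm _

end RKSpace

end ReproducingKernel

/-! ### Wiener processes and their filtration -/

section Wiener

variable {Ω : Type*} {mΩ : MeasurableSpace Ω}
  {U : Type*} [NormedAddCommGroup U] [InnerProductSpace ℝ U] [MeasurableSpace U] [BorelSpace U]

/-- `W` is a (standard) `Q`-Wiener process: a `U`-valued process with `W₀ = 0`, almost surely
continuous paths, independent increments, and `W_t - W_s ∼ N(0, (t - s) Q)` for `s ≤ t`, i.e. each
`⟪W_t - W_s, h⟫` is a centred real Gaussian variable of variance `(t - s) ⟪Q h, h⟫`. -/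
structure IsQWiener (Q : U →L[ℝ] U) (W : ℝ≥0 → Ω → U) (P : Measure Ω) : Prop where
  stronglyMeasurable : ∀ t, StronglyMeasurable (W t)
  zero : ∀ᵐ ω ∂P, W 0 ω = 0
  continuous : ∀ᵐ ω ∂P, Continuous fun t => W t ω
  indepIncrements : HasIndepIncrements W P
  gaussian : ∀ s t : ℝ≥0, s ≤ t → ∀ h : U,
    HasLaw (fun ω => ⟪W t ω - W s ω, h⟫) (gaussianReal 0 ((t - s) * ⟪Q h, h⟫.toNNReal)) P

/-- The filtration `σ(𝓕ₜ ∪ {A | P A = 0})`. -/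
def addNullSets (𝓕 : Filtration ℝ≥0 mΩ) (P : Measure Ω) : Filtration ℝ≥0 mΩ where
  seq t := 𝓕 t ⊔ MeasurableSpace.generateFrom {A | MeasurableSet A ∧ P A = 0}
  mono' _ _ hst := sup_le_sup_right (𝓕.mono hst) _
  le' t := sup_le (𝓕.le t) (MeasurableSpace.generateFrom_le fun _ hA => hA.1)

/-- The restriction of a filtration to the time interval `[0, T]`. -/
def restrictFiltration (𝓕 : Filtration ℝ≥0 mΩ) (T : ℝ≥0) : Filtration (Set.Iic T) mΩ where
  seq t := 𝓕 t
  mono' _ _ hst := 𝓕.mono hst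
  le' t := 𝓕.le t

/-- The normal filtration on `[0, T]` generated by the process `W`: the natural filtration
`σ(W_s : s ≤ t)` augmented by the null sets and made right-continuous. -/
def wienerFiltration (W : ℝ≥0 → Ω → U) (hW : ∀ t, StronglyMeasurable (W t)) (P : Measure Ω)
    (T : ℝ≥0) : Filtration (Set.Iic T) mΩ :=
  restrictFiltration (addNullSets (Filtration.natural W hW) P).rightCont T

end Wiener

/-! ### Stochastic integration on `[0, T]`

The time interval `[0, T]` is the type `Set.Iic T` with `T : ℝ≥0`. -/

section Integral

variable {Ω : Type*} {mΩ : MeasurableSpace Ω} {T : ℝ≥0}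
  {U : Type*} [NormedAddCommGroup U] [InnerProductSpace ℝ U]
  {H : Type*} [NormedAddCommGroup H] [InnerProductSpace ℝ H]

/-- Lebesgue measure on `[0, T]`. -/
def timeMeasure (T : ℝ≥0) : Measure (Set.Iic T) :=
  Measure.comap (fun t => ((t : ℝ≥0) : ℝ)) volume

/-- A simple `L(U; H)`-valued process: there are times `0 = t₀ < t₁ < ⋯ < t_{N+1} = T` and
`𝓕_{tₘ}`-measurable random operators `φₘ` taking finitely many values, `0 ≤ m ≤ N`. -/
structure SimpleProcess (𝓕 : Filtration (Set.Iic T) mΩ) (U H : Type*)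
    [NormedAddCommGroup U] [InnerProductSpace ℝ U]
    [NormedAddCommGroup H] [InnerProductSpace ℝ H] where
  N : ℕ
  time : Fin (N + 2) → Set.Iic T
  time_strictMono : StrictMono time
  time_zero : (time 0 : ℝ≥0) = 0
  time_last : (time (Fin.last (N + 1)) : ℝ≥0) = T
  value : Fin (N + 1) → Ω → U →L[ℝ] H
  finite_range : ∀ m, (Set.range (value m)).Finite
  measurable : ∀ m, StronglyMeasurable[𝓕 (time m.castSucc)] (value m)

namespace SimpleProcess

variable {𝓕 : Filtration (Set.Iic T) mΩ}

open scoped Classical in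
/-- The process `φ₀ 1_{{0}}(t) + ∑ₘ φₘ 1_{(tₘ, tₘ₊₁]}(t)`. -/
def eval (ψ : SimpleProcess 𝓕 U H) (t : Set.Iic T) (ω : Ω) : U →L[ℝ] H :=
  (if t = ⊥ then ψ.value 0 ω else 0) +
    ∑ m, if t ∈ Set.Ioc (ψ.time m.castSucc) (ψ.time m.succ) then ψ.value m ω else 0

/-- The elementary stochastic integral `∑ₘ φₘ (W_{tₘ₊₁ ∧ t} - W_{tₘ ∧ t})`. -/
def integral (ψ : SimpleProcess 𝓕 U H) (W : ℝ≥0 → Ω → U) (t : Set.Iic T) (ω : Ω) : H :=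
  ∑ m, ψ.value m ω
    (W (min (ψ.time m.succ) t : Set.Iic T) ω - W (min (ψ.time m.castSucc) t : Set.Iic T) ω)

end SimpleProcess

/-- `M` is a continuous, square integrable, `H`-valued martingale on `[0, T]`, null at `0`. -/
structure IsContSqIntMartingale [CompleteSpace H] (𝓕 : Filtration (Set.Iic T) mΩ)
    (M : Set.Iic T → Ω → H) (P : Measure Ω) : Prop where
  martingale : Martingale M 𝓕 P
  continuous : ∀ᵐ ω ∂P, Continuous fun t => M t ω
  sqIntegrable : ∀ t, MemLp (M t) 2 P
  zero : ∀ᵐ ω ∂P, M ⊥ ω = 0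

/-- `M` is a continuous local martingale on `[0, T]`, null at `0`. A localizing sequence on
`[0, T]` consists of stopping times with values in `[0, T] ∪ {⊤}` which, almost surely, increase
and are eventually equal to `⊤`. -/
structure IsContLocalMartingale [CompleteSpace H] (𝓕 : Filtration (Set.Iic T) mΩ)
    (M : Set.Iic T → Ω → H) (P : Measure Ω) : Prop where
  stronglyAdapted : StronglyAdapted 𝓕 M
  continuous : ∀ᵐ ω ∂P, Continuous fun t => M t ω
  zero : ∀ᵐ ω ∂P, M ⊥ ω = 0
  exists_localizing : ∃ τ : ℕ → Ω → WithTop (Set.Iic T), IsLocalizingSequence 𝓕 τ P ∧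
    ∀ n, Martingale (stoppedProcess M (τ n)) 𝓕 P

variable [CompleteSpace U] {Q : U →L[ℝ] U}

/-- The path energy `∫₀ᵗ ‖φ_s‖² ds` in the norm of `L₂(U₀; H)`. -/
def energy (φ : Set.Iic T → Ω → HilbertSchmidt (RKSpace Q) H) (t : Set.Iic T) (ω : Ω) : ℝ≥0∞ :=
  ∫⁻ s in Set.Iic t, ‖φ s ω‖ₑ ^ 2 ∂timeMeasure T

/-- The space `ℋ²_T(W)`: predictable `L₂(U₀; H)`-valued processes with `E ∫₀ᵀ ‖φ_s‖² ds < ∞`. -/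
structure IsSqIntegrand (𝓕 : Filtration (Set.Iic T) mΩ)
    (φ : Set.Iic T → Ω → HilbertSchmidt (RKSpace Q) H) (P : Measure Ω) : Prop where
  predictable : IsStronglyPredictable 𝓕 φ
  energy_lt_top : ∫⁻ ω, energy φ ⊤ ω ∂P < ∞

/-- The space `ℋ_T(W)`: predictable `L₂(U₀; H)`-valued processes with `∫₀ᵀ ‖φ_s‖² ds < ∞`
almost surely. -/
structure IsLocalIntegrand (𝓕 : Filtration (Set.Iic T) mΩ)
    (φ : Set.Iic T → Ω → HilbertSchmidt (RKSpace Q) H) (P : Measure Ω) : Prop where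
  predictable : IsStronglyPredictable 𝓕 φ
  energy_lt_top : ∀ᵐ ω ∂P, energy φ ⊤ ω < ∞

/-- The simple processes `ψₙ`, restricted to `U₀`, converge to `φ` in `ℋ²_T`:
`E ∫₀ᵀ ‖φ_s - ψₙ_s‖² ds → 0` in the Hilbert–Schmidt norm of operators from `U₀` to `H`. -/
def ApproximatedBy {𝓕 : Filtration (Set.Iic T) mΩ}
    (φ : Set.Iic T → Ω → HilbertSchmidt (RKSpace Q) H) (ψ : ℕ → SimpleProcess 𝓕 U H)
    (P : Measure Ω) : Prop :=
  Tendsto (fun n => ∫⁻ ω, ∫⁻ s,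
    hsENormSq ((φ s ω).toCLM - ((ψ n).eval s ω) ∘L RKSpace.incl Q) ∂timeMeasure T ∂P)
    atTop (𝓝 0)

/-- The elementary integrals of the simple processes `ψₙ` converge to `M` in the norm of
square integrable martingales: `sup_{t ≤ T} E ‖(ψₙ • W)_t - M_t‖² → 0`. -/
def IntegralsTendsto {𝓕 : Filtration (Set.Iic T) mΩ}
    (ψ : ℕ → SimpleProcess 𝓕 U H) (W : ℝ≥0 → Ω → U) (M : Set.Iic T → Ω → H)
    (P : Measure Ω) : Prop :=
  Tendsto (fun n => ⨆ t, ∫⁻ ω, ‖(ψ n).integral W t ω - M t ω‖ₑ ^ 2 ∂P) atTop (𝓝 0)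

/-- `M` is (a version of) the stochastic integral `φ • W` of `φ ∈ ℋ²_T(W)`: the limit of the
elementary integrals of some sequence of simple processes converging to `φ`. -/
structure IsItoIntegral (𝓕 : Filtration (Set.Iic T) mΩ) (W : ℝ≥0 → Ω → U)
    (φ : Set.Iic T → Ω → HilbertSchmidt (RKSpace Q) H) (M : Set.Iic T → Ω → H)
    (P : Measure Ω) : Prop where
  memLp : ∀ t, MemLp (M t) 2 P
  exists_approx : ∃ ψ : ℕ → SimpleProcess 𝓕 U H,
    ApproximatedBy φ ψ P ∧ IntegralsTendsto ψ W M P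

open scoped Classical in
/-- The truncated integrand `1_{[0, τ]} φ`. -/
def truncate (φ : Set.Iic T → Ω → HilbertSchmidt (RKSpace Q) H) (τ : Ω → WithTop (Set.Iic T))
    (t : Set.Iic T) (ω : Ω) : HilbertSchmidt (RKSpace Q) H :=
  if (t : WithTop (Set.Iic T)) ≤ τ ω then φ t ω else 0

/-- `M` is the stochastic integral of `φ` along the stopping times `τₙ`: the truncations
`1_{[0, τₙ]} φ` belong to `ℋ²_T(W)` and `M_{· ∧ τₙ}` is their stochastic integral. -/
def IsItoIntegralAlong (𝓕 : Filtration (Set.Iic T) mΩ) (W : ℝ≥0 → Ω → U)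
    (φ : Set.Iic T → Ω → HilbertSchmidt (RKSpace Q) H) (M : Set.Iic T → Ω → H)
    (τ : ℕ → Ω → WithTop (Set.Iic T)) (P : Measure Ω) : Prop :=
  ∀ n, IsSqIntegrand 𝓕 (truncate φ (τ n)) P ∧
    IsItoIntegral 𝓕 W (truncate φ (τ n)) (stoppedProcess M (τ n)) P

end Integral

end

/-! The stochastic integral is the continuous extension of an isometry. For one increment and a
fixed operator B, E‖B(W_t - W_s)‖² equals (t - s) times the squared Hilbert–Schmidt norm of B on U₀:
expand in an orthonormal basis of H and use that the adjoint of the inclusion U₀ ⊂ U has ‖incl* x‖²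
= ⟪Qx, x⟫, the variance rate of W in direction x (`norm_adjoint_incl_sq`). The increment stays
independent of 𝓕_s after null sets and right limits are added (`IsQWiener.indep_rightCont`), so the
blocks of an elementary integral are pairwise orthogonal and the isometry
`SimpleProcess.lintegral_integral_sq` follows.

The extension needs density of simple processes in the predictable L² space
(`exists_isElementary_eLpNorm_sub_le`). It combines a π-λ argument over predictable rectangles with
the density in L₂(U₀; H) of restrictions of bounded operators (`dense_range_restrictHS`). Two
notions keep the bookkeeping light: `IsElementary`, finite sums of X 1_{(s,T]} with no common grid,
and `IsL2Integral`, which says that integrand and integral are approximated simultaneously by an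
elementary pair. This relation is stable under differences, cuts and limits, and both the isometry
and the martingale property pass through it. Doob's maximal inequality and Borel–Cantelli make a
fast approximating sequence converge uniformly in time, which gives continuous paths
(`exists_isL2Integral`).

Localization rests on `IsL2Integral.stopped_indicator`: stopping the integral at σ is integrating
1_{[0,σ]} φ. For a stopping time with finitely many values this is algebra, and σ is reached from
above through such times. Uniqueness then glues the integrals of 1_{[0,τₙ]} φ, and computing the
integral of 1_{[0,σ]} 1_{[0,τₙ]} φ in two ways removes the dependence on the localizing sequence.
The level times of the energy are stopping times because the energy is adapted and, where finite,
right-continuous, while the exceptional null set belongs to every 𝓕_t. -/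

set_option linter.unusedSectionVars false

noncomputable section

/-! ### Square roots of positive operators -/

section Sqrt

/-- The coefficients of `1 - √(1 - x) = ∑ₙ aₙ xⁿ⁺¹`. -/
def sqrtCoeff (n : ℕ) : ℝ := catalan n / (2 * 4 ^ n)

theorem sqrtCoeff_nonneg (n : ℕ) : 0 ≤ sqrtCoeff n := by unfold sqrtCoeff; positivity

/-- Telescoping form: the partial sums become 1 - centralBinom n / 4ⁿ, so summability with sum at
most 1 needs no asymptotics. -/
theorem sqrtCoeff_eq_sub (n : ℕ) : sqrtCoeff n =
    (n.centralBinom : ℝ) / 4 ^ n - ((n + 1).centralBinom : ℝ) / 4 ^ (n + 1) := by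
  have h1 : ((n : ℝ) + 1) * catalan n = n.centralBinom := by
    exact_mod_cast succ_mul_catalan_eq_centralBinom n
  have h2 : ((n : ℝ) + 1) * (n + 1).centralBinom = 2 * (2 * n + 1) * n.centralBinom := by
    exact_mod_cast Nat.succ_mul_centralBinom_succ n
  have h3 : ((n + 1).centralBinom : ℝ) = 2 * (2 * n + 1) * catalan n := by
    have : ((n : ℝ) + 1) ≠ 0 := by positivity
    apply mul_left_cancel₀ this
    rw [h2, ← h1]; ring
  rw [h3, ← h1, sqrtCoeff]
  field_simp
  ring

theorem sum_sqrtCoeff_le (n : ℕ) : ∑ i ∈ Finset.range n, sqrtCoeff i ≤ 1 := by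
  have h : ∑ i ∈ Finset.range n, sqrtCoeff i = 1 - (n.centralBinom : ℝ) / 4 ^ n := by
    induction n with
    | zero => simp
    | succ n ih => rw [Finset.sum_range_succ, ih, sqrtCoeff_eq_sub]; ring
  rw [h]
  have : 0 ≤ (n.centralBinom : ℝ) / 4 ^ n := by positivity
  linarith

theorem summable_sqrtCoeff : Summable sqrtCoeff :=
  summable_of_sum_range_le sqrtCoeff_nonneg sum_sqrtCoeff_le

theorem tsum_sqrtCoeff_le : ∑' n, sqrtCoeff n ≤ 1 :=
  Real.tsum_le_of_sum_range_le sqrtCoeff_nonneg sum_sqrtCoeff_le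

/-- The Catalan recursion. It is the coefficientwise form of S² = 2S - x for S = 1 - √(1 - x). -/
theorem sum_antidiagonal_sqrtCoeff (n : ℕ) :
    ∑ p ∈ Finset.HasAntidiagonal.antidiagonal n, sqrtCoeff p.1 * sqrtCoeff p.2 = 2 * sqrtCoeff (n + 1) := by
  have h : ∀ p ∈ Finset.HasAntidiagonal.antidiagonal n, sqrtCoeff p.1 * sqrtCoeff p.2
      = ((catalan p.1 * catalan p.2 : ℕ) : ℝ) / (4 * 4 ^ n) := by
    intro p hp
    rw [← Finset.HasAntidiagonal.mem_antidiagonal.1 hp, sqrtCoeff, sqrtCoeff, pow_add]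
    push_cast
    field_simp
    ring
  rw [Finset.sum_congr rfl h, ← Finset.sum_div, ← Nat.cast_sum, ← catalan_succ', sqrtCoeff, pow_succ]
  field_simp

variable {A : Type*} [NormedRing A] [NormedAlgebra ℝ A] [CompleteSpace A]

/-- If `‖b‖ ≤ 1` then `1 - b` has a square root of the form `1 - ∑ₙ aₙ bⁿ⁺¹`. -/
theorem one_sub_tsum_sqrtCoeff_sq [NormOneClass A] {b : A} (hb : ‖b‖ ≤ 1) :
    Summable (fun n => ‖sqrtCoeff n • b ^ (n + 1)‖) ∧
    (1 - ∑' n, sqrtCoeff n • b ^ (n + 1)) * (1 - ∑' n, sqrtCoeff n • b ^ (n + 1)) = 1 - b := by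
  have hle : ∀ n, ‖sqrtCoeff n • b ^ (n + 1)‖ ≤ sqrtCoeff n := by
    intro n
    rw [norm_smul, Real.norm_of_nonneg (sqrtCoeff_nonneg n)]
    exact mul_le_of_le_one_right (sqrtCoeff_nonneg n)
      ((norm_pow_le b (n + 1)).trans (pow_le_one₀ (norm_nonneg _) hb))
  have hs : Summable (fun n => ‖sqrtCoeff n • b ^ (n + 1)‖) :=
    Summable.of_nonneg_of_le (fun _ => norm_nonneg _) hle summable_sqrtCoeff
  refine ⟨hs, ?_⟩
  have hsq : (∑' n, sqrtCoeff n • b ^ (n + 1)) * (∑' n, sqrtCoeff n • b ^ (n + 1))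
      = 2 * (∑' n, sqrtCoeff n • b ^ (n + 1)) - b := by
    rw [tsum_mul_tsum_eq_tsum_sum_antidiagonal_of_summable_norm hs hs]
    have h1 : ∀ n, ∑ p ∈ Finset.HasAntidiagonal.antidiagonal n,
        (sqrtCoeff p.1 • b ^ (p.1 + 1)) * (sqrtCoeff p.2 • b ^ (p.2 + 1))
        = 2 * (sqrtCoeff (n + 1) • b ^ (n + 1 + 1)) := by
      intro n
      have : ∀ p ∈ Finset.HasAntidiagonal.antidiagonal n,
          (sqrtCoeff p.1 • b ^ (p.1 + 1)) * (sqrtCoeff p.2 • b ^ (p.2 + 1))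
          = (sqrtCoeff p.1 * sqrtCoeff p.2) • b ^ (n + 1 + 1) := by
        intro p hp
        rw [← Finset.HasAntidiagonal.mem_antidiagonal.1 hp, smul_mul_smul_comm, ← pow_add]
        congr 2
        omega
      rw [Finset.sum_congr rfl this, ← Finset.sum_smul, sum_antidiagonal_sqrtCoeff, mul_smul,
        two_mul, two_smul]
    simp_rw [h1]
    have hs1 : Summable (fun n => sqrtCoeff (n + 1) • b ^ (n + 1 + 1)) :=
      (summable_nat_add_iff 1).2 hs.of_norm
    rw [hs.of_norm.tsum_eq_zero_add, hs1.tsum_mul_left, mul_add]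
    -- The Cauchy product starts in degree two; the missing degree one term of 2S is exactly b
    -- because the first coefficient is 1/2.
    have h0 : (2 : A) * (sqrtCoeff 0 • b ^ (0 + 1)) = b := by
      rw [zero_add, pow_one, two_mul, ← two_smul ℝ (sqrtCoeff 0 • b), smul_smul]
      simp [sqrtCoeff]
    rw [h0]
    abel
  rw [sub_mul, mul_sub, mul_sub, hsq]
  simp only [one_mul, mul_one]
  rw [two_mul]
  abel

variable {U : Type*} [NormedAddCommGroup U] [InnerProductSpace ℝ U] [CompleteSpace U]

omit [CompleteSpace U] in
theorem norm_le_one_of_abs_inner_le {B : U →L[ℝ] U} (hB : B.IsSymmetric)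
    (h : ∀ x, |⟪B x, x⟫| ≤ ‖x‖ ^ 2) : ‖B‖ ≤ 1 := by
  rw [ContinuousLinearMap.norm_eq_iSup_rayleighQuotient B hB]
  refine ciSup_le fun x => ?_
  rw [ContinuousLinearMap.rayleighQuotient, abs_div, abs_of_nonneg (sq_nonneg ‖x‖)]
  exact div_le_one_of_le₀ (h x) (sq_nonneg _)

/-- Put b = 1 - Q/‖Q‖. Its quadratic form lies between 0 and ‖x‖², so ‖b‖ ≤ 1 and the power series
gives S with (1 - S)² = Q/‖Q‖. Since ‖S‖ ≤ 1, the operator 1 - S is positive. This shows that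
`posSqrt` is not its default value 0. -/
theorem ContinuousLinearMap.IsPositive.exists_sqrt {Q : U →L[ℝ] U} (hQ : Q.IsPositive) :
    ∃ R : U →L[ℝ] U, R.IsPositive ∧ R ∘L R = Q := by
  rcases eq_or_ne Q 0 with rfl | hQ0
  · exact ⟨0, ContinuousLinearMap.isPositive_zero, by simp⟩
  -- The series argument uses ‖1‖ = 1, which fails on the zero space.
  have hnt : Nontrivial U := by
    by_contra h
    rw [not_nontrivial_iff_subsingleton] at h
    exact hQ0 (ContinuousLinearMap.ext fun x => Subsingleton.elim _ _)
  have hq : 0 < ‖Q‖ := norm_pos_iff.2 hQ0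
  set b : U →L[ℝ] U := 1 - ‖Q‖⁻¹ • Q with hb
  have hbsa : IsSelfAdjoint b :=
    (IsSelfAdjoint.one _).sub (IsSelfAdjoint.smul (by simp [isSelfAdjoint_iff]) hQ.isSelfAdjoint)
  have hbinner : ∀ x, ⟪b x, x⟫ = ‖x‖ ^ 2 - ‖Q‖⁻¹ * ⟪Q x, x⟫ := by
    intro x
    simp [hb, inner_sub_left, inner_smul_left]
  have hb1 : ‖b‖ ≤ 1 := by
    refine norm_le_one_of_abs_inner_le hbsa.isSymmetric fun x => ?_
    have h1 : 0 ≤ ⟪Q x, x⟫ := hQ.inner_nonneg_left x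
    have h2 : ‖Q‖⁻¹ * ⟪Q x, x⟫ ≤ ‖x‖ ^ 2 := by
      rw [inv_mul_le_iff₀ hq]
      calc ⟪Q x, x⟫ ≤ ‖Q x‖ * ‖x‖ := real_inner_le_norm _ _
        _ ≤ ‖Q‖ * ‖x‖ * ‖x‖ := by gcongr; exact Q.le_opNorm x
        _ = _ := by ring
    have h3 : 0 ≤ ‖Q‖⁻¹ * ⟪Q x, x⟫ := by positivity
    rw [hbinner, abs_of_nonneg (by linarith)]
    linarith
  obtain ⟨hs, hsq⟩ := one_sub_tsum_sqrtCoeff_sq hb1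
  set S : U →L[ℝ] U := ∑' n, sqrtCoeff n • b ^ (n + 1) with hS
  have hSsa : IsSelfAdjoint S := by
    have h1 := hs.of_norm.hasSum.star
    have h2 : ∀ n, star (sqrtCoeff n • b ^ (n + 1)) = sqrtCoeff n • b ^ (n + 1) := fun n => by
      rw [star_smul, star_pow, hbsa.star_eq, star_trivial]
    simp_rw [h2] at h1
    exact h1.unique hs.of_norm.hasSum
  have hSn : ‖S‖ ≤ 1 := by
    refine (tsum_of_norm_bounded summable_sqrtCoeff.hasSum fun n => ?_).trans tsum_sqrtCoeff_le
    rw [norm_smul, Real.norm_of_nonneg (sqrtCoeff_nonneg n)]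
    exact mul_le_of_le_one_right (sqrtCoeff_nonneg n)
      ((norm_pow_le b (n + 1)).trans (pow_le_one₀ (norm_nonneg _) hb1))
  have hRpos : (1 - S).IsPositive := by
    rw [ContinuousLinearMap.isPositive_def']
    refine ⟨(IsSelfAdjoint.one _).sub hSsa, fun x => ?_⟩
    have h1 : ⟪S x, x⟫ ≤ ‖x‖ ^ 2 := by
      calc ⟪S x, x⟫ ≤ ‖S x‖ * ‖x‖ := real_inner_le_norm _ _
        _ ≤ 1 * ‖x‖ * ‖x‖ := by
          gcongr
          exact (S.le_opNorm x).trans (by gcongr)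
        _ = _ := by ring
    have h2 : (1 - S).reApplyInnerSelf x = ‖x‖ ^ 2 - ⟪S x, x⟫ := by
      simp [ContinuousLinearMap.reApplyInnerSelf, inner_sub_left]
    rw [h2]
    linarith
  refine ⟨Real.sqrt ‖Q‖ • (1 - S), hRpos.smul_of_nonneg (Real.sqrt_nonneg _), ?_⟩
  have : (Real.sqrt ‖Q‖ • (1 - S)) * (Real.sqrt ‖Q‖ • (1 - S)) = Q := by
    rw [smul_mul_smul_comm, hsq, Real.mul_self_sqrt hq.le, hb]
    simp [smul_smul, hq.ne']
  exact this

theorem posSqrt_isPositive {Q : U →L[ℝ] U} (hQ : Q.IsPositive) : (posSqrt Q).IsPositive := by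
  rw [posSqrt, dif_pos hQ.exists_sqrt]
  exact hQ.exists_sqrt.choose_spec.1

theorem posSqrt_comp_posSqrt {Q : U →L[ℝ] U} (hQ : Q.IsPositive) :
    posSqrt Q ∘L posSqrt Q = Q := by
  rw [posSqrt, dif_pos hQ.exists_sqrt]
  exact hQ.exists_sqrt.choose_spec.2

theorem norm_posSqrt_sq {Q : U →L[ℝ] U} (hQ : Q.IsPositive) (x : U) :
    ‖posSqrt Q x‖ ^ 2 = ⟪Q x, x⟫ := by
  rw [← real_inner_self_eq_norm_sq, ← (posSqrt_isPositive hQ).inner_left_eq_inner_right]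
  change ⟪(posSqrt Q ∘L posSqrt Q) x, x⟫ = _
  rw [posSqrt_comp_posSqrt hQ]

/-- The adjoint of the inclusion sends x to Qx viewed in U₀. As Q^{1/2} x is orthogonal to the
kernel, it is the pseudo-inverse image of Qx, so the U₀-norm of Qx is ‖Q^{1/2} x‖. This turns
Hilbert–Schmidt norms over U₀ into covariances of W. -/
theorem norm_adjoint_incl_sq {Q : U →L[ℝ] U} (hQ : Q.IsPositive) (x : U) :
    ‖(RKSpace.incl Q).adjoint x‖ ^ 2 = ⟪Q x, x⟫ := by
  have hmem : posSqrt Q x ∈ (sqrtKer Q)ᗮ := by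
    intro y hy
    have hy' : posSqrt Q y = 0 := hy
    rw [← (posSqrt_isPositive hQ).inner_left_eq_inner_right, hy', inner_zero_left]
  set w : RKSpace Q := RKSpace.sqrtRestrict Q ⟨posSqrt Q x, hmem⟩ with hw
  have hpw : RKSpace.pinv Q w = ⟨posSqrt Q x, hmem⟩ :=
    (LinearEquiv.ofBijective (RKSpace.sqrtRestrict Q)
      (RKSpace.sqrtRestrict_bijective Q)).symm_apply_apply _
  have hadj : (RKSpace.incl Q).adjoint x = w := by
    refine ext_inner_right ℝ fun u => ?_
    rw [ContinuousLinearMap.adjoint_inner_left]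
    change ⟪x, u.1⟫ = ⟪RKSpace.pinv Q w, RKSpace.pinv Q u⟫
    rw [hpw, ← RKSpace.posSqrt_pinv Q u, ← (posSqrt_isPositive hQ).inner_left_eq_inner_right]
    rfl
  have hn : ‖w‖ = ‖RKSpace.pinv Q w‖ := rfl
  rw [hadj, hn, hpw]
  exact norm_posSqrt_sq hQ x

end Sqrt

/-! ### Traces and Hilbert–Schmidt norms -/

section HS

variable {E F G : Type*} [NormedAddCommGroup E] [InnerProductSpace ℝ E] [CompleteSpace E]
  [NormedAddCommGroup F] [InnerProductSpace ℝ F] [NormedAddCommGroup G] [InnerProductSpace ℝ G]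

/-- Insert the nuclear expansion of Q and exchange the sums. For each k, Cauchy–Schwarz over the
basis and Parseval bound the inner sum by ‖aₖ‖ ‖cₖ‖. -/
theorem IsTraceClass.summable_abs_inner {Q : E →L[ℝ] E} (hQ : IsTraceClass Q) {ι : Type*}
    (b : HilbertBasis ι ℝ E) : ∑' i, ‖⟪Q (b i), b i⟫‖ₑ < ∞ := by
  obtain ⟨a, c, hs, hsum⟩ := hQ
  have h1 : ∀ i, ‖⟪Q (b i), b i⟫‖ₑ ≤ ∑' k, ‖a k (b i)‖ₑ * ‖⟪c k, b i⟫‖ₑ := by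
    intro i
    have h := (hsum (b i)).mapL (innerSL ℝ (b i))
    simp only [innerSL_apply_apply, inner_smul_right] at h
    rw [real_inner_comm, ← h.tsum_eq]
    refine (enorm_tsum_le_tsum_enorm).trans (le_of_eq ?_)
    refine tsum_congr fun k => ?_
    rw [enorm_mul, real_inner_comm]
  have h2 : ∀ k, ∑' i, ‖a k (b i)‖ₑ * ‖⟪c k, b i⟫‖ₑ ≤ ‖a k‖ₑ * ‖c k‖ₑ := by
    intro k
    obtain ⟨y, hy⟩ : ∃ y : E, ∀ x, a k x = ⟪y, x⟫ :=
      ⟨(InnerProductSpace.toDual ℝ E).symm (a k), fun x => by simp⟩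
    have hyn : ‖y‖ₑ = ‖a k‖ₑ := by
      have : a k = InnerProductSpace.toDual ℝ E y := by ext x; simp [hy]
      rw [this, ← ofReal_norm, ← ofReal_norm, LinearIsometryEquiv.norm_map]
    have hA : (∑' i, ‖a k (b i)‖ₑ ^ 2) = ‖a k‖ₑ ^ 2 := by
      rw [← hyn, ← HilbertBasis.tsum_enorm_inner_sq b y]
      exact tsum_congr fun i => by rw [hy, real_inner_comm]
    have hC : (∑' i, ‖⟪c k, b i⟫‖ₑ ^ 2) = ‖c k‖ₑ ^ 2 := by
      rw [← HilbertBasis.tsum_enorm_inner_sq b (c k)]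
      exact tsum_congr fun i => by rw [real_inner_comm]
    -- Cauchy–Schwarz for series is Hölder for the counting measure on the discrete space.
    let _ : MeasurableSpace ι := ⊤
    have hH := ENNReal.lintegral_mul_le_Lp_mul_Lq (μ := Measure.count (α := ι))
      (p := 2) (q := 2) (f := fun i => ‖a k (b i)‖ₑ) (g := fun i => ‖⟪c k, b i⟫‖ₑ)
      ⟨by norm_num, by norm_num, by norm_num⟩ (measurable_from_top).aemeasurable
      (measurable_from_top).aemeasurable
    simp only [lintegral_count, Pi.mul_apply, ENNReal.rpow_two, hA, hC] at hH
    refine hH.trans (le_of_eq ?_)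
    rw [← ENNReal.rpow_two, ← ENNReal.rpow_two, ← ENNReal.rpow_mul, ← ENNReal.rpow_mul]
    norm_num
  calc ∑' i, ‖⟪Q (b i), b i⟫‖ₑ ≤ ∑' i, ∑' k, ‖a k (b i)‖ₑ * ‖⟪c k, b i⟫‖ₑ :=
        ENNReal.tsum_le_tsum h1
    _ = ∑' k, ∑' i, ‖a k (b i)‖ₑ * ‖⟪c k, b i⟫‖ₑ := ENNReal.tsum_comm
    _ ≤ ∑' k, ‖a k‖ₑ * ‖c k‖ₑ := ENNReal.tsum_le_tsum h2
    _ < ∞ := by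
      have h3 := hs.tsum_ofReal_lt_top
      simpa [ENNReal.ofReal_mul] using h3

theorem hsENormSq_comp_le (B : F →L[ℝ] G) (A : E →L[ℝ] F) :
    hsENormSq (B ∘L A) ≤ ‖B‖ₑ ^ 2 * hsENormSq A := by
  rw [hsENormSq, hsENormSq, ← ENNReal.tsum_mul_left]
  refine ENNReal.tsum_le_tsum fun i => ?_
  rw [← mul_pow]
  gcongr
  exact B.le_opENorm _

variable {U : Type*} [NormedAddCommGroup U] [InnerProductSpace ℝ U] [CompleteSpace U]
  {Q : U →L[ℝ] U}

/-- Passing to the adjoint, the squared Hilbert–Schmidt norm of the inclusion is the trace of Q. -/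
theorem hsENormSq_incl_lt_top (hQ : Q.IsPositive) (hQtr : IsTraceClass Q) :
    hsENormSq (RKSpace.incl Q) < ∞ := by
  rw [hsENormSq, tsum_enorm_sq_eq_adjoint _ (hsBasis U)]
  refine lt_of_le_of_lt (ENNReal.tsum_le_tsum fun i => ?_) (hQtr.summable_abs_inner (hsBasis U))
  rw [← norm_adjoint_incl_sq hQ, enorm_pow, enorm_norm]

/-- The j-th term is the variance rate of ⟪cⱼ, B W⟫, which is how this norm gets compared with
second moments of increments. -/
theorem hsENormSq_comp_incl [CompleteSpace G] (hQ : Q.IsPositive) {κ : Type*}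
    (c : HilbertBasis κ ℝ G) (B : U →L[ℝ] G) :
    hsENormSq (B ∘L RKSpace.incl Q) =
      ∑' j, ENNReal.ofReal ⟪Q (B.adjoint (c j)), B.adjoint (c j)⟫ := by
  rw [hsENormSq, tsum_enorm_sq_eq_adjoint _ c]
  refine tsum_congr fun j => ?_
  rw [ContinuousLinearMap.adjoint_comp, ContinuousLinearMap.comp_apply, ← norm_adjoint_incl_sq hQ,
    ENNReal.ofReal_pow (norm_nonneg _), ofReal_norm]

theorem memℓp_comp_incl (h : hsENormSq (RKSpace.incl Q) < ∞) (B : U →L[ℝ] G) :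
    (B ∘L RKSpace.incl Q) ∈ hilbertSchmidtSubmodule (RKSpace Q) G :=
  (hsENormSq_lt_top_iff _).1
    ((hsENormSq_comp_le B _).trans_lt (ENNReal.mul_lt_top (by simp) h))

theorem HilbertSchmidt.norm_sq_le {A : HilbertSchmidt E F} {c : ℝ} (hc : 0 ≤ c)
    (h : hsENormSq A.toCLM ≤ ENNReal.ofReal (c ^ 2)) : ‖A‖ ≤ c := by
  rw [← HilbertSchmidt.enorm_sq, ENNReal.ofReal_pow hc, ← ofReal_norm] at h
  have h2 := (ENNReal.pow_le_pow_left_iff (n := 2) (by norm_num)).1 h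
  exact (ENNReal.ofReal_le_ofReal_iff hc).1 h2

/-- The restriction of bounded operators `U → G` to Hilbert–Schmidt operators `U₀ → G`. -/
def restrictHS (h : hsENormSq (RKSpace.incl Q) < ∞) :
    (U →L[ℝ] G) →L[ℝ] HilbertSchmidt (RKSpace Q) G :=
  LinearMap.mkContinuous
    { toFun := fun B => ⟨B ∘L RKSpace.incl Q, memℓp_comp_incl h B⟩
      map_add' := fun _ _ => rfl
      map_smul' := fun _ _ => rfl }
    √(hsENormSq (RKSpace.incl Q)).toReal fun B => by
      refine HilbertSchmidt.norm_sq_le (by positivity) ?_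
      rw [mul_pow, Real.sq_sqrt ENNReal.toReal_nonneg, ENNReal.ofReal_mul ENNReal.toReal_nonneg,
        ENNReal.ofReal_toReal h.ne, mul_comm, ENNReal.ofReal_pow (norm_nonneg _), ofReal_norm]
      exact hsENormSq_comp_le B _

theorem toCLM_restrictHS (h : hsENormSq (RKSpace.incl Q) < ∞) (B : U →L[ℝ] G) :
    (restrictHS h B).toCLM = B ∘L RKSpace.incl Q := rfl

theorem hsENormSq_rankOne (y : F) (x : E) :
    hsENormSq (InnerProductSpace.rankOne ℝ y x) = ‖y‖ₑ ^ 2 * ‖x‖ₑ ^ 2 := by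
  rw [hsENormSq, ← HilbertBasis.tsum_enorm_inner_sq (hsBasis E) x, ← ENNReal.tsum_mul_left]
  refine tsum_congr fun i => ?_
  rw [InnerProductSpace.rankOne_apply, enorm_smul, mul_pow, mul_comm, real_inner_comm]

/-- The rank one operator `⟪x, ·⟫ y` as a Hilbert–Schmidt operator. -/
def HilbertSchmidt.rankOne (y : F) (x : E) : HilbertSchmidt E F :=
  ⟨InnerProductSpace.rankOne ℝ y x, (hsENormSq_lt_top_iff _).1 (by
    rw [hsENormSq_rankOne]
    exact ENNReal.mul_lt_top (by simp) (by simp))⟩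

/-- The embedding `toLp` into ℓ² is an isometry, and in ℓ² every element is the sum of its
coordinates. The i-th coordinate is the image of a rank one operator. -/
theorem HilbertSchmidt.hasSum_rankOne (A : HilbertSchmidt E F) :
    HasSum (fun i => HilbertSchmidt.rankOne (A.toCLM (hsBasis E i)) (hsBasis E i)) A := by
  have hiso : Isometry (HilbertSchmidt.toLp : HilbertSchmidt E F →ₗ[ℝ] _) :=
    AddMonoidHomClass.isometry_of_norm _ fun _ => rfl
  classical
  have h := lp.hasSum_single (p := 2) (by norm_num) (HilbertSchmidt.toLp A)
  have h2 : ∀ i, lp.single (E := fun _ : hsIndex E => F) 2 i (HilbertSchmidt.toLp A i)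
      = HilbertSchmidt.toLp (HilbertSchmidt.rankOne (A.toCLM (hsBasis E i)) (hsBasis E i)) := by
    intro i
    refine lp.ext (funext fun j => ?_)
    change _ = InnerProductSpace.rankOne ℝ (A.toCLM (hsBasis E i)) (hsBasis E i) (hsBasis E j)
    rw [InnerProductSpace.rankOne_apply, lp.coeFn_single,
      orthonormal_iff_ite.1 (hsBasis E).orthonormal i j]
    rcases eq_or_ne i j with rfl | hij
    · simp only [if_true, one_smul, Pi.single_eq_same]
      rfl
    · simp [hij, hij.symm]
  simp_rw [h2] at h
  rw [HasSum, hiso.isEmbedding.tendsto_nhds_iff]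
  refine h.congr fun s => ?_
  simp

/-- The orthogonal complement of this range is the kernel of the inclusion, which is injective. -/
theorem dense_range_adjoint_incl : DenseRange (RKSpace.incl Q).adjoint := by
  have h := ContinuousLinearMap.orthogonal_range (RKSpace.incl Q).adjoint
  rw [ContinuousLinearMap.adjoint_adjoint] at h
  have hk : LinearMap.ker (RKSpace.incl Q).toLinearMap = ⊥ := by
    rw [LinearMap.ker_eq_bot']
    intro m hm
    exact Subtype.ext hm
  have h2 := h.trans hk
  have h3 := (Submodule.topologicalClosure_eq_top_iff).2 h2
  exact Submodule.dense_iff_topologicalClosure_eq_top.2 h3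

/-- Simple processes take values in L(U; H) whereas integrands take values in L₂(U₀; H); this
bridges the gap. Rank one operators have dense span, and ⟪x, ·⟫ y with x = incl* z is the
restriction of ⟪z, ·⟫ y, such x being dense in U₀. -/
theorem dense_range_restrictHS (h : hsENormSq (RKSpace.incl Q) < ∞) :
    DenseRange (restrictHS (G := G) h) := by
  have hmem : ∀ (y : G) (x : RKSpace Q), HilbertSchmidt.rankOne y x ∈
      (LinearMap.range (restrictHS (G := G) h).toLinearMap).topologicalClosure := by
    intro y x
    change _ ∈ closure _
    rw [Metric.mem_closure_iff]
    intro ε hε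
    -- The error will be ‖y‖ ‖x - incl* z‖; adding 1 avoids a division by zero.
    obtain ⟨z, hz⟩ := (dense_range_adjoint_incl (Q := Q)).exists_dist_lt x
      (ε := ε / (‖y‖ + 1)) (by positivity)
    refine ⟨restrictHS h (InnerProductSpace.rankOne ℝ y z), ⟨_, rfl⟩, ?_⟩
    have hsub : (HilbertSchmidt.rankOne y x - restrictHS h (InnerProductSpace.rankOne ℝ y z)).toCLM
        = InnerProductSpace.rankOne ℝ y (x - (RKSpace.incl Q).adjoint z) := by
      rw [map_sub, toCLM_restrictHS]
      ext u
      change InnerProductSpace.rankOne ℝ y x u - InnerProductSpace.rankOne ℝ y z (RKSpace.incl Q u)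
        = _
      simp only [InnerProductSpace.rankOne_apply]
      rw [inner_sub_left, ContinuousLinearMap.adjoint_inner_left, sub_smul]
    rw [dist_eq_norm]
    rw [dist_eq_norm] at hz
    refine (HilbertSchmidt.norm_sq_le (c := ‖y‖ * ‖x - (RKSpace.incl Q).adjoint z‖)
      (by positivity) ?_).trans_lt ?_
    · rw [hsub, hsENormSq_rankOne, mul_pow, ENNReal.ofReal_mul (by positivity),
        ENNReal.ofReal_pow (norm_nonneg _), ENNReal.ofReal_pow (norm_nonneg _), ofReal_norm,
        ofReal_norm]
    · calc ‖y‖ * ‖x - (RKSpace.incl Q).adjoint z‖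
          ≤ (‖y‖ + 1) * ‖x - (RKSpace.incl Q).adjoint z‖ := by gcongr; linarith
        _ < (‖y‖ + 1) * (ε / (‖y‖ + 1)) := by gcongr
        _ = ε := by field_simp
  rw [DenseRange]
  have : Dense ((LinearMap.range (restrictHS (G := G) h).toLinearMap :
      Submodule ℝ _) : Set (HilbertSchmidt (RKSpace Q) G)) := by
    rw [Submodule.dense_iff_topologicalClosure_eq_top, eq_top_iff]
    intro A _
    have hA := HilbertSchmidt.hasSum_rankOne A
    exact (Submodule.isClosed_topologicalClosure _).mem_of_tendsto hA
      (Eventually.of_forall fun s => Submodule.sum_mem _ fun i _ => hmem _ _)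
  exact this

end HS

/-! ### Increments of a Wiener process -/

/-- Basis vectors are √2 apart, so the balls of radius 1/2 around them are disjoint. Countability
lets expectations be exchanged with coordinate sums. -/
theorem HilbertBasis.countable_of_separable {ι E : Type*} [NormedAddCommGroup E]
    [InnerProductSpace ℝ E] [SecondCountableTopology E] (b : HilbertBasis ι ℝ E) :
    Countable ι := by
  refine Pairwise.countable_of_isOpen_disjoint (s := fun i => Metric.ball (b i) (1 / 2)) ?_
    (fun _ => Metric.isOpen_ball) (fun i => ⟨b i, by simp⟩)
  intro i j hij
  refine Metric.ball_disjoint_ball ?_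
  have h : ‖b i - b j‖ ^ 2 = 2 := by
    rw [norm_sub_sq_real, b.orthonormal.1 i, b.orthonormal.1 j, b.orthonormal.2 hij]
    norm_num
  rw [dist_eq_norm]
  nlinarith [norm_nonneg (b i - b j)]

/-- Independence of increments is used along monotone sequences of times. The sequence lists J, then
u at index n, then stays at t, so that the n-th increment is the one from u to t. -/
theorem exists_monotone_seq_of_finset {α : Type*} [LinearOrder α] (J : Finset α) {u t : α}
    (hJ : ∀ j ∈ J, j ≤ u) (hut : u ≤ t) :
    ∃ (n : ℕ) (τ : ℕ → α), Monotone τ ∧ (∀ j ∈ J, ∃ k < n, τ k = j) ∧ (∀ k < n, τ k ∈ J) ∧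
      τ n = u ∧ τ (n + 1) = t := by
  refine ⟨J.card, fun k => if h : k < J.card then J.orderEmbOfFin rfl ⟨k, h⟩ else
    if k = J.card then u else t, ?_, ?_, ?_, ?_, ?_⟩
  · refine monotone_nat_of_le_succ fun k => ?_
    rcases lt_trichotomy (k + 1) J.card with h | h | h
    · rw [dif_pos h, dif_pos (by omega)]
      exact (J.orderEmbOfFin rfl).monotone (by simp)
    · have hk : k < J.card := by omega
      have hk1 : ¬ k + 1 < J.card := by omega
      rw [dif_pos hk, dif_neg hk1, if_pos h]
      exact hJ _ (J.orderEmbOfFin_mem rfl _)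
    · have hk : ¬ k < J.card := by omega
      have hk1 : ¬ k + 1 < J.card := by omega
      have hk2 : ¬ k + 1 = J.card := by omega
      rw [dif_neg hk, dif_neg hk1, if_neg hk2]
      split_ifs
      · exact hut
      · exact le_rfl
  · intro j hj
    have : j ∈ Set.range (J.orderEmbOfFin rfl) := by
      rw [J.range_orderEmbOfFin rfl]; exact hj
    obtain ⟨k, rfl⟩ := this
    exact ⟨k, k.2, by simp⟩
  · intro k hk
    simp only [hk, dif_pos]
    exact J.orderEmbOfFin_mem rfl _
  · simp
  · simp

theorem ProbabilityTheory.Indep.setIntegral_comp {Ω β : Type*} {m mΩ : MeasurableSpace Ω}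
    {P : Measure Ω} [IsProbabilityMeasure P] {mβ : MeasurableSpace β} {X : Ω → β} (hm : m ≤ mΩ)
    (hX : Measurable X) (h : Indep m (mβ.comap X) P) {f : β → ℝ} (hf : StronglyMeasurable f)
    (hint : Integrable (fun ω => f (X ω)) P)
    {A : Set Ω} (hA : MeasurableSet[m] A) :
    ∫ ω in A, f (X ω) ∂P = P.real A * ∫ ω, f (X ω) ∂P := by
  have h1 := condExp_indep_eq (f := fun ω => f (X ω)) hX.comap_le hm
    (hf.comp_measurable (comap_measurable X)) h.symm
  rw [← setIntegral_condExp hm hint hA, setIntegral_congr_ae (hm _ hA) (h1.mono fun _ h _ => h),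
    setIntegral_const, smul_eq_mul]

theorem ProbabilityTheory.Indep.setLIntegral_comp {Ω β : Type*} {m mΩ : MeasurableSpace Ω}
    {P : Measure Ω} {mβ : MeasurableSpace β} {X : Ω → β} (hm : m ≤ mΩ)
    (hX : Measurable X) (h : Indep m (mβ.comap X) P) {f : β → ℝ≥0∞} (hf : Measurable f)
    {A : Set Ω} (hA : MeasurableSet[m] A) :
    ∫⁻ ω in A, f (X ω) ∂P = P A * ∫⁻ ω, f (X ω) ∂P := by
  have hA' : MeasurableSet A := hm _ hA
  have h1 : Measurable[m] (A.indicator (fun _ => (1 : ℝ≥0∞))) :=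
    (measurable_indicator_const_iff (1 : ℝ≥0∞)).2 hA
  have h := lintegral_mul_eq_lintegral_mul_lintegral_of_independent_measurableSpace
    (μ := P) (g := fun ω => f (X ω)) hm hX.comap_le h h1 (hf.comp (comap_measurable _))
  rw [lintegral_indicator_const hA', one_mul] at h
  rw [← h, ← lintegral_indicator hA']
  refine lintegral_congr fun ω => ?_
  by_cases hω : ω ∈ A <;> simp [hω]

section Wiener

variable {Ω : Type*} {mΩ : MeasurableSpace Ω} {P : Measure Ω} [IsProbabilityMeasure P]
  {U : Type*} [NormedAddCommGroup U] [InnerProductSpace ℝ U] [MeasurableSpace U] [BorelSpace U]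
  {Q : U →L[ℝ] U} {W : ℝ≥0 → Ω → U}

theorem IsQWiener.measurable_sub [SecondCountableTopology U] (hW : IsQWiener Q W P) (s t : ℝ≥0) :
    Measurable (fun ω => W t ω - W s ω) :=
  (hW.stronglyMeasurable t).measurable.sub (hW.stronglyMeasurable s).measurable

/-- It suffices to treat finitely many times up to u. Once time 0 is added to the grid, each W_j is
almost surely a sum of increments of index below n, by W₀ = 0, and W_t - W_u is the increment of
index n. -/
theorem IsQWiener.indep_natural [SecondCountableTopology U] (hW : IsQWiener Q W P) {u t : ℝ≥0}
    (hut : u ≤ t) :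
    Indep (Filtration.natural W hW.stronglyMeasurable u)
      (MeasurableSpace.comap (fun ω => W t ω - W u ω) inferInstance) P := by
  rw [Filtration.natural_eq_comap]
  refine IndepFun.process_indepFun (X := fun (j : Set.Iic u) ω => W j ω)
    (fun j => (hW.stronglyMeasurable j).measurable) (hW.measurable_sub u t) fun I => ?_
  obtain ⟨n, τ, hmono, hJ, hJ', hn, hn1⟩ := exists_monotone_seq_of_finset
    (insert 0 (I.image Subtype.val)) (u := u) (t := t) (by
      intro j hj
      rcases Finset.mem_insert.1 hj with rfl | hj
      · exact zero_le
      · obtain ⟨k, -, rfl⟩ := Finset.mem_image.1 hj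
        exact k.2) hut
  have h0 : τ 0 = 0 := by
    obtain ⟨k, -, hk⟩ := hJ 0 (Finset.mem_insert_self _ _)
    exact le_antisymm (hk ▸ hmono (Nat.zero_le k)) zero_le
  have hind := hW.indepIncrements.nat hmono
  have h1 := hind.indepFun_finset (Finset.range n) {n} (by simp)
    (fun i => hW.measurable_sub _ _)
  have hk : ∀ i : I, ∃ k < n, τ k = (i : Set.Iic u) := fun i =>
    hJ _ (Finset.mem_insert_of_mem (Finset.mem_image.2 ⟨i, i.2, rfl⟩))
  choose k hkn hkτ using hk
  have hψ : Measurable fun x : ({n} : Finset ℕ) → U => x ⟨n, Finset.mem_singleton_self n⟩ :=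
    measurable_pi_apply _
  have h2 := h1.comp (φ := fun x (i : I) => ∑ l : Fin (k i),
      x ⟨l, Finset.mem_range.2 (l.2.trans (hkn i))⟩)
    (ψ := fun x => x (⟨n, Finset.mem_singleton_self n⟩ : ({n} : Finset ℕ)))
    (by fun_prop)
    hψ
  have h3 : ((fun x => x ⟨n, Finset.mem_singleton_self n⟩) ∘ fun a (i : ({n} : Finset ℕ)) =>
      W (τ (i + 1)) a - W (τ i) a) = fun ω => W t ω - W u ω := by
    funext ω
    simp [hn, hn1]
  rw [h3] at h2
  refine h2.congr ?_ .rfl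
  filter_upwards [hW.zero] with ω hω
  funext i
  simp only [Function.comp_apply]
  rw [Fin.sum_univ_eq_sum_range (fun l => W (τ (l + 1)) ω - W (τ l) ω) (k i),
    Finset.sum_range_sub (fun l => W (τ l) ω), hkτ, h0, hω, sub_zero]

theorem exists_ae_eq_of_sup_null {m : MeasurableSpace Ω} {A : Set Ω}
    (hA : MeasurableSet[m ⊔ MeasurableSpace.generateFrom
      {A | MeasurableSet[mΩ] A ∧ P A = 0}] A) :
    ∃ B, MeasurableSet[m] B ∧ A =ᵐ[P] B := by
  have hle : m ⊔ MeasurableSpace.generateFrom {A | MeasurableSet[mΩ] A ∧ P A = 0}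
      ≤ eventuallyMeasurableSpace m (ae P) := by
    refine sup_le (le_eventuallyMeasurableSpace) (MeasurableSpace.generateFrom_le ?_)
    rintro s ⟨-, hs⟩
    exact ⟨∅, MeasurableSet.empty, ae_eq_empty.2 hs⟩
  exact hle _ hA

theorem IsQWiener.indep_addNullSets [SecondCountableTopology U] (hW : IsQWiener Q W P) {u t : ℝ≥0}
    (hut : u ≤ t) :
    Indep (addNullSets (Filtration.natural W hW.stronglyMeasurable) P u)
      (MeasurableSpace.comap (fun ω => W t ω - W u ω) inferInstance) P := by
  rw [Indep_iff]
  intro A B hA hB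
  obtain ⟨A', hA', hAA'⟩ :=
    exists_ae_eq_of_sup_null (P := P) (m := Filtration.natural W hW.stronglyMeasurable u) hA
  rw [measure_congr hAA', measure_congr (hAA'.inter (ae_eq_refl B))]
  exact (Indep_iff _ _ _).1 (hW.indep_natural hut) _ _ hA' hB

theorem rightCont_le_of_lt (𝓖 : Filtration ℝ≥0 mΩ) {s u : ℝ≥0} (h : s < u) :
    𝓖.rightCont s ≤ 𝓖 u := by
  rw [Filtration.rightCont_eq]
  exact iInf₂_le u h

/-- For uₙ ↓ s strictly, the right limit σ-algebra at s is contained in the one at uₙ, which is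
independent of W_t - W_{uₙ}. Tested on bounded continuous functions, independence survives the limit
by path continuity. -/
theorem IsQWiener.indep_rightCont [SecondCountableTopology U] (hW : IsQWiener Q W P) {s t : ℝ≥0}
    (hst : s ≤ t) :
    Indep ((addNullSets (Filtration.natural W hW.stronglyMeasurable) P).rightCont s)
      (MeasurableSpace.comap (fun ω => W t ω - W s ω) inferInstance) P := by
  -- For s = t the increment is constant and generates the trivial σ-algebra; otherwise the uₙ can
  -- be taken inside (s, t).
  rcases hst.eq_or_lt with rfl | hst
  · simp only [sub_self, MeasurableSpace.comap_const]
    exact indep_bot_right _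
  refine indep_comap_of_bcf (Filtration.le _ _) (hW.measurable_sub s t).aemeasurable
    fun A hA f => ?_
  obtain ⟨u, -, hu, hlim⟩ := exists_seq_strictAnti_tendsto' hst
  have hmeas : ∀ a : ℝ≥0, StronglyMeasurable (fun ω => f (W t ω - W a ω)) := fun a =>
    (f.continuous.measurable.comp (hW.measurable_sub a t)).stronglyMeasurable
  have hbd : ∀ (a : ℝ≥0) (μ : Measure Ω), ∀ᵐ ω ∂μ, ‖f (W t ω - W a ω)‖ ≤ ‖f‖ := fun a μ =>
    ae_of_all _ fun ω => f.norm_coe_le_norm _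
  have hconv : ∀ᵐ ω ∂P, Tendsto (fun n => f (W t ω - W (u n) ω)) atTop (𝓝 (f (W t ω - W s ω))) := by
    filter_upwards [hW.continuous] with ω hω
    exact (f.continuous.tendsto _).comp (tendsto_const_nhds.sub ((hω.tendsto s).comp hlim))
  have h1 : Tendsto (fun n => ∫ ω in A, f (W t ω - W (u n) ω) ∂P) atTop
      (𝓝 (∫ ω in A, f (W t ω - W s ω) ∂P)) :=
    tendsto_integral_of_dominated_convergence (fun _ => ‖f‖)
      (fun n => (hmeas _).aestronglyMeasurable) (integrable_const _) (fun n => hbd _ _)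
      (ae_restrict_of_ae hconv)
  have h2 : Tendsto (fun n => ∫ ω, f (W t ω - W (u n) ω) ∂P) atTop
      (𝓝 (∫ ω, f (W t ω - W s ω) ∂P)) :=
    tendsto_integral_of_dominated_convergence (fun _ => ‖f‖)
      (fun n => (hmeas _).aestronglyMeasurable) (integrable_const _) (fun n => hbd _ _) hconv
  refine tendsto_nhds_unique h1 ((h2.const_mul (P.real A)).congr fun n => Eq.symm ?_)
  exact (hW.indep_addNullSets (hu n).2.le).setIntegral_comp (Filtration.le _ _)
    (hW.measurable_sub _ _) (f := f) f.continuous.measurable.stronglyMeasurable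
    (Integrable.of_bound (hmeas _).aestronglyMeasurable ‖f‖ (hbd _ _))
    (rightCont_le_of_lt _ (hu n).1 _ hA)

theorem IsQWiener.lintegral_inner_sq [SecondCountableTopology U] (hW : IsQWiener Q W P)
    {s t : ℝ≥0} (hst : s ≤ t) (h : U) :
    ∫⁻ ω, ‖⟪h, W t ω - W s ω⟫‖ₑ ^ 2 ∂P = (t - s : ℝ≥0) * ENNReal.ofReal ⟪Q h, h⟫ := by
  have hl := hW.gaussian s t hst h
  have hm : MemLp (fun ω => ⟪W t ω - W s ω, h⟫) 2 P := by
    have := (memLp_id_gaussianReal (μ := 0) (v := (t - s) * ⟪Q h, h⟫.toNNReal) 2)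
    rw [← hl.map_eq] at this
    exact this.comp_of_map hl.aemeasurable
  have hv := hl.variance_eq
  rw [variance_id_gaussianReal, variance_eq_integral hl.aemeasurable] at hv
  have hz : ∫ ω, ⟪W t ω - W s ω, h⟫ ∂P = 0 := by
    rw [hl.integral_eq, integral_id_gaussianReal]
  simp only [hz, sub_zero] at hv
  have h2 := ofReal_integral_eq_lintegral_ofReal (f := fun ω => ⟪W t ω - W s ω, h⟫ ^ 2)
    (hm.integrable_sq) (ae_of_all _ fun ω => sq_nonneg _)
  rw [hv] at h2
  have h3 : ∀ ω, ‖⟪h, W t ω - W s ω⟫‖ₑ ^ 2 = ENNReal.ofReal (⟪W t ω - W s ω, h⟫ ^ 2) := by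
    intro ω
    rw [real_inner_comm, ← sq_abs, ENNReal.ofReal_pow (abs_nonneg _), ← Real.norm_eq_abs,
      ofReal_norm]
  simp_rw [h3]
  rw [← h2, ENNReal.ofReal_coe_nnreal, ENNReal.coe_mul]
  rfl

variable [CompleteSpace U] [SecondCountableTopology U]
  {H : Type*} [NormedAddCommGroup H] [InnerProductSpace ℝ H] [CompleteSpace H]
  [SecondCountableTopology H]

theorem lintegral_enorm_sq_eq_tsum [MeasurableSpace H] [BorelSpace H] {ι : Type*}
    (c : HilbertBasis ι ℝ H) {X : Ω → H} (hX : AEMeasurable X P) :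
    ∫⁻ ω, ‖X ω‖ₑ ^ 2 ∂P = ∑' i, ∫⁻ ω, ‖⟪c i, X ω⟫‖ₑ ^ 2 ∂P := by
  have := c.countable_of_separable
  rw [← lintegral_tsum fun i => by fun_prop]
  exact lintegral_congr fun ω => (HilbertBasis.tsum_enorm_inner_sq c _).symm

/-- Parseval in H reduces to the variances of ⟪B* cⱼ, W_t - W_s⟫, whose sum is given by
`hsENormSq_comp_incl`. -/
theorem IsQWiener.lintegral_apply_sq (hW : IsQWiener Q W P) (hQ : Q.IsPositive)
    {s t : ℝ≥0} (hst : s ≤ t) (B : U →L[ℝ] H) :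
    ∫⁻ ω, ‖B (W t ω - W s ω)‖ₑ ^ 2 ∂P = (t - s : ℝ≥0) * hsENormSq (B ∘L RKSpace.incl Q) := by
  borelize H
  rw [lintegral_enorm_sq_eq_tsum (X := fun ω => B (W t ω - W s ω)) (hsBasis H)
    (B.continuous.measurable.comp (hW.measurable_sub s t)).aemeasurable,
    hsENormSq_comp_incl hQ (hsBasis H), ← ENNReal.tsum_mul_left]
  refine tsum_congr fun j => ?_
  rw [← hW.lintegral_inner_sq hst]
  simp_rw [ContinuousLinearMap.adjoint_inner_left]

theorem memLp_two_of_lintegral_lt_top {E : Type*} [NormedAddCommGroup E] {α : Type*}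
    {mα : MeasurableSpace α} {μ : Measure α} {X : α → E}
    (hX : AEStronglyMeasurable X μ) (h : ∫⁻ ω, ‖X ω‖ₑ ^ 2 ∂μ < ∞) : MemLp X 2 μ := by
  refine ⟨hX, ?_⟩
  rw [eLpNorm_lt_top_iff_lintegral_rpow_enorm_lt_top (by norm_num) (by norm_num)]
  simpa using h

theorem IsQWiener.memLp_sub (hW : IsQWiener Q W P) (hQ : Q.IsPositive) (hQtr : IsTraceClass Q)
    {s t : ℝ≥0} (hst : s ≤ t) : MemLp (fun ω => W t ω - W s ω) 2 P := by
  refine memLp_two_of_lintegral_lt_top (hW.measurable_sub s t).stronglyMeasurable.aestronglyMeasurable ?_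
  have h := hW.lintegral_apply_sq hQ hst (ContinuousLinearMap.id ℝ U)
  simp only [ContinuousLinearMap.coe_id', id_eq, ContinuousLinearMap.id_comp] at h
  rw [h]
  exact ENNReal.mul_lt_top ENNReal.coe_lt_top (hsENormSq_incl_lt_top hQ hQtr)

theorem IsQWiener.integral_sub_eq_zero (hW : IsQWiener Q W P) (hQ : Q.IsPositive)
    (hQtr : IsTraceClass Q) {s t : ℝ≥0} (hst : s ≤ t) : ∫ ω, (W t ω - W s ω) ∂P = 0 := by
  refine ext_inner_left ℝ fun h => ?_
  rw [inner_zero_right, ← integral_inner ((hW.memLp_sub hQ hQtr hst).integrable (by norm_num)) h]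
  simp_rw [real_inner_comm _ h]
  rw [(hW.gaussian s t hst h).integral_eq, integral_id_gaussianReal]

end Wiener

/-! ### The filtration -/

section Filtration

variable {Ω : Type*} {mΩ : MeasurableSpace Ω} {P : Measure Ω} {T : ℝ≥0}

/-- The properties of a normal filtration carrying a `Q`-Wiener process that stochastic integration
uses. -/
structure IsWienerFor {U : Type*} [NormedAddCommGroup U] [InnerProductSpace ℝ U]
    [CompleteSpace U] (𝓕 : Filtration (Set.Iic T) mΩ)
    (Q : U →L[ℝ] U) (W : ℝ≥0 → Ω → U) (H : Type*) [NormedAddCommGroup H] [InnerProductSpace ℝ H]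
    (P : Measure Ω) : Prop where
  stronglyMeasurable : ∀ t : Set.Iic T, StronglyMeasurable[𝓕 t] (W t)
  continuous : ∀ᵐ ω ∂P, Continuous fun t => W t ω
  memLp : ∀ s t : Set.Iic T, s ≤ t → MemLp (fun ω => W t ω - W s ω) 2 P
  condExp : ∀ s t : Set.Iic T, s ≤ t → P[fun ω => W t ω - W s ω | 𝓕 s] =ᵐ[P] 0
  lintegral : ∀ s t : Set.Iic T, s ≤ t → ∀ (B : U →L[ℝ] H) (A : Set Ω), MeasurableSet[𝓕 s] A →
    ∫⁻ ω in A, ‖B (W t ω - W s ω)‖ₑ ^ 2 ∂P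
      = P A * (((t : ℝ≥0) - s : ℝ≥0) * hsENormSq (B ∘L RKSpace.incl Q))
  null : ∀ t A, MeasurableSet A → P A = 0 → MeasurableSet[𝓕 t] A
  incl_lt_top : hsENormSq (RKSpace.incl Q) < ∞

variable {U : Type*} [NormedAddCommGroup U] [InnerProductSpace ℝ U] [CompleteSpace U]
    [SecondCountableTopology U] [MeasurableSpace U] [BorelSpace U] {Q : U →L[ℝ] U}
    {W : ℝ≥0 → Ω → U}

theorem addNullSets_le_wienerFiltration (hW : ∀ t, StronglyMeasurable (W t)) (t : Set.Iic T) :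
    addNullSets (Filtration.natural W hW) P t ≤ wienerFiltration W hW P T t :=
  Filtration.le_rightCont _ _

theorem IsQWiener.isWienerFor [IsProbabilityMeasure P] (hW : IsQWiener Q W P)
    (hQ : Q.IsPositive) (hQtr : IsTraceClass Q)
    (H : Type*) [NormedAddCommGroup H] [InnerProductSpace ℝ H] [CompleteSpace H]
    [SecondCountableTopology H] :
    IsWienerFor (wienerFiltration W hW.stronglyMeasurable P T) Q W H P where
  stronglyMeasurable t := by
    have h := (Filtration.stronglyAdapted_natural hW.stronglyMeasurable (t : ℝ≥0))
    exact h.mono (le_sup_left.trans (addNullSets_le_wienerFiltration _ t))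
  continuous := hW.continuous
  memLp s t hst := hW.memLp_sub hQ hQtr hst
  condExp s t hst := by
    have h := condExp_indep_eq (f := fun ω => W t ω - W s ω) (hW.measurable_sub s t).comap_le
      (Filtration.le _ (s : ℝ≥0)) (comap_measurable _).stronglyMeasurable
      (hW.indep_rightCont hst).symm
    rw [hW.integral_sub_eq_zero hQ hQtr hst] at h
    exact h
  lintegral s t hst B A hA := by
    borelize H
    rw [← hW.lintegral_apply_sq hQ hst B]
    exact (hW.indep_rightCont hst).setLIntegral_comp (f := fun u : U => ‖B u‖ₑ ^ 2)
      (Filtration.le _ _) (hW.measurable_sub s t) (by fun_prop) hA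
  null t A hA hPA := by
    refine (le_sup_right.trans (addNullSets_le_wienerFiltration hW.stronglyMeasurable t)) _ ?_
    exact MeasurableSpace.measurableSet_generateFrom ⟨hA, hPA⟩
  incl_lt_top := hsENormSq_incl_lt_top hQ hQtr

end Filtration

/-! ### Orthogonality in `L²` -/

section Orthogonality

variable {Ω : Type*} {m mΩ : MeasurableSpace Ω} {P : Measure Ω}
  {H : Type*} [NormedAddCommGroup H] [InnerProductSpace ℝ H] [CompleteSpace H]

theorem MeasureTheory.MemLp.integrable_inner_of_two {X Y : Ω → H} (hX : MemLp X 2 P)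
    (hY : MemLp Y 2 P) : Integrable (fun ω => ⟪X ω, Y ω⟫) P := by
  have h := (hX.norm.integrable_sq.add hY.norm.integrable_sq)
  refine h.mono' (hX.1.inner hY.1) (ae_of_all _ fun ω => ?_)
  have := abs_real_inner_le_norm (X ω) (Y ω)
  simp only [Real.norm_eq_abs, Pi.add_apply]
  nlinarith [sq_nonneg (‖X ω‖ - ‖Y ω‖), sq_nonneg ‖X ω‖, sq_nonneg ‖Y ω‖]

theorem integral_inner_eq_zero_of_condExp [IsFiniteMeasure P] (hm : m ≤ mΩ) {X Y : Ω → H}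
    (hXm : StronglyMeasurable[m] X) (hX : MemLp X 2 P) (hY : MemLp Y 2 P)
    (h : P[Y | m] =ᵐ[P] 0) : ∫ ω, ⟪X ω, Y ω⟫ ∂P = 0 := by
  have h1 : P[fun ω => ⟪X ω, Y ω⟫ | m] =ᵐ[P] fun ω => ⟪X ω, P[Y | m] ω⟫ :=
    condExp_bilin_of_stronglyMeasurable_left (μ := P) (innerSL ℝ : H →L[ℝ] H →L[ℝ] ℝ) hXm
      (hX.integrable_inner_of_two hY) (hY.integrable (by norm_num))
  rw [← integral_condExp hm, integral_congr_ae (h1.trans (h.mono fun ω hω => ?_)), integral_zero]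
  simp only [hω, Pi.zero_apply, inner_zero_right]

theorem lintegral_enorm_sq_eq_ofReal {X : Ω → H} (hX : MemLp X 2 P) :
    ∫⁻ ω, ‖X ω‖ₑ ^ 2 ∂P = ENNReal.ofReal (∫ ω, ⟪X ω, X ω⟫ ∂P) := by
  rw [ofReal_integral_eq_lintegral_ofReal (hX.integrable_inner_of_two hX)
    (ae_of_all _ fun ω => real_inner_self_nonneg)]
  refine lintegral_congr fun ω => ?_
  rw [real_inner_self_eq_norm_sq, ENNReal.ofReal_pow (norm_nonneg _), ofReal_norm]

theorem lintegral_enorm_sum_sq {ι : Type*} [Fintype ι] {Y : ι → Ω → H}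
    (hY : ∀ i, MemLp (Y i) 2 P) (h : Pairwise fun i j => ∫ ω, ⟪Y i ω, Y j ω⟫ ∂P = 0) :
    ∫⁻ ω, ‖∑ i, Y i ω‖ₑ ^ 2 ∂P = ∑ i, ∫⁻ ω, ‖Y i ω‖ₑ ^ 2 ∂P := by
  have hS : MemLp (fun ω => ∑ i, Y i ω) 2 P := memLp_finsetSum _ fun i _ => hY i
  rw [lintegral_enorm_sq_eq_ofReal hS]
  simp_rw [lintegral_enorm_sq_eq_ofReal (hY _)]
  rw [← ENNReal.ofReal_sum_of_nonneg fun i _ => integral_nonneg fun ω => real_inner_self_nonneg]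
  congr 1
  simp_rw [sum_inner, inner_sum]
  rw [integral_finsetSum _ fun i _ => integrable_finsetSum _ fun j _ =>
    (hY i).integrable_inner_of_two (hY j)]
  refine Finset.sum_congr rfl fun i _ => ?_
  rw [integral_finsetSum _ fun j _ => (hY i).integrable_inner_of_two (hY j)]
  exact Finset.sum_eq_single i (fun j _ hj => h hj.symm) (by simp)

end Orthogonality

/-! ### Blocks of elementary integrals -/

section Block

variable {Ω : Type*} {mΩ : MeasurableSpace Ω} {P : Measure Ω} [IsProbabilityMeasure P] {T : ℝ≥0}
  {U : Type*} [NormedAddCommGroup U] [InnerProductSpace ℝ U] [CompleteSpace U]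
  {H : Type*} [NormedAddCommGroup H] [InnerProductSpace ℝ H] [CompleteSpace H]
  {𝓕 : Filtration (Set.Iic T) mΩ} {Q : U →L[ℝ] U} {W : ℝ≥0 → Ω → U}

/-- The integral of `X 1_{(a, b]}`. -/
def blockIntegral (W : ℝ≥0 → Ω → U) (X : Ω → U →L[ℝ] H) (a b t : Set.Iic T) (ω : Ω) : H :=
  X ω (W (min b t : Set.Iic T) ω - W (min a t : Set.Iic T) ω)

/-- Over (s, t] the block again contributes X applied to one increment of W, starting at max a s.
This start is after a, where X is known, and after s, where one conditions. The outer max makes the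
increment vanish when (a, b] and (s, t] do not meet. -/
theorem blockIntegral_sub (X : Ω → U →L[ℝ] H) {a b s t : Set.Iic T} (hab : a ≤ b) (hst : s ≤ t)
    (ω : Ω) : blockIntegral W X a b t ω - blockIntegral W X a b s ω =
      X ω (W (max (max a s) (min b t) : Set.Iic T) ω - W (max a s : Set.Iic T) ω) := by
  rw [blockIntegral, blockIntegral, ← map_sub]
  congr 1
  rcases le_total t a with hta | hta
  · have hsa := hst.trans hta
    simp [hta, hsa, hta.trans hab, hsa.trans hab]
  · rcases le_total b s with hbs | hbs
    · have hbt := hbs.trans hst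
      simp [hab.trans hbs, hbs, hbt, hab.trans hbt]
    · have h1 : max (max a s) (min b t) = min b t :=
        max_eq_right (max_le (le_min hab hta) (le_min hbs hst))
      rw [h1]
      rcases le_total a s with has | has
      · simp [has, hbs, hta]
      · simp [has, hbs, hta]

theorem blockIntegral_eq (X : Ω → U →L[ℝ] H) {a b : Set.Iic T} (hab : a ≤ b) (t : Set.Iic T)
    (ω : Ω) : blockIntegral W X a b t ω =
      X ω (W (max a (min b t) : Set.Iic T) ω - W a ω) := by
  have h := blockIntegral_sub (W := W) X hab (bot_le : ⊥ ≤ t) ω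
  have h0 : blockIntegral W X a b ⊥ ω = 0 := by simp [blockIntegral]
  rwa [h0, sub_zero, sup_bot_eq] at h

theorem exists_norm_le_of_finite_range {α E : Type*} [NormedAddCommGroup E] {X : α → E}
    (h : (Set.range X).Finite) : ∃ C : ℝ, ∀ x, ‖X x‖ ≤ C := by
  obtain ⟨C, hC⟩ := h.isBounded.exists_norm_le
  exact ⟨C, fun x => hC _ ⟨x, rfl⟩⟩

namespace IsWienerFor

variable (hW : IsWienerFor 𝓕 Q W H P) {X : Ω → U →L[ℝ] H} {a b s t : Set.Iic T}
include hW

theorem stronglyMeasurable_apply (hX : StronglyMeasurable[𝓕 t] X) (hat : a ≤ t) (hbt : b ≤ t) :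
    StronglyMeasurable[𝓕 t] (fun ω => X ω (W b ω - W a ω)) := by
  have h1 : StronglyMeasurable[𝓕 t] (fun ω => W b ω - W a ω) :=
    ((hW.stronglyMeasurable b).mono (𝓕.mono hbt)).sub
      ((hW.stronglyMeasurable a).mono (𝓕.mono hat))
  exact (isBoundedBilinearMap_apply (𝕜 := ℝ) (E := U) (F := H)).continuous.comp_stronglyMeasurable
    (hX.prodMk h1)

theorem memLp_apply (hX : StronglyMeasurable[𝓕 a] X) (hfin : (Set.range X).Finite) (hab : a ≤ b) :
    MemLp (fun ω => X ω (W b ω - W a ω)) 2 P := by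
  obtain ⟨C, hC⟩ := exists_norm_le_of_finite_range hfin
  refine (hW.memLp a b hab).of_le_mul (c := C) ?_ (ae_of_all _ fun ω => ?_)
  · exact ((hW.stronglyMeasurable_apply (hX.mono (𝓕.mono hab)) hab le_rfl).mono
      (𝓕.le b)).aestronglyMeasurable
  · exact ((X ω).le_opNorm _).trans (by gcongr; exact hC ω)

theorem condExp_apply (hX : StronglyMeasurable[𝓕 a] X) (hfin : (Set.range X).Finite)
    (hab : a ≤ b) : P[fun ω => X ω (W b ω - W a ω) | 𝓕 a] =ᵐ[P] 0 := by
  have h1 := condExp_bilin_of_stronglyMeasurable_left (μ := P)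
    (ContinuousLinearMap.id ℝ (U →L[ℝ] H)) hX
    ((hW.memLp_apply hX hfin hab).integrable (by norm_num))
    ((hW.memLp a b hab).integrable (by norm_num))
  refine h1.trans ((hW.condExp a b hab).mono fun ω hω => ?_)
  simp [hω]

/-- Split Ω by the finitely many values of X. On each piece, which lies in 𝓕_a, the operator is
constant and the second moment formula for increments applies. -/
theorem lintegral_apply_sq (hX : StronglyMeasurable[𝓕 a] X) (hfin : (Set.range X).Finite)
    (hab : a ≤ b) : ∫⁻ ω, ‖X ω (W b ω - W a ω)‖ₑ ^ 2 ∂P =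
      ∫⁻ ω, ((b : ℝ≥0) - a : ℝ≥0) * hsENormSq (X ω ∘L RKSpace.incl Q) ∂P := by
  borelize (U →L[ℝ] H)
  have hU : (⋃ c ∈ hfin.toFinset, X ⁻¹' {c}) = Set.univ := by
    ext ω; simp
  have hmeas : ∀ c, MeasurableSet[𝓕 a] (X ⁻¹' {c}) := fun c =>
    hX.measurable (measurableSet_singleton c)
  have hsplit : ∀ f : Ω → ℝ≥0∞, ∫⁻ ω, f ω ∂P = ∑ c ∈ hfin.toFinset, ∫⁻ ω in X ⁻¹' {c}, f ω ∂P := by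
    intro f
    rw [← lintegral_biUnion_finset _ (fun c _ => 𝓕.le a _ (hmeas c)), hU, setLIntegral_univ]
    intro c _ d _ hcd
    exact Set.disjoint_left.2 fun ω hc hd => hcd (hc.symm.trans hd)
  rw [hsplit, hsplit]
  refine Finset.sum_congr rfl fun c _ => ?_
  have h1 : ∫⁻ ω in X ⁻¹' {c}, ‖X ω (W b ω - W a ω)‖ₑ ^ 2 ∂P
      = ∫⁻ ω in X ⁻¹' {c}, ‖c (W b ω - W a ω)‖ₑ ^ 2 ∂P :=
    setLIntegral_congr_fun (𝓕.le a _ (hmeas c)) fun ω hω => by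
      have : X ω = c := hω
      simp only [this]
  have h2 : ∫⁻ ω in X ⁻¹' {c}, ((b : ℝ≥0) - a : ℝ≥0) * hsENormSq (X ω ∘L RKSpace.incl Q) ∂P
      = ∫⁻ ω in X ⁻¹' {c}, ((b : ℝ≥0) - a : ℝ≥0) * hsENormSq (c ∘L RKSpace.incl Q) ∂P :=
    setLIntegral_congr_fun (𝓕.le a _ (hmeas c)) fun ω hω => by
      have : X ω = c := hω
      simp only [this]
  rw [h1, h2, hW.lintegral a b hab c _ (hmeas c), setLIntegral_const, mul_comm]

theorem stronglyMeasurable_block (hX : StronglyMeasurable[𝓕 a] X) (hab : a ≤ b)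
    (t : Set.Iic T) : StronglyMeasurable[𝓕 t] (blockIntegral W X a b t) := by
  rcases le_total t a with hta | hta
  · have : blockIntegral W X a b t = fun _ => 0 := by
      funext ω
      simp [blockIntegral, hta, hta.trans hab]
    rw [this]
    exact stronglyMeasurable_const
  · exact hW.stronglyMeasurable_apply (hX.mono (𝓕.mono hta)) (min_le_right _ _) (min_le_right _ _)

theorem memLp_block (hX : StronglyMeasurable[𝓕 a] X) (hfin : (Set.range X).Finite) (hab : a ≤ b)
    (t : Set.Iic T) : MemLp (blockIntegral W X a b t) 2 P := by
  have h : blockIntegral W X a b t = _ := funext fun ω => blockIntegral_eq X hab t ω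
  rw [h]
  exact hW.memLp_apply hX hfin (le_max_left _ _)

theorem stronglyMeasurable_block_end (hX : StronglyMeasurable[𝓕 a] X) (hab : a ≤ b)
    (t : Set.Iic T) : StronglyMeasurable[𝓕 b] (blockIntegral W X a b t) := by
  have h : blockIntegral W X a b t = _ := funext fun ω => blockIntegral_eq X hab t ω
  rw [h]
  exact hW.stronglyMeasurable_apply (hX.mono (𝓕.mono hab)) hab (max_le hab (min_le_left _ _))

theorem condExp_block (hX : StronglyMeasurable[𝓕 a] X) (hfin : (Set.range X).Finite) (hab : a ≤ b)
    (t : Set.Iic T) : P[blockIntegral W X a b t | 𝓕 a] =ᵐ[P] 0 := by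
  have h : blockIntegral W X a b t = _ := funext fun ω => blockIntegral_eq X hab t ω
  rw [h]
  exact hW.condExp_apply hX hfin (le_max_left _ _)

/-- Condition first on the σ-algebra at max a s, where the increment has mean zero, then on 𝓕_s by
the tower property. -/
theorem condExp_block_sub (hX : StronglyMeasurable[𝓕 a] X) (hfin : (Set.range X).Finite)
    (hab : a ≤ b) (hst : s ≤ t) :
    P[blockIntegral W X a b t - blockIntegral W X a b s | 𝓕 s] =ᵐ[P] 0 := by
  have h : blockIntegral W X a b t - blockIntegral W X a b s = _ :=
    funext fun ω => blockIntegral_sub X hab hst ω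
  rw [h]
  have h1 := hW.condExp_apply (b := max (max a s) (min b t)) (hX.mono (𝓕.mono (le_max_left a s)))
    hfin (le_max_left _ _)
  have h2 := condExp_condExp_of_le (μ := P)
    (f := fun ω => X ω (W (max (max a s) (min b t) : Set.Iic T) ω - W (max a s : Set.Iic T) ω))
    (𝓕.mono (le_max_right a s)) (𝓕.le _)
  refine h2.symm.trans ((condExp_congr_ae h1).trans ?_)
  rw [condExp_zero]

theorem lintegral_block_sq (hX : StronglyMeasurable[𝓕 a] X) (hfin : (Set.range X).Finite)
    (hab : a ≤ b) (t : Set.Iic T) : ∫⁻ ω, ‖blockIntegral W X a b t ω‖ₑ ^ 2 ∂P =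
      ∫⁻ ω, ((max a (min b t) : Set.Iic T) - a : ℝ≥0) * hsENormSq (X ω ∘L RKSpace.incl Q) ∂P := by
  simp_rw [blockIntegral_eq X hab t]
  exact hW.lintegral_apply_sq hX hfin (le_max_left _ _)

end IsWienerFor

end Block

/-! ### The time measure -/

section TimeMeasure

variable {T : ℝ≥0}

theorem measurableEmbedding_time : MeasurableEmbedding (fun t : Set.Iic T => ((t : ℝ≥0) : ℝ)) :=
  (MeasurableEmbedding.subtype_coe (measurableSet_Ici : MeasurableSet (Set.Ici (0 : ℝ)))).comp
    (MeasurableEmbedding.subtype_coe (measurableSet_Iic : MeasurableSet (Set.Iic T)))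

theorem timeMeasure_Ioc (a b : Set.Iic T) :
    timeMeasure T (Set.Ioc a b) = ((b : ℝ≥0) - a : ℝ≥0) := by
  rw [timeMeasure, measurableEmbedding_time.comap_apply]
  have : (fun t : Set.Iic T => ((t : ℝ≥0) : ℝ)) '' Set.Ioc a b
      = Set.Ioc ((a : ℝ≥0) : ℝ) ((b : ℝ≥0) : ℝ) := by
    ext x
    constructor
    · rintro ⟨t, ⟨h1, h2⟩, rfl⟩
      exact ⟨h1, h2⟩
    · rintro ⟨h1, h2⟩
      have hx : 0 ≤ x := (NNReal.coe_nonneg _).trans h1.le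
      have hb : (⟨x, hx⟩ : ℝ≥0) ≤ (b : ℝ≥0) := h2
      exact ⟨⟨⟨x, hx⟩, hb.trans b.2⟩, ⟨h1, h2⟩, rfl⟩
  rw [this, Real.volume_Ioc, ENNReal.ofReal, NNReal.sub_def]

theorem timeMeasure_singleton (a : Set.Iic T) : timeMeasure T {a} = 0 := by
  rw [timeMeasure, measurableEmbedding_time.comap_apply, Set.image_singleton]
  exact Real.volume_singleton

instance : NullSingletonClass (timeMeasure T) := ⟨timeMeasure_singleton⟩

instance : IsFiniteMeasure (timeMeasure T) := by
  refine ⟨?_⟩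
  have h : (Set.univ : Set (Set.Iic T)) ⊆ {⊥} ∪ Set.Ioc ⊥ ⊤ := by
    intro t _
    rcases eq_bot_or_bot_lt t with h | h
    · exact Or.inl h
    · exact Or.inr ⟨h, le_top⟩
  refine (measure_mono h).trans_lt ((measure_union_le _ _).trans_lt ?_)
  rw [timeMeasure_singleton, timeMeasure_Ioc, zero_add]
  exact ENNReal.coe_lt_top

theorem timeMeasure_Ioc_inter_Iic {a b : Set.Iic T} (t : Set.Iic T) :
    (timeMeasure T).restrict (Set.Iic t) (Set.Ioc a b)
      = ((max a (min b t) : Set.Iic T) - a : ℝ≥0) := by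
  rw [Measure.restrict_apply measurableSet_Ioc, Set.Ioc_inter_Iic, timeMeasure_Ioc]
  rcases le_total a (min b t) with h | h
  · simp only [max_eq_right h]
  · simp only [max_eq_left h]
    rw [tsub_self, tsub_eq_zero_of_le]
    exact h

end TimeMeasure

/-! ### The Itô isometry for simple processes -/

namespace SimpleProcess

variable {Ω : Type*} {mΩ : MeasurableSpace Ω} {P : Measure Ω} {T : ℝ≥0}
  {U : Type*} [NormedAddCommGroup U] [InnerProductSpace ℝ U]
  {H : Type*} [NormedAddCommGroup H] [InnerProductSpace ℝ H]
  {𝓕 : Filtration (Set.Iic T) mΩ} {Q : U →L[ℝ] U} {W : ℝ≥0 → Ω → U}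

theorem time_le (ψ : SimpleProcess 𝓕 U H) (m : Fin (ψ.N + 1)) :
    ψ.time m.castSucc ≤ ψ.time m.succ :=
  ψ.time_strictMono.monotone (Fin.castSucc_lt_succ).le

theorem time_succ_le (ψ : SimpleProcess 𝓕 U H) {m m' : Fin (ψ.N + 1)} (h : m < m') :
    ψ.time m.succ ≤ ψ.time m'.castSucc :=
  ψ.time_strictMono.monotone (Fin.succ_le_castSucc_iff.2 h)

theorem integral_eq_sum_block (ψ : SimpleProcess 𝓕 U H) (t : Set.Iic T) (ω : Ω) :
    ψ.integral W t ω =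
      ∑ m, blockIntegral W (ψ.value m) (ψ.time m.castSucc) (ψ.time m.succ) t ω := rfl

theorem eval_of_mem (ψ : SimpleProcess 𝓕 U H) {t : Set.Iic T} {m : Fin (ψ.N + 1)}
    (h : t ∈ Set.Ioc (ψ.time m.castSucc) (ψ.time m.succ)) (ω : Ω) :
    ψ.eval t ω = ψ.value m ω := by
  have ht : t ≠ ⊥ := (bot_le.trans_lt h.1).ne'
  rw [eval, if_neg ht, zero_add, Finset.sum_eq_single m, if_pos h]
  · intro m' _ hm'
    refine if_neg fun h' => ?_
    rcases lt_or_gt_of_ne hm' with hlt | hlt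
    · exact absurd (h.1.trans_le (h'.2.trans (ψ.time_succ_le hlt))) (lt_irrefl _)
    · exact absurd (h'.1.trans_le (h.2.trans (ψ.time_succ_le hlt))) (lt_irrefl _)
  · simp

/-- The intervals are disjoint, so at most one summand is nonzero and the square passes inside the
sum. Time 0 is excluded because of the separate value there; it is a null set for the time measure.
-/
theorem hsENormSq_eval [CompleteSpace U] (ψ : SimpleProcess 𝓕 U H) {t : Set.Iic T} (ht : t ≠ ⊥)
    (ω : Ω) :
    hsENormSq (ψ.eval t ω ∘L RKSpace.incl Q) =
      ∑ m : Fin (ψ.N + 1), (Set.Ioc (ψ.time m.castSucc) (ψ.time m.succ)).indicator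
        (fun _ => hsENormSq (ψ.value m ω ∘L RKSpace.incl Q)) t := by
  by_cases h : ∃ m : Fin (ψ.N + 1), t ∈ Set.Ioc (ψ.time m.castSucc) (ψ.time m.succ)
  · obtain ⟨m, hm⟩ := h
    rw [ψ.eval_of_mem hm, Finset.sum_eq_single m, Set.indicator_of_mem hm]
    · intro m' _ hm'
      refine Set.indicator_of_notMem (fun h' => ?_) _
      rcases lt_or_gt_of_ne hm' with hlt | hlt
      · exact absurd (hm.1.trans_le (h'.2.trans (ψ.time_succ_le hlt))) (lt_irrefl _)
      · exact absurd (h'.1.trans_le (hm.2.trans (ψ.time_succ_le hlt))) (lt_irrefl _)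
    · simp
  · push Not at h
    have h0 : ψ.eval t ω = 0 := by
      rw [eval, if_neg ht, zero_add]
      exact Finset.sum_eq_zero fun m _ => if_neg (h m)
    rw [h0, Finset.sum_eq_zero fun m _ => Set.indicator_of_notMem (h m) _]
    simp [hsENormSq]

theorem setLIntegral_hsENormSq_eval [CompleteSpace U] (ψ : SimpleProcess 𝓕 U H) (t : Set.Iic T)
    (ω : Ω) :
    ∫⁻ s in Set.Iic t, hsENormSq (ψ.eval s ω ∘L RKSpace.incl Q) ∂timeMeasure T =
      ∑ m, ((max (ψ.time m.castSucc) (min (ψ.time m.succ) t) : Set.Iic T)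
        - ψ.time m.castSucc : ℝ≥0) * hsENormSq (ψ.value m ω ∘L RKSpace.incl Q) := by
  have h1 : ∀ᵐ s ∂(timeMeasure T).restrict (Set.Iic t), s ≠ ⊥ :=
    ae_restrict_of_ae (by simp [ae_iff])
  rw [lintegral_congr_ae (h1.mono fun s hs => ψ.hsENormSq_eval hs ω), lintegral_finsetSum]
  · refine Finset.sum_congr rfl fun m _ => ?_
    rw [lintegral_indicator_const measurableSet_Ioc, timeMeasure_Ioc_inter_Iic, mul_comm]
  · exact fun m _ => measurable_const.indicator measurableSet_Ioc

variable [IsProbabilityMeasure P] [CompleteSpace U] [CompleteSpace H]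
  (hW : IsWienerFor 𝓕 Q W H P) (ψ : SimpleProcess 𝓕 U H)

include hW

theorem memLp_integral (t : Set.Iic T) : MemLp (ψ.integral W t) 2 P := by
  have h : ψ.integral W t = fun ω => ∑ m, blockIntegral W (ψ.value m) (ψ.time m.castSucc)
    (ψ.time m.succ) t ω := rfl
  rw [h]
  exact memLp_finsetSum _ fun m _ =>
    hW.memLp_block (ψ.measurable m) (ψ.finite_range m) (ψ.time_le m) t

theorem stronglyMeasurable_integral (t : Set.Iic T) :
    StronglyMeasurable[𝓕 t] (ψ.integral W t) :=
  Finset.stronglyMeasurable_fun_sum _ fun m _ =>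
    hW.stronglyMeasurable_block (ψ.measurable m) (ψ.time_le m) t

theorem continuous_integral : ∀ᵐ ω ∂P, Continuous fun t => ψ.integral W t ω := by
  filter_upwards [hW.continuous] with ω hω
  unfold integral
  fun_prop

/-- Of two distinct blocks, the earlier one is measurable at the starting time of the later one,
given which the later one has conditional mean zero. Hence blocks are orthogonal and only the
diagonal terms remain. -/
theorem lintegral_integral_sq (t : Set.Iic T) :
    ∫⁻ ω, ‖ψ.integral W t ω‖ₑ ^ 2 ∂P =
      ∫⁻ ω, ∫⁻ s in Set.Iic t, hsENormSq (ψ.eval s ω ∘L RKSpace.incl Q) ∂timeMeasure T ∂P := by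
  simp_rw [ψ.setLIntegral_hsENormSq_eval, integral_eq_sum_block]
  have hfin : ∀ m, Measurable fun ω => hsENormSq (ψ.value m ω ∘L RKSpace.incl Q) := by
    intro m
    -- Measurability comes from writing the norm as a continuous function of the operator.
    have h1 : ∀ B : U →L[ℝ] H, hsENormSq (B ∘L RKSpace.incl Q)
        = ‖restrictHS hW.incl_lt_top B‖ₑ ^ 2 := fun B => by
      rw [HilbertSchmidt.enorm_sq, toCLM_restrictHS]
    simp_rw [h1]
    exact (((restrictHS hW.incl_lt_top).continuous.comp_stronglyMeasurable
      ((ψ.measurable m).mono (𝓕.le _))).enorm).pow_const 2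
  rw [lintegral_finsetSum _ fun m _ => (hfin m).const_mul _, lintegral_enorm_sum_sq]
  · exact Finset.sum_congr rfl fun m _ =>
      hW.lintegral_block_sq (ψ.measurable m) (ψ.finite_range m) (ψ.time_le m) t
  · exact fun m => hW.memLp_block (ψ.measurable m) (ψ.finite_range m) (ψ.time_le m) t
  · have key : ∀ m m', m < m' → ∫ ω, ⟪blockIntegral W (ψ.value m) (ψ.time m.castSucc)
        (ψ.time m.succ) t ω, blockIntegral W (ψ.value m') (ψ.time m'.castSucc)
        (ψ.time m'.succ) t ω⟫ ∂P = 0 := by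
      intro m m' hmm
      refine integral_inner_eq_zero_of_condExp (𝓕.le (ψ.time m'.castSucc)) ?_
        (hW.memLp_block (ψ.measurable m) (ψ.finite_range m) (ψ.time_le m) t)
        (hW.memLp_block (ψ.measurable m') (ψ.finite_range m') (ψ.time_le m') t)
        (hW.condExp_block (ψ.measurable m') (ψ.finite_range m') (ψ.time_le m') t)
      exact (hW.stronglyMeasurable_block_end (ψ.measurable m) (ψ.time_le m) t).mono
        (𝓕.mono (ψ.time_succ_le hmm))
    intro m m' hmm
    rcases lt_or_gt_of_ne hmm with h | h
    · exact key m m' h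
    · exact (integral_congr_ae (ae_of_all _ fun ω => real_inner_comm _ _)).trans (key m' m h)

theorem condExp_integral_sub {s t : Set.Iic T} (hst : s ≤ t) :
    P[ψ.integral W t - ψ.integral W s | 𝓕 s] =ᵐ[P] 0 := by
  have h : ψ.integral W t - ψ.integral W s = ∑ m,
      (blockIntegral W (ψ.value m) (ψ.time m.castSucc) (ψ.time m.succ) t
        - blockIntegral W (ψ.value m) (ψ.time m.castSucc) (ψ.time m.succ) s) := by
    funext ω
    simp [integral_eq_sum_block]
  have hi : ∀ m, ∀ t, Integrable (blockIntegral W (ψ.value m) (ψ.time m.castSucc)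
      (ψ.time m.succ) t) P := fun m t =>
    (hW.memLp_block (ψ.measurable m) (ψ.finite_range m) (ψ.time_le m) t).integrable (by norm_num)
  rw [h]
  refine (condExp_finsetSum (fun m _ => (hi m t).sub (hi m s)) _).trans ?_
  have h0 : ∀ᵐ ω ∂P, ∀ m, P[blockIntegral W (ψ.value m) (ψ.time m.castSucc) (ψ.time m.succ) t
        - blockIntegral W (ψ.value m) (ψ.time m.castSucc) (ψ.time m.succ) s | 𝓕 s] ω = 0 :=
    ae_all_iff.2 fun m => hW.condExp_block_sub (ψ.measurable m) (ψ.finite_range m) (ψ.time_le m) hst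
  filter_upwards [h0] with ω hω
  simp [hω]

omit hW in
theorem martingale_of_condExp_sub {M : Set.Iic T → Ω → H}
    (hM : ∀ t, StronglyMeasurable[𝓕 t] (M t)) (hint : ∀ t, Integrable (M t) P)
    (h : ∀ s t, s ≤ t → P[M t - M s | 𝓕 s] =ᵐ[P] 0) : Martingale M 𝓕 P := by
  refine ⟨hM, fun s t hst => ?_⟩
  have h1 := condExp_sub (hint t) (hint s) (𝓕 s)
  have h2 := condExp_of_stronglyMeasurable (𝓕.le s) (hM s) (hint s)
  filter_upwards [h1, h s t hst] with ω h1 h3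
  rw [h3, h2] at h1
  simpa [sub_eq_zero] using h1.symm

theorem isContSqIntMartingale : IsContSqIntMartingale 𝓕 (ψ.integral W) P where
  martingale := martingale_of_condExp_sub (ψ.stronglyMeasurable_integral hW)
    (fun t => (ψ.memLp_integral hW t).integrable (by norm_num))
    fun _ _ hst => ψ.condExp_integral_sub hW hst
  continuous := ψ.continuous_integral hW
  sqIntegrable := ψ.memLp_integral hW
  zero := ae_of_all _ fun ω => by simp [integral]

end SimpleProcess

/-! ### Elementary processes -/

section Elementary

variable {Ω : Type*} {mΩ : MeasurableSpace Ω} {P : Measure Ω} {T : ℝ≥0}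
  {U : Type*} [NormedAddCommGroup U] [InnerProductSpace ℝ U]
  {H : Type*} [NormedAddCommGroup H] [InnerProductSpace ℝ H]

/-- `IsElementary 𝓕 W Y J` means that `Y` is a finite sum of processes `X 1_{(s, T]}` with `X`
finitely valued and `𝓕_s`-measurable, and `J` is the elementary stochastic integral of `Y`. -/
inductive IsElementary (𝓕 : Filtration (Set.Iic T) mΩ) (W : ℝ≥0 → Ω → U) :
    (Set.Iic T → Ω → U →L[ℝ] H) → (Set.Iic T → Ω → H) → Prop
  | zero : IsElementary 𝓕 W (fun _ _ => 0) (fun _ _ => 0)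
  | term_add {Y : Set.Iic T → Ω → U →L[ℝ] H} {J : Set.Iic T → Ω → H} (s : Set.Iic T)
      (X : Ω → U →L[ℝ] H) (hX : StronglyMeasurable[𝓕 s] X) (hfin : (Set.range X).Finite)
      (h : IsElementary 𝓕 W Y J) :
      IsElementary 𝓕 W (fun t ω => (Set.Ioi s).indicator (fun _ => X ω) t + Y t ω)
        (fun t ω => X ω (W t ω - W (min s t : Set.Iic T) ω) + J t ω)

variable {𝓕 : Filtration (Set.Iic T) mΩ} {W : ℝ≥0 → Ω → U}
  {Y Y' : Set.Iic T → Ω → U →L[ℝ] H} {J J' : Set.Iic T → Ω → H}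

namespace IsElementary

theorem congr (h : IsElementary 𝓕 W Y J) (hY : ∀ t ω, Y t ω = Y' t ω) (hJ : ∀ t ω, J t ω = J' t ω) :
    IsElementary 𝓕 W Y' J' := by
  have h1 : Y = Y' := funext fun t => funext fun ω => hY t ω
  have h2 : J = J' := funext fun t => funext fun ω => hJ t ω
  rwa [← h1, ← h2]

theorem term (s : Set.Iic T) (X : Ω → U →L[ℝ] H) (hX : StronglyMeasurable[𝓕 s] X)
    (hfin : (Set.range X).Finite) :
    IsElementary 𝓕 W (fun t ω => (Set.Ioi s).indicator (fun _ => X ω) t)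
      (fun t ω => X ω (W t ω - W (min s t : Set.Iic T) ω)) :=
  (zero.term_add s X hX hfin).congr (fun _ _ => add_zero _) fun _ _ => add_zero _

theorem add (h : IsElementary 𝓕 W Y J) (h' : IsElementary 𝓕 W Y' J') :
    IsElementary 𝓕 W (fun t ω => Y t ω + Y' t ω) (fun t ω => J t ω + J' t ω) := by
  induction h with
  | zero => exact h'.congr (fun _ _ => (zero_add _).symm) fun _ _ => (zero_add _).symm
  | term_add s X hX hfin _ ih =>
    exact (ih.term_add s X hX hfin).congr (fun _ _ => (add_assoc _ _ _).symm)
      fun _ _ => (add_assoc _ _ _).symm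

theorem sum {ι : Type*} (S : Finset ι) {Y : ι → Set.Iic T → Ω → U →L[ℝ] H}
    {J : ι → Set.Iic T → Ω → H} (h : ∀ i, IsElementary 𝓕 W (Y i) (J i)) :
    IsElementary 𝓕 W (fun t ω => ∑ i ∈ S, Y i t ω) (fun t ω => ∑ i ∈ S, J i t ω) := by
  classical
  induction S using Finset.induction_on with
  | empty => exact zero.congr (fun _ _ => by simp) fun _ _ => by simp
  | insert i S hi ih =>
    exact ((h i).add ih).congr (fun _ _ => by rw [Finset.sum_insert hi])
      fun _ _ => by rw [Finset.sum_insert hi]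

/-- A term X 1_{(s,T]} multiplied by 1_{(r,T]×A} is 1_A X 1_{(s∨r,T]}, again a term. Subtracting
such cuts is how a process is later stopped at a time with finitely many values. -/
theorem cut (h : IsElementary 𝓕 W Y J) (r : Set.Iic T) {A : Set Ω} (hA : MeasurableSet[𝓕 r] A) :
    IsElementary 𝓕 W (fun t ω => (Set.Ioi r).indicator (fun _ => A.indicator (Y t) ω) t)
      (fun t ω => A.indicator (fun ω => J t ω - J (min r t) ω) ω) := by
  induction h with
  | zero => exact zero.congr (fun _ _ => by simp) fun _ _ => by simp
  | @term_add Y J s X hX hfin _ ih =>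
    refine (ih.term_add (max s r) (A.indicator X)
      ((hX.mono (𝓕.mono (le_max_left s r))).indicator (𝓕.mono (le_max_right s r) _ hA))
      ((hfin.union (Set.finite_singleton 0)).subset ?_)).congr ?_ ?_
    · rintro _ ⟨ω, rfl⟩
      by_cases hω : ω ∈ A
      · exact Or.inl ⟨ω, by simp [hω]⟩
      · exact Or.inr (by simp [hω])
    · intro t ω
      by_cases hω : ω ∈ A <;> by_cases hs : s < t <;> by_cases hr : r < t <;>
        simp [hω, hs, hr, Set.indicator]
    · intro t ω
      by_cases hω : ω ∈ A
      · simp only [hω, Set.indicator_of_mem]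
        rcases le_total r s with hrs | hrs
        · have h1 : min s (min r t) = min r t := min_eq_right ((min_le_left _ _).trans hrs)
          rw [max_eq_left hrs, h1, sub_self, map_zero]
          abel
        · have h1 : min s (min r t) = min s t := by rw [← min_assoc, min_eq_left hrs]
          rw [max_eq_right hrs, h1]
          simp only [map_sub]
          abel
      · simp [hω]

theorem neg (h : IsElementary 𝓕 W Y J) :
    IsElementary 𝓕 W (fun t ω => - Y t ω) (fun t ω => - J t ω) := by
  induction h with
  | zero => exact zero.congr (fun _ _ => by simp) fun _ _ => by simp
  | term_add s X hX hfin _ ih =>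
    have hfin' : (Set.range (-X)).Finite :=
      (hfin.image (fun x => -x)).subset (by rintro _ ⟨ω, rfl⟩; exact ⟨X ω, ⟨ω, rfl⟩, rfl⟩)
    refine (ih.term_add s (-X) hX.neg hfin').congr (fun t ω => ?_) fun t ω => ?_
    · by_cases hs : s < t
      · simp [hs, add_comm]
      · simp [hs]
    · simp [add_comm]

theorem sub (h : IsElementary 𝓕 W Y J) (h' : IsElementary 𝓕 W Y' J') :
    IsElementary 𝓕 W (fun t ω => Y t ω - Y' t ω) (fun t ω => J t ω - J' t ω) :=
  (h.add h'.neg).congr (fun _ _ => (sub_eq_add_neg _ _).symm) fun _ _ => (sub_eq_add_neg _ _).symm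

theorem block {X : Ω → U →L[ℝ] H} {a b : Set.Iic T} (hab : a ≤ b)
    (hX : StronglyMeasurable[𝓕 a] X) (hfin : (Set.range X).Finite) :
    IsElementary 𝓕 W (fun t ω => (Set.Ioc a b).indicator (fun _ => X ω) t)
      (blockIntegral W X a b) := by
  refine ((term a X hX hfin).sub (term b X (hX.mono (𝓕.mono hab)) hfin)).congr
    (fun t ω => ?_) fun t ω => ?_
  · by_cases ha : a < t
    · by_cases hb : b < t
      · simp [ha, hb, Set.indicator]
      · simp [ha, hb, not_lt.1 hb, Set.indicator]
    · have hb : ¬ b < t := fun hb => ha (hab.trans_lt hb)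
      simp [ha, hb, Set.indicator]
  · rw [blockIntegral, ← map_sub]
    congr 1
    abel

end IsElementary

theorem SimpleProcess.isElementary (ψ : SimpleProcess 𝓕 U H) :
    IsElementary 𝓕 W (fun t ω => ∑ m : Fin (ψ.N + 1),
      (Set.Ioc (ψ.time m.castSucc) (ψ.time m.succ)).indicator (fun _ => ψ.value m ω) t)
      (ψ.integral W) :=
  IsElementary.sum Finset.univ fun m =>
    IsElementary.block (ψ.time_le m) (ψ.measurable m) (ψ.finite_range m)

theorem SimpleProcess.eval_eq_sum (ψ : SimpleProcess 𝓕 U H) {t : Set.Iic T} (ht : t ≠ ⊥) (ω : Ω) :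
    ψ.eval t ω = ∑ m : Fin (ψ.N + 1),
      (Set.Ioc (ψ.time m.castSucc) (ψ.time m.succ)).indicator (fun _ => ψ.value m ω) t := by
  classical
  rw [eval, if_neg ht, zero_add]
  exact Finset.sum_congr rfl fun m _ => by simp only [Set.indicator]

theorem Fin.sum_ite_le_sub {G : Type*} [AddCommGroup G] (n : ℕ) (g : Fin (n + 1) → G)
    (j : Fin (n + 1)) :
    ∑ m : Fin n, (if j ≤ m.castSucc then g m.succ - g m.castSucc else 0) =
      g (Fin.last n) - g j := by
  induction n with
  | zero =>
    obtain rfl : j = Fin.last 0 := Subsingleton.elim (α := Fin 1) _ _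
    simp
  | succ n ih =>
    rw [Fin.sum_univ_castSucc]
    rcases Fin.eq_castSucc_or_eq_last j with ⟨j', rfl⟩ | rfl
    · have := ih (fun i => g i.castSucc) j'
      simp only [Fin.castSucc_le_castSucc_iff, Fin.succ_castSucc, Fin.le_last, if_true,
        Fin.succ_last, Nat.succ_eq_add_one]
      rw [this]
      abel
    · have h : ∀ m : Fin (n + 1), ¬ Fin.last (n + 1) ≤ m.castSucc := fun m =>
        not_le.2 (Fin.castSucc_lt_last m)
      simp [h]

/-- The grid is left free, subject to containing a finite set S of times. This makes the induction
work: a further term only enlarges S, and one grid then serves all terms. -/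
theorem IsElementary.exists_value (h : IsElementary 𝓕 W Y J) :
    ∃ S : Finset (Set.Iic T), ∀ (N : ℕ) (time : Fin (N + 2) → Set.Iic T), StrictMono time →
      time (Fin.last (N + 1)) = ⊤ → (∀ s ∈ S, ∃ j, time j = s) →
      ∃ value : Fin (N + 1) → Ω → U →L[ℝ] H, (∀ m, (Set.range (value m)).Finite) ∧
        (∀ m, StronglyMeasurable[𝓕 (time m.castSucc)] (value m)) ∧
        (∀ t ω, ∑ m : Fin (N + 1), (Set.Ioc (time m.castSucc) (time m.succ)).indicator
          (fun _ => value m ω) t = Y t ω) ∧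
        ∀ t ω, ∑ m : Fin (N + 1),
          blockIntegral W (value m) (time m.castSucc) (time m.succ) t ω = J t ω := by
  classical
  induction h with
  | zero => exact ⟨∅, fun N time _ _ _ => ⟨fun _ _ => 0, fun _ => Set.finite_range_const,
      fun _ => stronglyMeasurable_const, fun _ _ => by simp, fun _ _ => by simp [blockIntegral]⟩⟩
  | @term_add Y J s X hX hfin _ ih =>
    obtain ⟨S, hS⟩ := ih
    refine ⟨insert s S, fun N time hmono hlast hsub => ?_⟩
    obtain ⟨value, hfr, hmeas, hev, hint⟩ := hS N time hmono hlast
      fun s hs => hsub s (Finset.mem_insert_of_mem hs)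
    obtain ⟨j, rfl⟩ := hsub s (Finset.mem_insert_self _ _)
    refine ⟨fun m ω => (if j ≤ m.castSucc then X ω else 0) + value m ω, fun m => ?_, fun m => ?_,
      fun t ω => ?_, fun t ω => ?_⟩
    · by_cases hj : j ≤ m.castSucc
      · simp only [hj, if_true]
        refine ((hfin.prod (hfr m)).image fun p => p.1 + p.2).subset ?_
        rintro _ ⟨ω, rfl⟩
        exact ⟨(X ω, value m ω), ⟨⟨ω, rfl⟩, ⟨ω, rfl⟩⟩, rfl⟩
      · simpa only [hj, if_false, zero_add] using hfr m
    · by_cases hj : j ≤ m.castSucc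
      · simp only [hj, if_true]
        exact (hX.mono (𝓕.mono (hmono.monotone hj))).add (hmeas m)
      · simpa only [hj, if_false, zero_add] using hmeas m
    · beta_reduce
      rw [← hev]
      -- X 1_{(t_j,T]} is the telescoping sum of its pieces over the grid intervals from t_j on; the
      -- end term vanishes because no time exceeds ⊤.
      have h1 := Fin.sum_ite_le_sub (N + 1)
        (fun i => - (Set.Ioi (time i)).indicator (fun _ => X ω) t) j
      simp only [hlast] at h1
      have h2 : (Set.Ioi (⊤ : Set.Iic T)).indicator (fun _ => X ω) t = 0 := by simp
      rw [h2, neg_zero, sub_neg_eq_add, zero_add] at h1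
      rw [← h1, ← Finset.sum_add_distrib]
      refine Finset.sum_congr rfl fun m _ => ?_
      have hle : time m.castSucc ≤ time m.succ := hmono.monotone (Fin.castSucc_lt_succ).le
      by_cases ha : time m.castSucc < t
      · by_cases hb : time m.succ < t
        · simp [Set.indicator, ha, hb, not_le.2 hb]
        · by_cases hj : j ≤ m.castSucc <;> simp [Set.indicator, ha, hb, not_lt.1 hb, hj]
      · have hb : ¬ time m.succ < t := fun hb => ha (hle.trans_lt hb)
        simp [Set.indicator, ha, hb]
    · beta_reduce
      rw [← hint]
      have h1 := Fin.sum_ite_le_sub (N + 1)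
        (fun i => X ω (W (min (time i) t : Set.Iic T) ω)) j
      simp only [hlast, top_inf_eq] at h1
      rw [map_sub, ← h1, ← Finset.sum_add_distrib]
      refine Finset.sum_congr rfl fun m _ => ?_
      by_cases hj : j ≤ m.castSucc <;> simp [blockIntegral, hj]

/-- Adding both endpoints to S gives an admissible grid, with at least two points since T > 0. Time
0 is excluded since Y vanishes there while `eval` takes its first value. -/
theorem IsElementary.exists_simple (hT : 0 < T) (h : IsElementary 𝓕 W Y J) :
    ∃ ψ : SimpleProcess 𝓕 U H, (∀ t ω, t ≠ ⊥ → ψ.eval t ω = Y t ω) ∧ ψ.integral W = J := by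
  classical
  obtain ⟨S, hS⟩ := h.exists_value
  set S' : Finset (Set.Iic T) := insert ⊥ (insert ⊤ S) with hS'
  have hbt : (⊥ : Set.Iic T) ≠ ⊤ := fun h => hT.ne (congrArg Subtype.val h)
  have hcard : 2 ≤ S'.card := by
    rw [← Finset.card_pair hbt]
    exact Finset.card_le_card (by
      intro x hx
      simp only [Finset.mem_insert, Finset.mem_singleton] at hx
      rcases hx with rfl | rfl <;> simp [hS'])
  obtain ⟨N, hN⟩ : ∃ N, S'.card = N + 2 := ⟨S'.card - 2, by omega⟩
  set time := S'.orderEmbOfFin hN with htime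
  have hmem : ∀ s ∈ S', ∃ j, time j = s := fun s hs => by
    have : s ∈ Set.range time := by rw [htime, S'.range_orderEmbOfFin hN]; exact hs
    exact this
  have h0 : time 0 = ⊥ := by
    obtain ⟨j, hj⟩ := hmem ⊥ (by simp [hS'])
    exact le_bot_iff.1 (hj ▸ time.monotone (Fin.zero_le j))
  have hlast : time (Fin.last (N + 1)) = ⊤ := by
    obtain ⟨j, hj⟩ := hmem ⊤ (by simp [hS'])
    exact top_le_iff.1 (hj ▸ time.monotone (Fin.le_last j))
  obtain ⟨value, hfr, hmeas, hev, hint⟩ := hS N time time.strictMono hlast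
    fun s hs => hmem s (by simp [hS', hs])
  let ψ : SimpleProcess 𝓕 U H :=
    { N := N, time := time, time_strictMono := time.strictMono
      time_zero := congrArg Subtype.val h0
      time_last := congrArg Subtype.val hlast
      value := value, finite_range := hfr, measurable := hmeas }
  refine ⟨ψ, fun t ω ht => ?_, funext fun t => funext fun ω => ?_⟩
  · rw [ψ.eval_eq_sum ht]
    exact hev t ω
  · exact hint t ω

/-! ### Measurability of elementary processes -/

theorem predictable_le_prod (𝓕 : Filtration (Set.Iic T) mΩ) :
    𝓕.predictable ≤ (inferInstance : MeasurableSpace (Set.Iic T × Ω)) :=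
  measurableSpace_le_predictable_of_measurableSet
    (fun _ hA => (measurableSet_singleton _).prod (𝓕.le _ _ hA))
    fun _ _ hA => measurableSet_Ioi.prod (𝓕.le _ _ hA)

theorem IsElementary.stronglyMeasurable_predictable (h : IsElementary 𝓕 W Y J) :
    StronglyMeasurable[𝓕.predictable] (fun p : Set.Iic T × Ω => Y p.1 p.2) := by
  classical
  induction h with
  | zero => exact stronglyMeasurable_const
  | @term_add Y J s X hX hfin _ ih =>
    refine StronglyMeasurable.add ?_ ih
    have h1 : (fun p : Set.Iic T × Ω => (Set.Ioi s).indicator (fun _ => X p.2) p.1) =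
        fun p => ∑ c ∈ hfin.toFinset, (Set.Ioi s ×ˢ (X ⁻¹' {c})).indicator (fun _ => c) p := by
      funext p
      rw [Finset.sum_eq_single (X p.2)]
      · by_cases hp : s < p.1 <;> simp [Set.indicator, hp]
      · intro c _ hc
        exact Set.indicator_of_notMem (fun hp => hc (Set.mem_prod.1 hp).2.symm) _
      · intro hp
        exact absurd (hfin.mem_toFinset.2 ⟨p.2, rfl⟩) hp
    rw [h1]
    refine Finset.stronglyMeasurable_fun_sum _ fun c _ => ?_
    borelize (U →L[ℝ] H)
    exact stronglyMeasurable_const.indicator (measurableSet_predictable_Ioi_prod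
      (hX.measurable (measurableSet_singleton c)))

end Elementary

/-! ### The Itô isometry for elementary processes -/

section ElementaryL2

variable {Ω : Type*} {mΩ : MeasurableSpace Ω} {P : Measure Ω} [IsProbabilityMeasure P] {T : ℝ≥0}
  {U : Type*} [NormedAddCommGroup U] [InnerProductSpace ℝ U] [CompleteSpace U]
  {H : Type*} [NormedAddCommGroup H] [InnerProductSpace ℝ H] [CompleteSpace H]
  {𝓕 : Filtration (Set.Iic T) mΩ} {Q : U →L[ℝ] U} {W : ℝ≥0 → Ω → U}
  {Y : Set.Iic T → Ω → U →L[ℝ] H} {J : Set.Iic T → Ω → H}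

theorem ae_time_ne_bot : ∀ᵐ s ∂timeMeasure T, s ≠ ⊥ := by
  simp [ae_iff]

theorem eLpNorm_two_sq {α E : Type*} {mα : MeasurableSpace α} {μ : Measure α}
    [NormedAddCommGroup E] (f : α → E) : eLpNorm f 2 μ ^ 2 = ∫⁻ x, ‖f x‖ₑ ^ 2 ∂μ := by
  rw [eLpNorm_eq_lintegral_rpow_enorm_toReal (by norm_num) (by norm_num), ← ENNReal.rpow_two,
    ← ENNReal.rpow_mul]
  simp

theorem IsElementary.stronglyMeasurable_prod (h : IsElementary 𝓕 W Y J)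
    (hQ : hsENormSq (RKSpace.incl Q) < ∞) :
    StronglyMeasurable (fun p : Set.Iic T × Ω => restrictHS hQ (Y p.1 p.2)) :=
  (restrictHS hQ).continuous.comp_stronglyMeasurable
    (h.stronglyMeasurable_predictable.mono (predictable_le_prod 𝓕))

/-- The Itô isometry for elementary processes. -/
theorem IsElementary.eLpNorm_integral (hW : IsWienerFor 𝓕 Q W H P) (hT : 0 < T)
    (h : IsElementary 𝓕 W Y J) (t : Set.Iic T) :
    eLpNorm (J t) 2 P = eLpNorm (fun p : Set.Iic T × Ω => restrictHS hW.incl_lt_top (Y p.1 p.2)) 2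
      (((timeMeasure T).restrict (Set.Iic t)).prod P) := by
  obtain ⟨ψ, hψ, rfl⟩ := h.exists_simple hT
  rw [← ENNReal.pow_right_strictMono (n := 2) (by norm_num) |>.injective.eq_iff]
  rw [eLpNorm_two_sq, eLpNorm_two_sq, ψ.lintegral_integral_sq hW,
    lintegral_prod_symm]
  · refine lintegral_congr fun ω => lintegral_congr_ae (ae_restrict_of_ae ?_)
    filter_upwards [ae_time_ne_bot] with s hs
    rw [HilbertSchmidt.enorm_sq, toCLM_restrictHS, hψ s ω hs]
  · exact ((h.stronglyMeasurable_prod hW.incl_lt_top).enorm.pow_const 2).aemeasurable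

theorem IsElementary.eLpNorm_integral_le (hW : IsWienerFor 𝓕 Q W H P) (hT : 0 < T)
    (h : IsElementary 𝓕 W Y J) (t : Set.Iic T) :
    eLpNorm (J t) 2 P ≤ eLpNorm (fun p : Set.Iic T × Ω => restrictHS hW.incl_lt_top (Y p.1 p.2)) 2
      ((timeMeasure T).prod P) := by
  rw [h.eLpNorm_integral hW hT]
  exact eLpNorm_mono_measure _ (Measure.prod_mono Measure.restrict_le_self le_rfl)

end ElementaryL2

/-! ### Density of elementary processes in the predictable L² space -/

section Density

variable {Ω : Type*} {mΩ : MeasurableSpace Ω} {P : Measure Ω} [IsProbabilityMeasure P] {T : ℝ≥0}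
  {U : Type*} [NormedAddCommGroup U] [InnerProductSpace ℝ U] [CompleteSpace U]
  {H : Type*} [NormedAddCommGroup H] [InnerProductSpace ℝ H] [CompleteSpace H]
  {𝓕 : Filtration (Set.Iic T) mΩ} {Q : U →L[ℝ] U} {W : ℝ≥0 → Ω → U}

theorem ae_prod_time_ne_bot :
    ∀ᵐ p : Set.Iic T × Ω ∂(timeMeasure T).prod P, p.1 ≠ ⊥ :=
  Measure.quasiMeasurePreserving_fst.ae ae_time_ne_bot

theorem isPiSystem_predictable (𝓕 : Filtration (Set.Iic T) mΩ) :
    IsPiSystem ({s | ∃ A, MeasurableSet[𝓕 ⊥] A ∧ s = {⊥} ×ˢ A} ∪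
      {s : Set (Set.Iic T × Ω) | ∃ i A, MeasurableSet[𝓕 i] A ∧ s = Set.Ioi i ×ˢ A}) := by
  rintro s (⟨A, hA, rfl⟩ | ⟨i, A, hA, rfl⟩) t (⟨B, hB, rfl⟩ | ⟨j, B, hB, rfl⟩) hne
  · exact Or.inl ⟨A ∩ B, hA.inter hB, by rw [Set.prod_inter_prod, Set.inter_self]⟩
  · obtain ⟨p, ⟨hp1, -⟩, ⟨hp2, -⟩⟩ := hne
    rw [Set.mem_singleton_iff] at hp1
    rw [hp1] at hp2
    exact absurd (Set.mem_Ioi.1 hp2) not_lt_bot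
  · obtain ⟨p, ⟨hp2, -⟩, ⟨hp1, -⟩⟩ := hne
    rw [Set.mem_singleton_iff] at hp1
    rw [hp1] at hp2
    exact absurd (Set.mem_Ioi.1 hp2) not_lt_bot
  · exact Or.inr ⟨i ⊔ j, A ∩ B, (𝓕.mono le_sup_left _ hA).inter (𝓕.mono le_sup_right _ hB), by
      rw [Set.prod_inter_prod, Set.Ioi_inter_Ioi]⟩

/-- Indicators of predictable sets are limits of elementary processes. -/
theorem exists_isElementary_indicator (hQ : hsENormSq (RKSpace.incl Q) < ∞) (W : ℝ≥0 → Ω → U)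
    {s : Set (Set.Iic T × Ω)}
    (hs : MeasurableSet[𝓕.predictable] s) (B : U →L[ℝ] H) {ε : ℝ≥0∞} (hε : ε ≠ 0) :
    ∃ Y J, IsElementary 𝓕 W Y J ∧
      eLpNorm ((fun p : Set.Iic T × Ω => restrictHS hQ (Y p.1 p.2)) -
        s.indicator fun _ => restrictHS hQ B) 2 ((timeMeasure T).prod P) ≤ ε := by
  induction s, hs using MeasurableSpace.induction_on_inter rfl (isPiSystem_predictable 𝓕)
    generalizing ε with
  | empty => exact ⟨_, _, IsElementary.zero, by
      simp only [map_zero, Set.indicator_empty]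
      rw [show (fun _ : Set.Iic T × Ω => (0 : HilbertSchmidt (RKSpace Q) H)) - (fun _ => 0) = 0
        from sub_self _, eLpNorm_zero]
      exact zero_le⟩
  | basic t ht =>
    rcases ht with ⟨A, hA, rfl⟩ | ⟨i, A, hA, rfl⟩
    -- A rectangle over time 0 is a null set, so the zero process will do.
    · refine ⟨_, _, IsElementary.zero, le_of_eq_of_le ?_ (zero_le (a := ε))⟩
      rw [eLpNorm_eq_zero_of_ae_zero]
      filter_upwards [ae_prod_time_ne_bot] with p hp
      simp [Set.indicator, hp]
    · refine ⟨_, _, IsElementary.term i (A.indicator fun _ => B)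
        (stronglyMeasurable_const.indicator hA)
        (Set.Finite.subset (Set.toFinite {B, 0}) ?_), le_of_eq_of_le ?_ (zero_le (a := ε))⟩
      · rintro _ ⟨ω, rfl⟩
        by_cases h : ω ∈ A <;> simp [h]
      · rw [eLpNorm_eq_zero_of_ae_zero]
        filter_upwards with p
        by_cases h : p.2 ∈ A <;> by_cases h' : i < p.1 <;> simp [Set.indicator, h, h']
  | compl t ht ih =>
    obtain ⟨Y, J, hY, hle⟩ := ih hε
    -- Away from time 0 the constant B is the elementary process B 1_{(0,T]}, from which the
    -- approximation of the set is subtracted.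
    refine ⟨_, _, (IsElementary.term ⊥ (fun _ => B) stronglyMeasurable_const
      Set.finite_range_const).sub hY, le_trans (le_of_eq ?_) hle⟩
    rw [← eLpNorm_neg]
    refine eLpNorm_congr_ae ?_
    filter_upwards [ae_prod_time_ne_bot] with p hp
    have hp' : ⊥ < p.1 := bot_lt_iff_ne_bot.2 hp
    by_cases h : p ∈ t <;> simp [Set.indicator, hp', h]
  | iUnion f hd hf ih =>
    set μ := (timeMeasure T).prod P
    have hfm : ∀ i, MeasurableSet (f i) := fun i => predictable_le_prod 𝓕 _ (hf i)
    -- Half of ε pays for the tail of the union, whose measure is below η once n is large; the other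
    -- half is distributed as a summable sequence over the first n sets.
    obtain ⟨η, hη, hηle⟩ := exists_eLpNorm_indicator_le (p := 2) (μ := μ) (by norm_num)
      (restrictHS hQ B) (ENNReal.half_pos hε).ne'
    have hsum : ∑' i, μ (f i) ≠ ∞ := by
      rw [← measure_iUnion hd hfm]
      exact measure_ne_top _ _
    obtain ⟨n, hn⟩ := ((ENNReal.tendsto_sum_nat_add _ hsum).eventually_lt_const
      (ENNReal.coe_pos.2 hη)).exists
    obtain ⟨ε', hε'pos, hε'⟩ := ENNReal.exists_pos_sum_of_countable' (ENNReal.half_pos hε).ne' ℕ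
    choose Y J hY hle using fun i => ih i (hε'pos i).ne'
    refine ⟨_, _, IsElementary.sum (Finset.range n) hY, ?_⟩
    have hdecomp : (fun p : Set.Iic T × Ω => restrictHS hQ (∑ i ∈ Finset.range n, Y i p.1 p.2)) -
        (⋃ i, f i).indicator (fun _ => restrictHS hQ B) =
        (∑ i ∈ Finset.range n, ((fun p : Set.Iic T × Ω => restrictHS hQ (Y i p.1 p.2)) -
          (f i).indicator fun _ => restrictHS hQ B)) -
        (⋃ i, f (i + n)).indicator (fun _ => restrictHS hQ B) := by
      funext p
      simp only [Pi.sub_apply, map_sum, Finset.sum_apply, Finset.sum_sub_distrib]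
      rw [sub_sub]
      congr 1
      by_cases hp : ∃ j, p ∈ f j
      · obtain ⟨j, hj⟩ := hp
        have hother : ∀ i, i ≠ j → p ∉ f i := fun i hij hi =>
          Set.disjoint_left.1 (hd hij) hi hj
        rw [Set.indicator_of_mem (Set.mem_iUnion.2 ⟨j, hj⟩)]
        by_cases hjn : j < n
        · rw [Finset.sum_eq_single j (fun i _ hij => Set.indicator_of_notMem (hother i hij) _)
            (fun h => absurd (Finset.mem_range.2 hjn) h), Set.indicator_of_mem hj,
            Set.indicator_of_notMem, add_zero]
          rw [Set.mem_iUnion]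
          rintro ⟨i, hi⟩
          exact hother (i + n) (by omega) hi
        · rw [Finset.sum_eq_zero, zero_add, Set.indicator_of_mem]
          · exact Set.mem_iUnion.2 ⟨j - n, by rwa [Nat.sub_add_cancel (not_lt.1 hjn)]⟩
          · intro i hi
            exact Set.indicator_of_notMem (hother i (by
              rintro rfl
              exact hjn (Finset.mem_range.1 hi))) _
      · push Not at hp
        have h1 : ∀ g : ℕ → ℕ, p ∉ ⋃ i, f (g i) := fun g h => by
          obtain ⟨i, hi⟩ := Set.mem_iUnion.1 h
          exact hp _ hi
        rw [Set.indicator_of_notMem (by simpa using h1 id), Set.indicator_of_notMem (h1 (· + n)), add_zero,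
          Finset.sum_eq_zero fun i _ => Set.indicator_of_notMem (hp i) _]
    have hmeas : ∀ i, AEStronglyMeasurable
        ((fun p : Set.Iic T × Ω => restrictHS hQ (Y i p.1 p.2)) -
          (f i).indicator fun _ => restrictHS hQ B) μ := fun i =>
      ((hY i).stronglyMeasurable_prod hQ).aestronglyMeasurable.sub
        (stronglyMeasurable_const.indicator (hfm i)).aestronglyMeasurable
    rw [hdecomp]
    calc _ ≤ _ := eLpNorm_sub_le (Finset.aestronglyMeasurable_sum _ fun i _ => hmeas i)
          (stronglyMeasurable_const.indicator
            (MeasurableSet.iUnion fun i => hfm (i + n))).aestronglyMeasurable (by norm_num)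
      _ ≤ ε / 2 + ε / 2 := by
        refine add_le_add ?_ (hηle _ ((measure_iUnion_le _).trans hn.le))
        refine (eLpNorm_sum_le (fun i _ => hmeas i) (by norm_num)).trans ?_
        refine (Finset.sum_le_sum fun i _ => hle i).trans ?_
        exact (ENNReal.sum_le_tsum _).trans hε'.le
      _ = ε := ENNReal.add_halves ε

/-- Elementary processes are dense in the square integrable predictable processes. -/
theorem exists_isElementary_eLpNorm_sub_le [SecondCountableTopology U]
    (hQ : hsENormSq (RKSpace.incl Q) < ∞) (W : ℝ≥0 → Ω → U)
    {φ : Set.Iic T × Ω → HilbertSchmidt (RKSpace Q) H} (hφ : StronglyMeasurable[𝓕.predictable] φ)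
    (hφ2 : MemLp φ 2 ((timeMeasure T).prod P)) {ε : ℝ≥0∞} (hε : ε ≠ 0) :
    ∃ Y J, IsElementary 𝓕 W Y J ∧
      eLpNorm (φ - fun p => restrictHS hQ (Y p.1 p.2)) 2 ((timeMeasure T).prod P) ≤ ε := by
  set μ := (timeMeasure T).prod P
  have hm := predictable_le_prod 𝓕
  -- The measure is trimmed to the predictable σ-algebra so that the approximation only involves
  -- indicators of predictable sets.
  obtain ⟨g, hg, Y, J, hYJ, rfl⟩ := @MemLp.induction_dense _ _ 𝓕.predictable _ 2 (μ.trim hm)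
    (by norm_num)
    (fun f => ∃ Y J, IsElementary 𝓕 W Y J ∧ f = fun p => restrictHS hQ (Y p.1 p.2))
    (by
      intro c s hs _ ε hε
      -- The value c is replaced by the restriction of a bounded operator; the power of the total
      -- mass is what bounds the L² norm of a constant on any set.
      obtain ⟨B, hB⟩ : ∃ B : U →L[ℝ] H,
          ‖restrictHS hQ B - c‖ₑ * μ Set.univ ^ (1 / (2 : ℝ≥0∞).toReal) < ε / 2 := by
        have hopen : IsOpen {x : HilbertSchmidt (RKSpace Q) H |
            ‖x - c‖ₑ * μ Set.univ ^ (1 / (2 : ℝ≥0∞).toReal) < ε / 2} := by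
          refine isOpen_lt ?_ continuous_const
          exact (ENNReal.continuous_mul_const
            (ENNReal.rpow_ne_top_of_nonneg (by simp) (measure_ne_top _ _))).comp
              (continuous_id.sub continuous_const).enorm
        exact (dense_range_restrictHS hQ).exists_mem_open hopen
          ⟨c, by simpa using (ENNReal.half_pos hε)⟩
      obtain ⟨Y, J, hY, hle⟩ := exists_isElementary_indicator (P := P) hQ W hs B
        (ENNReal.half_pos hε).ne'
      refine ⟨_, ?_, Y, J, hY, rfl⟩
      have h1 : StronglyMeasurable[𝓕.predictable]
          ((fun p : Set.Iic T × Ω => restrictHS hQ (Y p.1 p.2)) - s.indicator fun _ => c) :=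
        ((restrictHS hQ).continuous.comp_stronglyMeasurable
          hY.stronglyMeasurable_predictable).sub (stronglyMeasurable_const.indicator hs)
      rw [eLpNorm_trim hm h1]
      have h2 : ((fun p : Set.Iic T × Ω => restrictHS hQ (Y p.1 p.2)) - s.indicator fun _ => c) =
          ((fun p : Set.Iic T × Ω => restrictHS hQ (Y p.1 p.2)) -
            s.indicator fun _ => restrictHS hQ B) +
          s.indicator fun _ => restrictHS hQ B - c := by
        funext p
        by_cases hp : p ∈ s <;> simp [hp]
      rw [h2]
      refine (eLpNorm_add_le ?_ ?_ (by norm_num)).trans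
        ((add_le_add hle ?_).trans (ENNReal.add_halves ε).le)
      · exact (hY.stronglyMeasurable_prod hQ).aestronglyMeasurable.sub
          (stronglyMeasurable_const.indicator (hm _ hs)).aestronglyMeasurable
      · exact (stronglyMeasurable_const.indicator (hm _ hs)).aestronglyMeasurable
      · refine (eLpNorm_indicator_const_le _ _).trans (le_trans ?_ hB.le)
        gcongr
        exact Set.subset_univ _)
    (by
      rintro f g ⟨Y, J, hY, rfl⟩ ⟨Y', J', hY', rfl⟩
      exact ⟨_, _, hY.add hY', by funext p; simp⟩)
    (by
      rintro f ⟨Y, J, hY, rfl⟩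
      exact ((restrictHS hQ).continuous.comp_stronglyMeasurable
          hY.stronglyMeasurable_predictable).aestronglyMeasurable)
    φ ⟨hφ.aestronglyMeasurable, (eLpNorm_trim hm hφ).trans_lt hφ2.2⟩ ε hε
  refine ⟨Y, J, hYJ, ?_⟩
  rwa [eLpNorm_trim hm (hφ.sub ((restrictHS hQ).continuous.comp_stronglyMeasurable
          hYJ.stronglyMeasurable_predictable))] at hg

end Density

/-! ### The stochastic integral as a limit in `L²` -/

section L2Integral

variable {Ω : Type*} {mΩ : MeasurableSpace Ω} {P : Measure Ω} [IsProbabilityMeasure P] {T : ℝ≥0}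
  {U : Type*} [NormedAddCommGroup U] [InnerProductSpace ℝ U] [CompleteSpace U]
  {H : Type*} [NormedAddCommGroup H] [InnerProductSpace ℝ H] [CompleteSpace H]
  {𝓕 : Filtration (Set.Iic T) mΩ} {Q : U →L[ℝ] U} {W : ℝ≥0 → Ω → U}
  {Y : Set.Iic T → Ω → U →L[ℝ] H} {J : Set.Iic T → Ω → H}

theorem IsElementary.isContSqIntMartingale (hW : IsWienerFor 𝓕 Q W H P) (hT : 0 < T)
    (h : IsElementary 𝓕 W Y J) : IsContSqIntMartingale 𝓕 J P := by
  obtain ⟨ψ, -, rfl⟩ := h.exists_simple hT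
  exact ψ.isContSqIntMartingale hW

/-- `M` is the stochastic integral of the square integrable process `φ` with respect to `W`. -/
structure IsL2Integral (hQ : hsENormSq (RKSpace.incl Q) < ∞) (𝓕 : Filtration (Set.Iic T) mΩ)
    (W : ℝ≥0 → Ω → U) (φ : Set.Iic T × Ω → HilbertSchmidt (RKSpace Q) H)
    (M : Set.Iic T → Ω → H) (P : Measure Ω) : Prop where
  aestronglyMeasurable : AEStronglyMeasurable φ ((timeMeasure T).prod P)
  aestronglyMeasurable_integral : ∀ t, AEStronglyMeasurable (M t) P
  exists_approx : ∀ ε : ℝ≥0∞, ε ≠ 0 → ∃ Y J, IsElementary 𝓕 W Y J ∧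
    eLpNorm (φ - fun p => restrictHS hQ (Y p.1 p.2)) 2 ((timeMeasure T).prod P) ≤ ε ∧
    ∀ t, eLpNorm (M t - J t) 2 P ≤ ε

theorem eLpNorm_sub_le_add {α E : Type*} {mα : MeasurableSpace α} {μ : Measure α}
    [NormedAddCommGroup E] {f g h : α → E} (hf : AEStronglyMeasurable f μ)
    (hg : AEStronglyMeasurable g μ) (hh : AEStronglyMeasurable h μ) :
    eLpNorm (f - h) 2 μ ≤ eLpNorm (f - g) 2 μ + eLpNorm (g - h) 2 μ := by
  rw [← sub_add_sub_cancel f g h]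
  exact eLpNorm_add_le (hf.sub hg) (hg.sub hh) (by norm_num)

theorem eLpNorm_le_eLpNorm_sub_add {α E : Type*} {mα : MeasurableSpace α} {μ : Measure α}
    [NormedAddCommGroup E] {f g : α → E} (hf : AEStronglyMeasurable f μ)
    (hg : AEStronglyMeasurable g μ) : eLpNorm f 2 μ ≤ eLpNorm (f - g) 2 μ + eLpNorm g 2 μ := by
  conv_lhs => rw [← sub_add_cancel f g]
  exact eLpNorm_add_le (hf.sub hg) hg (by norm_num)

theorem ENNReal.le_of_forall_ne_zero_le_add {a b : ℝ≥0∞} (c : ℝ≥0∞) (hc : c ≠ ∞)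
    (h : ∀ ε : ℝ≥0∞, ε ≠ 0 → a ≤ b + c * ε) : a ≤ b := by
  refine ENNReal.le_of_forall_pos_le_add fun ε hε _ => ?_
  have h0 : c + 1 ≠ ∞ := by finiteness
  refine (h (ε / (c + 1)) ?_).trans (add_le_add_right ?_ b)
  · exact ENNReal.div_ne_zero.2 ⟨by exact_mod_cast hε.ne', h0⟩
  · calc c * (ε / (c + 1)) ≤ (c + 1) * (ε / (c + 1)) := by gcongr; exact le_self_add
      _ = ε := ENNReal.mul_div_cancel (by simp) h0

namespace IsElementary

theorem aestronglyMeasurable_integral (hW : IsWienerFor 𝓕 Q W H P) (hT : 0 < T)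
    (h : IsElementary 𝓕 W Y J) (t : Set.Iic T) : AEStronglyMeasurable (J t) P :=
  ((h.isContSqIntMartingale hW hT).sqIntegrable t).1

theorem eLpNorm_sub_le (hW : IsWienerFor 𝓕 Q W H P) (hT : 0 < T)
    {Y' : Set.Iic T → Ω → U →L[ℝ] H} {J' : Set.Iic T → Ω → H}
    (h : IsElementary 𝓕 W Y J) (h' : IsElementary 𝓕 W Y' J') (t : Set.Iic T) :
    eLpNorm (J t - J' t) 2 P ≤ eLpNorm ((fun p : Set.Iic T × Ω => restrictHS hW.incl_lt_top
      (Y p.1 p.2)) - fun p => restrictHS hW.incl_lt_top (Y' p.1 p.2)) 2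
      ((timeMeasure T).prod P) := by
  refine ((h.sub h').eLpNorm_integral_le hW hT t).trans (le_of_eq ?_)
  congr 1

theorem isL2Integral (hW : IsWienerFor 𝓕 Q W H P) (hT : 0 < T) (h : IsElementary 𝓕 W Y J) :
    IsL2Integral hW.incl_lt_top 𝓕 W
      (fun p => restrictHS hW.incl_lt_top (Y p.1 p.2)) J P where
  aestronglyMeasurable := (h.stronglyMeasurable_prod _).aestronglyMeasurable
  aestronglyMeasurable_integral := h.aestronglyMeasurable_integral hW hT
  exists_approx ε _ := ⟨Y, J, h, by rw [sub_self]; simp, fun t => by rw [sub_self]; simp⟩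

end IsElementary

namespace IsL2Integral

variable {φ φ' : Set.Iic T × Ω → HilbertSchmidt (RKSpace Q) H} {M M' : Set.Iic T → Ω → H}

theorem congr {hQ : hsENormSq (RKSpace.incl Q) < ∞} (h : IsL2Integral hQ 𝓕 W φ M P) (hφ : φ =ᵐ[(timeMeasure T).prod P] φ')
    (hM : ∀ t, M t =ᵐ[P] M' t) : IsL2Integral hQ 𝓕 W φ' M' P where
  aestronglyMeasurable := h.aestronglyMeasurable.congr hφ
  aestronglyMeasurable_integral t := (h.aestronglyMeasurable_integral t).congr (hM t)
  exists_approx ε hε := by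
    obtain ⟨Y, J, hJ, h1, h2⟩ := h.exists_approx ε hε
    refine ⟨Y, J, hJ, ?_, fun t => ?_⟩
    · rwa [eLpNorm_congr_ae (hφ.symm.sub EventuallyEq.rfl)]
    · rw [eLpNorm_congr_ae ((hM t).symm.sub EventuallyEq.rfl)]
      exact h2 t

variable (hW : IsWienerFor 𝓕 Q W H P) (hT : 0 < T)

include hT

theorem sub (h : IsL2Integral hW.incl_lt_top 𝓕 W φ M P) (h' : IsL2Integral hW.incl_lt_top 𝓕 W φ' M' P) :
    IsL2Integral hW.incl_lt_top 𝓕 W (φ - φ') (fun t => M t - M' t) P where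
  aestronglyMeasurable := h.aestronglyMeasurable.sub h'.aestronglyMeasurable
  aestronglyMeasurable_integral t :=
    (h.aestronglyMeasurable_integral t).sub (h'.aestronglyMeasurable_integral t)
  exists_approx ε hε := by
    have hε2 : ε / 2 ≠ 0 := (ENNReal.half_pos hε).ne'
    obtain ⟨Y, J, hJ, h1, h2⟩ := h.exists_approx (ε / 2) hε2
    obtain ⟨Y', J', hJ', h1', h2'⟩ := h'.exists_approx (ε / 2) hε2
    refine ⟨_, _, hJ.sub hJ', ?_, fun t => ?_⟩
    · have hsplit : (φ - φ' - fun p : Set.Iic T × Ω => restrictHS hW.incl_lt_top (Y p.1 p.2 - Y' p.1 p.2)) =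
          (φ - fun p => restrictHS hW.incl_lt_top (Y p.1 p.2)) -
            (φ' - fun p => restrictHS hW.incl_lt_top (Y' p.1 p.2)) := by
        funext p
        simp only [Pi.sub_apply, map_sub]
        abel
      rw [hsplit, ← ENNReal.add_halves ε]
      exact (eLpNorm_sub_le (h.aestronglyMeasurable.sub
        (hJ.stronglyMeasurable_prod hW.incl_lt_top).aestronglyMeasurable) (h'.aestronglyMeasurable.sub
        (hJ'.stronglyMeasurable_prod hW.incl_lt_top).aestronglyMeasurable) (by norm_num)).trans
          (add_le_add h1 h1')
    · have hsplit : (M t - M' t - fun ω => J t ω - J' t ω) = (M t - J t) - (M' t - J' t) := by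
        funext ω
        simp only [Pi.sub_apply]
        abel
      rw [hsplit, ← ENNReal.add_halves ε]
      exact (eLpNorm_sub_le ((h.aestronglyMeasurable_integral t).sub
        (hJ.aestronglyMeasurable_integral hW hT t)) ((h'.aestronglyMeasurable_integral t).sub
        (hJ'.aestronglyMeasurable_integral hW hT t)) (by norm_num)).trans (add_le_add (h2 t) (h2' t))

theorem cut (h : IsL2Integral hW.incl_lt_top 𝓕 W φ M P) (r : Set.Iic T) {A : Set Ω}
    (hA : MeasurableSet[𝓕 r] A) :
    IsL2Integral hW.incl_lt_top 𝓕 W ((Set.Ioi r ×ˢ A).indicator φ)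
      (fun t => A.indicator (M t - M (min r t))) P where
  aestronglyMeasurable :=
    h.aestronglyMeasurable.indicator (measurableSet_Ioi.prod (𝓕.le _ _ hA))
  aestronglyMeasurable_integral t := ((h.aestronglyMeasurable_integral t).sub
    (h.aestronglyMeasurable_integral _)).indicator (𝓕.le _ _ hA)
  exists_approx ε hε := by
    have hε2 : ε / 2 ≠ 0 := (ENNReal.half_pos hε).ne'
    obtain ⟨Y, J, hJ, h1, h2⟩ := h.exists_approx (ε / 2) hε2
    refine ⟨_, _, hJ.cut r hA, ?_, fun t => ?_⟩
    · have hsplit : ((Set.Ioi r ×ˢ A).indicator φ - fun p : Set.Iic T × Ω => restrictHS hW.incl_lt_top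
          ((Set.Ioi r).indicator (fun _ => A.indicator (Y p.1) p.2) p.1)) =
          (Set.Ioi r ×ˢ A).indicator (φ - fun p => restrictHS hW.incl_lt_top (Y p.1 p.2)) := by
        funext p
        by_cases hr : r < p.1 <;> by_cases hp : p.2 ∈ A <;> simp [Set.indicator, hr, hp]
      rw [hsplit]
      exact (eLpNorm_indicator_le _).trans (h1.trans ENNReal.half_le_self)
    · have hsplit : (A.indicator (M t - M (min r t)) -
          fun ω => A.indicator (fun ω => J t ω - J (min r t) ω) ω) =
          A.indicator ((M t - J t) - (M (min r t) - J (min r t))) := by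
        funext ω
        by_cases hω : ω ∈ A
        · simp only [Set.indicator, hω, Pi.sub_apply, if_true]
          abel
        · simp [hω]
      rw [hsplit, ← ENNReal.add_halves ε]
      refine (eLpNorm_indicator_le _).trans ?_
      exact (eLpNorm_sub_le ((h.aestronglyMeasurable_integral t).sub
        (hJ.aestronglyMeasurable_integral hW hT t)) ((h.aestronglyMeasurable_integral _).sub
        (hJ.aestronglyMeasurable_integral hW hT _)) (by norm_num)).trans (add_le_add (h2 t) (h2 _))

/-- Compare through an elementary pair ε-close to (φ, M): one ε is lost on the integral and one on
the integrand, hence the constant 2. Applied to a difference and to the zero process, this yields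
contraction and uniqueness. -/
theorem eLpNorm_sub_elementary_le (h : IsL2Integral hW.incl_lt_top 𝓕 W φ M P)
    (hY : IsElementary 𝓕 W Y J) (t : Set.Iic T) :
    eLpNorm (M t - J t) 2 P ≤ eLpNorm (φ - fun p => restrictHS hW.incl_lt_top (Y p.1 p.2)) 2
      ((timeMeasure T).prod P) := by
  refine ENNReal.le_of_forall_ne_zero_le_add 2 (by norm_num) fun ε hε => ?_
  obtain ⟨Y', J', hJ', h1, h2⟩ := h.exists_approx ε hε
  have hm := hY.stronglyMeasurable_prod hW.incl_lt_top
  have hm' := hJ'.stronglyMeasurable_prod hW.incl_lt_top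
  calc eLpNorm (M t - J t) 2 P
      ≤ eLpNorm (M t - J' t) 2 P + eLpNorm (J' t - J t) 2 P :=
        eLpNorm_sub_le_add (h.aestronglyMeasurable_integral t)
          (hJ'.aestronglyMeasurable_integral hW hT t) (hY.aestronglyMeasurable_integral hW hT t)
    _ ≤ ε + (ε + eLpNorm (φ - fun p => restrictHS hW.incl_lt_top (Y p.1 p.2)) 2
          ((timeMeasure T).prod P)) := by
        refine add_le_add (h2 t) ((hJ'.eLpNorm_sub_le hW hT hY t).trans ?_)
        refine (eLpNorm_sub_le_add hm'.aestronglyMeasurable h.aestronglyMeasurable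
          hm.aestronglyMeasurable).trans (add_le_add_left ?_ _)
        rwa [eLpNorm_sub_comm]
    _ = _ := by ring

theorem eLpNorm_sub_le (h : IsL2Integral hW.incl_lt_top 𝓕 W φ M P)
    (h' : IsL2Integral hW.incl_lt_top 𝓕 W φ' M' P) (t : Set.Iic T) :
    eLpNorm (M t - M' t) 2 P ≤ eLpNorm (φ - φ') 2 ((timeMeasure T).prod P) := by
  have := (h.sub hW hT h').eLpNorm_sub_elementary_le hW hT IsElementary.zero t
  simpa only [map_zero, show ∀ f : Set.Iic T × Ω → HilbertSchmidt (RKSpace Q) H,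
    (f - fun _ => 0) = f from fun f => sub_zero f, show ∀ f : Ω → H,
    (f - fun _ => 0) = f from fun f => sub_zero f] using this

theorem unique (h : IsL2Integral hW.incl_lt_top 𝓕 W φ M P)
    (h' : IsL2Integral hW.incl_lt_top 𝓕 W φ M' P) (t : Set.Iic T) : M t =ᵐ[P] M' t := by
  have h1 := h.eLpNorm_sub_le hW hT h' t
  rw [sub_self, eLpNorm_zero, nonpos_iff_eq_zero, eLpNorm_eq_zero_iff
    ((h.aestronglyMeasurable_integral t).sub (h'.aestronglyMeasurable_integral t))
    (by norm_num)] at h1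
  exact h1.mono fun ω hω => sub_eq_zero.1 hω

/-- Limits of integrands and pointwise limits of integrals correspond to each other. -/
theorem of_tendsto {φn : ℕ → Set.Iic T × Ω → HilbertSchmidt (RKSpace Q) H}
    {Mn : ℕ → Set.Iic T → Ω → H} (hn : ∀ n, IsL2Integral hW.incl_lt_top 𝓕 W (φn n) (Mn n) P)
    (hφ : AEStronglyMeasurable φ ((timeMeasure T).prod P))
    (hlim : Tendsto (fun n => eLpNorm (φn n - φ) 2 ((timeMeasure T).prod P)) atTop (𝓝 0))
    (hM : ∀ t, ∀ᵐ ω ∂P, Tendsto (fun n => Mn n t ω) atTop (𝓝 (M t ω))) :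
    IsL2Integral hW.incl_lt_top 𝓕 W φ M P where
  aestronglyMeasurable := hφ
  aestronglyMeasurable_integral t := aestronglyMeasurable_of_tendsto_ae atTop
    (fun n => (hn n).aestronglyMeasurable_integral t) (hM t)
  exists_approx ε hε := by
    have h4 : ε / 4 ≠ 0 := ENNReal.div_ne_zero.2 ⟨hε, by norm_num⟩
    obtain ⟨n, hnε⟩ := (ENNReal.tendsto_atTop_zero.1 hlim (ε / 4) (pos_iff_ne_zero.2 h4))
    obtain ⟨Y, J, hJ, h1, h2⟩ := (hn n).exists_approx (ε / 4) h4
    have hεsum : ε / 4 + (ε / 4 + ε / 4) ≤ ε := by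
      calc ε / 4 + (ε / 4 + ε / 4) ≤ ε / 4 + (ε / 4 + ε / 4) + ε / 4 := le_self_add
        _ = 4 * (ε / 4) := by ring
        _ = ε := ENNReal.mul_div_cancel (by norm_num) (by norm_num)
    refine ⟨Y, J, hJ, ?_, fun t => ?_⟩
    · refine (eLpNorm_sub_le_add hφ (hn n).aestronglyMeasurable
        (hJ.stronglyMeasurable_prod _).aestronglyMeasurable).trans (le_trans ?_ hεsum)
      rw [eLpNorm_sub_comm]
      exact add_le_add (hnε n le_rfl) (h1.trans le_self_add)
    · have hmJ := hJ.aestronglyMeasurable_integral hW hT t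
      -- The integrals are only known to converge almost surely. Fatou's lemma upgrades this, since
      -- the contraction makes them Cauchy in L².
      have h3 : eLpNorm (M t - Mn n t) 2 P ≤ ε / 4 + ε / 4 := by
        refine (Lp.eLpNorm_lim_le_liminf_eLpNorm (f := fun m => Mn m t - Mn n t) (fun m =>
          ((hn m).aestronglyMeasurable_integral t).sub
            ((hn n).aestronglyMeasurable_integral t)) _ ?_).trans ?_
        · filter_upwards [hM t] with ω hω
          exact hω.sub tendsto_const_nhds
        · refine liminf_le_of_frequently_le' (Eventually.frequently ?_)
          filter_upwards [eventually_ge_atTop n] with m hm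
          refine ((hn m).eLpNorm_sub_le hW hT (hn n) t).trans ((eLpNorm_sub_le_add
            (hn m).aestronglyMeasurable hφ (hn n).aestronglyMeasurable).trans ?_)
          refine add_le_add (hnε m hm) ?_
          rw [eLpNorm_sub_comm]
          exact hnε n le_rfl
      refine (eLpNorm_sub_le_add ((aestronglyMeasurable_of_tendsto_ae atTop
        (fun n => (hn n).aestronglyMeasurable_integral t) (hM t)))
        ((hn n).aestronglyMeasurable_integral t) hmJ).trans ((add_le_add h3 (h2 t)).trans ?_)
      rwa [add_assoc]

/-- The Itô isometry. -/
theorem eLpNorm_integral (h : IsL2Integral hW.incl_lt_top 𝓕 W φ M P) (t : Set.Iic T) :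
    eLpNorm (M t) 2 P = eLpNorm φ 2 (((timeMeasure T).restrict (Set.Iic t)).prod P) := by
  have hle : ((timeMeasure T).restrict (Set.Iic t)).prod P ≤ (timeMeasure T).prod P :=
    Measure.prod_mono Measure.restrict_le_self le_rfl
  have hle2 : ∀ {Y J}, IsElementary 𝓕 W Y J → ∀ ε,
      eLpNorm (φ - fun p => restrictHS hW.incl_lt_top (Y p.1 p.2)) 2
        ((timeMeasure T).prod P) ≤ ε →
      eLpNorm (φ - fun p => restrictHS hW.incl_lt_top (Y p.1 p.2)) 2
      (((timeMeasure T).restrict (Set.Iic t)).prod P) ≤ ε := fun _ _ h =>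
    (eLpNorm_mono_measure _ hle).trans h
  have hφ' := h.aestronglyMeasurable.mono_measure hle
  -- Both inequalities pass through the isometry of an elementary approximation, with one error ε
  -- for the integral and one for the integrand.
  refine le_antisymm ?_ ?_
  all_goals
    refine ENNReal.le_of_forall_ne_zero_le_add 2 (by norm_num) fun ε hε => ?_
    obtain ⟨Y, J, hJ, h1, h2⟩ := h.exists_approx ε hε
    have hmY := (hJ.stronglyMeasurable_prod hW.incl_lt_top).aestronglyMeasurable
      (μ := ((timeMeasure T).restrict (Set.Iic t)).prod P)
    have hmJ := hJ.aestronglyMeasurable_integral hW hT t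
    have hiso := hJ.eLpNorm_integral hW hT t
    have h3 := hle2 hJ ε h1
  · calc eLpNorm (M t) 2 P ≤ ε + eLpNorm (J t) 2 P :=
          (eLpNorm_le_eLpNorm_sub_add (h.aestronglyMeasurable_integral t) hmJ).trans
            (add_le_add_left (h2 t) _)
      _ ≤ ε + (ε + eLpNorm φ 2 (((timeMeasure T).restrict (Set.Iic t)).prod P)) := by
          rw [hiso]
          refine add_le_add_right ((eLpNorm_le_eLpNorm_sub_add hmY hφ').trans
            (add_le_add_left ?_ _)) _
          rwa [eLpNorm_sub_comm]
      _ = _ := by ring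
  · calc eLpNorm φ 2 (((timeMeasure T).restrict (Set.Iic t)).prod P) ≤ ε + eLpNorm (J t) 2 P := by
          rw [hiso]
          exact (eLpNorm_le_eLpNorm_sub_add hφ' hmY).trans (add_le_add_left h3 _)
      _ ≤ ε + (ε + eLpNorm (M t) 2 P) := by
          refine add_le_add_right ((eLpNorm_le_eLpNorm_sub_add hmJ
            (h.aestronglyMeasurable_integral t)).trans (add_le_add_left ?_ _)) _
          rw [eLpNorm_sub_comm]
          exact h2 t
      _ = _ := by ring

theorem eLpNorm_integral_le (h : IsL2Integral hW.incl_lt_top 𝓕 W φ M P) (t : Set.Iic T) :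
    eLpNorm (M t) 2 P ≤ eLpNorm φ 2 ((timeMeasure T).prod P) := by
  rw [h.eLpNorm_integral hW hT]
  exact eLpNorm_mono_measure _ (Measure.prod_mono Measure.restrict_le_self le_rfl)

theorem memLp_integral (h : IsL2Integral hW.incl_lt_top 𝓕 W φ M P)
    (hφ : MemLp φ 2 ((timeMeasure T).prod P)) (t : Set.Iic T) : MemLp (M t) 2 P :=
  ⟨h.aestronglyMeasurable_integral t, (h.eLpNorm_integral_le hW hT t).trans_lt hφ.2⟩

/-- Conditional expectation contracts L², so the martingale property passes from elementary
integrals to their limits. -/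
theorem condExp_eq (h : IsL2Integral hW.incl_lt_top 𝓕 W φ M P)
    (hφ : MemLp φ 2 ((timeMeasure T).prod P)) {s t : Set.Iic T} (hst : s ≤ t) :
    P[M t | 𝓕 s] =ᵐ[P] M s := by
  have hMt := h.memLp_integral hW hT hφ t
  have hmc : AEStronglyMeasurable (P[M t | 𝓕 s]) P :=
    (stronglyMeasurable_condExp.mono (𝓕.le s)).aestronglyMeasurable
  have key : eLpNorm (P[M t | 𝓕 s] - M s) 2 P ≤ 0 := by
    refine ENNReal.le_of_forall_ne_zero_le_add 2 (by norm_num) fun ε hε => ?_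
    obtain ⟨Y, J, hJ, h1, h2⟩ := h.exists_approx ε hε
    have hJm := hJ.isContSqIntMartingale hW hT
    have h3 : P[M t | 𝓕 s] - J s =ᵐ[P] P[M t - J t | 𝓕 s] :=
      (EventuallyEq.rfl.sub (hJm.martingale.condExp_ae_eq hst).symm).trans
        (condExp_sub (hMt.integrable (by norm_num))
          ((hJm.sqIntegrable t).integrable (by norm_num)) _).symm
    refine (eLpNorm_sub_le_add hmc (hJm.sqIntegrable s).1
      (h.aestronglyMeasurable_integral s)).trans ?_
    rw [eLpNorm_congr_ae h3, eLpNorm_sub_comm (J s), zero_add, two_mul]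
    exact add_le_add ((eLpNorm_condExp_le_eLpNorm _ (by norm_num)).trans (h2 t)) (h2 s)
  rw [nonpos_iff_eq_zero, eLpNorm_eq_zero_iff (hmc.sub (h.aestronglyMeasurable_integral s))
    (by norm_num)] at key
  exact key.mono fun ω hω => sub_eq_zero.1 hω

theorem ae_bot_eq_zero (h : IsL2Integral hW.incl_lt_top 𝓕 W φ M P) : ∀ᵐ ω ∂P, M ⊥ ω = 0 := by
  have h1 := h.eLpNorm_integral hW hT ⊥
  have h2 : (timeMeasure T).restrict (Set.Iic ⊥) = 0 := by
    rw [Measure.restrict_eq_zero, Set.Iic_bot, timeMeasure_singleton]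
  rw [h2, Measure.zero_prod, eLpNorm_measure_zero,
    eLpNorm_eq_zero_iff (h.aestronglyMeasurable_integral _) (by norm_num)] at h1
  exact h1

end IsL2Integral

end L2Integral

/-! ### Maximal inequality and continuous limits -/

section Maximal

variable {Ω : Type*} {mΩ : MeasurableSpace Ω} {P : Measure Ω} [IsProbabilityMeasure P] {T : ℝ≥0}
  {H : Type*} [NormedAddCommGroup H] [InnerProductSpace ℝ H] [CompleteSpace H]
  {𝓕 : Filtration (Set.Iic T) mΩ}

theorem MeasureTheory.Martingale.submartingale_norm {ι : Type*} [Preorder ι]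
    {𝓖 : Filtration ι mΩ} {M : ι → Ω → H} (hM : Martingale M 𝓖 P) :
    Submartingale (fun t ω => ‖M t ω‖) 𝓖 P := by
  refine ⟨fun t => (hM.stronglyMeasurable t).norm, fun s t hst => ?_,
    fun t => (hM.integrable t).norm⟩
  filter_upwards [norm_condExp_le (μ := P) (m := 𝓖 s) (M t), hM.condExp_ae_eq hst] with ω h1 h2
  rwa [h2] at h1

/-- The filtration sampled along a monotone sequence of times. -/
def MeasureTheory.Filtration.sample {ι : Type*} [Preorder ι] (𝓖 : Filtration ι mΩ) (time : ℕ → ι)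
    (h : Monotone time) : Filtration ℕ mΩ where
  seq k := 𝓖 (time k)
  mono' _ _ hkl := 𝓖.mono (h hkl)
  le' k := 𝓖.le (time k)

/-- Continuing the enumeration by ⊤ makes the discrete maximal inequality end at the final time,
whatever S is. -/
theorem Finset.exists_monotone_enumeration {ι : Type*} [LinearOrder ι] [OrderTop ι]
    (S : Finset ι) : ∃ (time : ℕ → ι) (n : ℕ), Monotone time ∧ time n = ⊤ ∧
      ∀ s ∈ S, ∃ k ≤ n, time k = s := by
  refine ⟨fun k => if h : k < S.card then S.orderEmbOfFin rfl ⟨k, h⟩ else ⊤, S.card, ?_, by simp,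
    fun s hs => ?_⟩
  · intro k l hkl
    by_cases hl : l < S.card
    · simp only [hl, hkl.trans_lt hl, dif_pos]
      exact (S.orderEmbOfFin rfl).monotone hkl
    · simp [hl]
  · have : s ∈ Set.range (S.orderEmbOfFin rfl) := by rwa [S.range_orderEmbOfFin rfl]
    obtain ⟨j, hj⟩ := this
    exact ⟨j, j.2.le, by simpa using hj⟩

/-- Doob's discrete inequality for the submartingale ‖M‖ along an enumeration of S ending at ⊤. The
resulting L¹ bound is weakened to L² since P has mass one, and it is uniform in S. -/
theorem MeasureTheory.Martingale.maximal_ineq_finset {M : Set.Iic T → Ω → H}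
    (hM : Martingale M 𝓕 P) (S : Finset (Set.Iic T)) (ε : ℝ≥0) :
    ε * P {ω | ∃ s ∈ S, ε ≤ ‖M s ω‖} ≤ eLpNorm (M ⊤) 2 P := by
  obtain ⟨time, n, hmono, htop, hS⟩ := S.exists_monotone_enumeration
  have hsub : Submartingale (fun k ω => ‖M (time k) ω‖) (𝓕.sample time hmono) P :=
    ⟨fun k => hM.submartingale_norm.1 (time k),
      fun k l hkl => hM.submartingale_norm.2.1 _ _ (hmono hkl),
      fun k => hM.submartingale_norm.2.2 _⟩
  have h := maximal_ineq hsub (fun _ _ => norm_nonneg _) (ε := ε) n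
  calc ε * P {ω | ∃ s ∈ S, ε ≤ ‖M s ω‖}
      ≤ ε * P {ω | (ε : ℝ) ≤ (Finset.range (n + 1)).sup' Finset.nonempty_range_add_one
          fun k => ‖M (time k) ω‖} := by
        gcongr
        rintro ⟨s, hs, hle⟩
        obtain ⟨k, hk, rfl⟩ := hS s hs
        exact Finset.le_sup'_of_le _ (Finset.mem_range.2 (Nat.lt_succ_of_le hk)) hle
    _ ≤ _ := h
    _ ≤ ENNReal.ofReal (∫ ω, ‖M (time n) ω‖ ∂P) := by
        refine ENNReal.ofReal_le_ofReal (setIntegral_le_integral (hM.integrable _).norm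
          (ae_of_all _ fun _ => norm_nonneg _))
    _ = eLpNorm (M ⊤) 1 P := by
        rw [htop, eLpNorm_one_eq_lintegral_enorm, ofReal_integral_norm_eq_lintegral_enorm
          (hM.integrable _)]
    _ ≤ eLpNorm (M ⊤) 2 P :=
        eLpNorm_le_eLpNorm_of_exponent_le (by norm_num) (hM.integrable _).1

/-- On a continuous path, the strict inequality holds on an open set of times, hence at a dense time
if anywhere. Continuity of P along the increasing finite sets of dense times finishes. -/
theorem MeasureTheory.Martingale.maximal_ineq_of_continuous {M : Set.Iic T → Ω → H}
    (hM : Martingale M 𝓕 P) (hc : ∀ᵐ ω ∂P, Continuous fun t => M t ω) (ε : ℝ≥0) :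
    ε * P {ω | ∃ t, ε < ‖M t ω‖} ≤ eLpNorm (M ⊤) 2 P := by
  classical
  let A : ℕ → Set Ω := fun n =>
    {ω | ∃ s ∈ (Finset.range n).image (TopologicalSpace.denseSeq (Set.Iic T)), ε ≤ ‖M s ω‖}
  have hA : Monotone A := by
    rintro m n hmn ω ⟨s, hs, hle⟩
    exact ⟨s, Finset.image_subset_image (Finset.range_mono hmn) hs, hle⟩
  have h1 : P {ω | ∃ t, ε < ‖M t ω‖} ≤ P (⋃ n, A n) := by
    refine measure_mono_ae ?_
    filter_upwards [hc] with ω hω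
    rintro ⟨t, ht⟩
    obtain ⟨i, hs⟩ := (TopologicalSpace.denseRange_denseSeq (Set.Iic T)).exists_mem_open
      (isOpen_lt continuous_const hω.norm) ⟨t, ht⟩
    exact Set.mem_iUnion.2 ⟨i + 1, _, Finset.mem_image_of_mem _
      (Finset.mem_range.2 (Nat.lt_succ_self i)), le_of_lt hs⟩
  refine (mul_le_mul_right h1 _).trans ?_
  rw [hA.measure_iUnion, ENNReal.mul_iSup]
  exact iSup_le fun n => hM.maximal_ineq_finset _ ε

/-- The limit of a sequence of adapted processes which almost surely converges pointwise to a
continuous path has an adapted version with continuous paths. -/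
theorem exists_continuous_adapted_limit
    (hnull : ∀ t A, MeasurableSet A → P A = 0 → MeasurableSet[𝓕 t] A)
    {J : ℕ → Set.Iic T → Ω → H} (hJ : ∀ n t, StronglyMeasurable[𝓕 t] (J n t))
    (hlim : ∀ᵐ ω ∂P, ∃ f : Set.Iic T → H, Continuous f ∧
      ∀ t, Tendsto (fun n => J n t ω) atTop (𝓝 (f t))) :
    ∃ M : Set.Iic T → Ω → H, (∀ ω, Continuous fun t => M t ω) ∧
      (∀ t, StronglyMeasurable[𝓕 t] (M t)) ∧
      ∀ᵐ ω ∂P, ∀ t, Tendsto (fun n => J n t ω) atTop (𝓝 (M t ω)) := by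
  classical
  -- A measurable null set covering the bad paths. It belongs to every 𝓕_t, so setting the limit to
  -- 0 on it keeps the limit adapted.
  set N := toMeasurable P {ω | ¬ ∃ f : Set.Iic T → H, Continuous f ∧
      ∀ t, Tendsto (fun n => J n t ω) atTop (𝓝 (f t))} with hN
  have hNm : MeasurableSet N := measurableSet_toMeasurable _ _
  have hN0 : P N = 0 := (measure_toMeasurable _).trans hlim
  have hex : ∀ ω, ω ∉ N → ∃ f : Set.Iic T → H, Continuous f ∧
      ∀ t, Tendsto (fun n => J n t ω) atTop (𝓝 (f t)) := fun ω hω => by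
    by_contra h
    exact hω (subset_toMeasurable _ _ h)
  choose! f hf using hex
  have hlimM : ∀ t ω, Tendsto (fun n => Nᶜ.indicator (J n t) ω) atTop
      (𝓝 (Nᶜ.indicator (fun ω => f ω t) ω)) := by
    intro t ω
    by_cases hω : ω ∈ N
    · simp [hω]
    · simpa [hω] using (hf ω hω).2 t
  refine ⟨fun t => Nᶜ.indicator fun ω => f ω t, fun ω => ?_, fun t => ?_, ?_⟩
  · by_cases hω : ω ∈ N
    · simpa [hω] using continuous_const
    · simpa [hω] using (hf ω hω).1
  · exact stronglyMeasurable_of_tendsto (f := fun n => Nᶜ.indicator (J n t)) atTop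
      (fun n => (hJ n t).indicator (hnull t N hNm hN0).compl)
      (tendsto_pi_nhds.2 (hlimM t))
  · filter_upwards [measure_eq_zero_iff_ae_notMem.1 hN0] with ω hω t
    simpa [hω] using (hf ω hω).2 t

/-- Two processes with continuous paths that are modifications of each other are
indistinguishable. -/
theorem ae_forall_eq_of_continuous {X Y : Set.Iic T → Ω → H} (h : ∀ t, X t =ᵐ[P] Y t)
    (hX : ∀ᵐ ω ∂P, Continuous fun t => X t ω) (hY : ∀ᵐ ω ∂P, Continuous fun t => Y t ω) :
    ∀ᵐ ω ∂P, ∀ t, X t ω = Y t ω := by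
  have h1 : ∀ᵐ ω ∂P, ∀ n, X (TopologicalSpace.denseSeq (Set.Iic T) n) ω =
      Y (TopologicalSpace.denseSeq (Set.Iic T) n) ω := ae_all_iff.2 fun n => h _
  filter_upwards [h1, hX, hY] with ω h hX hY t
  refine congrFun ((TopologicalSpace.denseRange_denseSeq (Set.Iic T)).equalizer hX hY ?_) t
  exact funext h

/-- Martingales which converge fast in `L²` converge almost surely to a continuous path. -/
theorem ae_exists_continuous_limit {M : ℕ → Set.Iic T → Ω → H}
    (hM : ∀ n, IsContSqIntMartingale 𝓕 (M n) P)
    (hfast : ∀ n, eLpNorm (M (n + 1) ⊤ - M n ⊤) 2 P ≤ (1 / 4) ^ n) :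
    ∀ᵐ ω ∂P, ∃ f : Set.Iic T → H, Continuous f ∧
      ∀ t, Tendsto (fun n => M n t ω) atTop (𝓝 (f t)) := by
  have hdc : ∀ n, ∀ᵐ ω ∂P, Continuous fun t => (M (n + 1) - M n) t ω := fun n => by
    filter_upwards [(hM (n + 1)).continuous, (hM n).continuous] with ω h1 h2 using h1.sub h2
  -- The rate (1/4)ⁿ is split between the level (1/2)ⁿ, summable so that paths are uniformly Cauchy,
  -- and the probability (1/2)ⁿ, summable for Borel–Cantelli.
  have hb : ∀ n, P {ω | ∃ t, (((1 / 2) ^ n : ℝ≥0) : ℝ) < ‖(M (n + 1) - M n) t ω‖} ≤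
      (1 / 2) ^ n := fun n => by
    have h := ((hM (n + 1)).martingale.sub (hM n).martingale).maximal_ineq_of_continuous (hdc n)
      ((1 / 2) ^ n)
    have h2 := h.trans (hfast n)
    have h3 : (((1 / 2) ^ n : ℝ≥0) : ℝ≥0∞) = (1 / 2) ^ n := by
      push_cast
      simp
    have h4 : (1 / 4 : ℝ≥0∞) = 1 / 2 * (1 / 2) := by
      rw [one_div, one_div, ← ENNReal.mul_inv (by norm_num) (by norm_num)]
      norm_num
    rw [h3, h4, mul_pow] at h2
    exact (ENNReal.mul_le_mul_iff_right (by simp) (by finiteness)).1 h2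
  have hsum : ∑' n, P {ω | ∃ t, (((1 / 2) ^ n : ℝ≥0) : ℝ) < ‖(M (n + 1) - M n) t ω‖} ≠ ∞ := by
    refine ne_top_of_le_ne_top ?_ (ENNReal.tsum_le_tsum hb)
    rw [ENNReal.tsum_geometric]
    simp
  filter_upwards [ae_eventually_notMem hsum, ae_all_iff.2 fun n => (hM n).continuous] with ω h hc
  obtain ⟨N, hN⟩ := eventually_atTop.1 h
  have hstep : ∀ n ≥ N, ∀ t, ‖M (n + 1) t ω - M n t ω‖ ≤ (1 / 2 : ℝ) ^ n := fun n hn t => by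
    have := hN n hn
    simp only [not_exists, not_lt] at this
    simpa using this t
  have hdist : ∀ t k, dist (M (N + k) t ω) (M (N + (k + 1)) t ω) ≤ (1 / 2) ^ N * (1 / 2) ^ k :=
    fun t k => by
      rw [dist_comm, dist_eq_norm, ← pow_add]
      exact hstep (N + k) (by omega) t
  have hcau : ∀ t, CauchySeq fun k => M (N + k) t ω := fun t =>
    cauchySeq_of_le_geometric _ _ (by norm_num) (hdist t)
  choose f hf using fun t => cauchySeq_tendsto_of_complete (hcau t)
  refine ⟨f, ?_, fun t => ?_⟩
  · have hunif : TendstoUniformly (fun k t => M (N + k) t ω) f atTop := by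
      rw [Metric.tendstoUniformly_iff]
      intro ε hε
      have h0 : Tendsto (fun k : ℕ => (1 / 2 : ℝ) ^ N * (1 / 2) ^ k / (1 - 1 / 2)) atTop (𝓝 0) := by
        have := (tendsto_pow_atTop_nhds_zero_of_lt_one (r := (1 / 2 : ℝ)) (by norm_num)
          (by norm_num)).const_mul ((1 / 2) ^ N) |>.div_const (1 - 1 / 2)
        simpa using this
      filter_upwards [h0.eventually_lt_const hε] with k hk t
      rw [dist_comm]
      exact (dist_le_of_le_geometric_of_tendsto _ _ (by norm_num) (hdist t) (hf t) k).trans_lt hk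
    exact hunif.continuous (Frequently.of_forall fun k => hc (N + k))
  · have := hf t
    simp_rw [add_comm N] at this
    exact (tendsto_add_atTop_iff_nat N).1 this

end Maximal

/-! ### Existence of the continuous integral of a square integrable process -/

section Existence

variable {Ω : Type*} {mΩ : MeasurableSpace Ω} {P : Measure Ω} [IsProbabilityMeasure P] {T : ℝ≥0}
  {U : Type*} [NormedAddCommGroup U] [InnerProductSpace ℝ U] [CompleteSpace U]
  [SecondCountableTopology U]
  {H : Type*} [NormedAddCommGroup H] [InnerProductSpace ℝ H] [CompleteSpace H]
  {𝓕 : Filtration (Set.Iic T) mΩ} {Q : U →L[ℝ] U} {W : ℝ≥0 → Ω → U}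
  {φ : Set.Iic T × Ω → HilbertSchmidt (RKSpace Q) H}

theorem IsL2Integral.isContSqIntMartingale (hW : IsWienerFor 𝓕 Q W H P) (hT : 0 < T)
    {M : Set.Iic T → Ω → H} (h : IsL2Integral hW.incl_lt_top 𝓕 W φ M P)
    (hφ : MemLp φ 2 ((timeMeasure T).prod P)) (hM : ∀ t, StronglyMeasurable[𝓕 t] (M t))
    (hc : ∀ᵐ ω ∂P, Continuous fun t => M t ω) : IsContSqIntMartingale 𝓕 M P where
  martingale := ⟨hM, fun _ _ hst => h.condExp_eq hW hT hφ hst⟩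
  continuous := hc
  sqIntegrable := h.memLp_integral hW hT hφ
  zero := h.ae_bot_eq_zero hW hT

/-- Every square integrable predictable process has a continuous stochastic integral. -/
theorem exists_isL2Integral (hW : IsWienerFor 𝓕 Q W H P) (hT : 0 < T)
    (hφm : StronglyMeasurable[𝓕.predictable] φ) (hφ : MemLp φ 2 ((timeMeasure T).prod P)) :
    ∃ M : Set.Iic T → Ω → H, (∀ ω, Continuous fun t => M t ω) ∧
      (∀ t, StronglyMeasurable[𝓕 t] (M t)) ∧ IsL2Integral hW.incl_lt_top 𝓕 W φ M P := by
  -- With these errors consecutive approximations differ by at most (1/4)ⁿ, the rate required by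
  -- `ae_exists_continuous_limit`.
  have hε : ∀ n : ℕ, (1 / 4 : ℝ≥0∞) ^ n / 2 ≠ 0 := fun n => by simp
  choose Y J hY hle using fun n => exists_isElementary_eLpNorm_sub_le (P := P) hW.incl_lt_top W
    hφm hφ (hε n)
  have hm := fun n => ((hY n).stronglyMeasurable_prod hW.incl_lt_top).aestronglyMeasurable
    (μ := (timeMeasure T).prod P)
  have hmart := fun n => (hY n).isContSqIntMartingale hW hT
  have hfast : ∀ n, eLpNorm (J (n + 1) ⊤ - J n ⊤) 2 P ≤ (1 / 4) ^ n := fun n => by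
    refine ((hY (n + 1)).eLpNorm_sub_le hW hT (hY n) ⊤).trans ((eLpNorm_sub_le_add
      (hm (n + 1)) hφ.1 (hm n)).trans ?_)
    rw [eLpNorm_sub_comm, ← ENNReal.add_halves ((1 / 4) ^ n)]
    refine add_le_add ((hle (n + 1)).trans ?_) (hle n)
    gcongr ?_ / 2
    exact pow_le_pow_right_of_le_one' (by norm_num) (Nat.le_succ n)
  obtain ⟨M, hMc, hMm, hMlim⟩ := exists_continuous_adapted_limit (P := P) hW.null
    (fun n t => (hmart n).martingale.stronglyMeasurable t) (ae_exists_continuous_limit hmart hfast)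
  refine ⟨M, hMc, hMm, IsL2Integral.of_tendsto hW hT (fun n => (hY n).isL2Integral hW hT) hφ.1 ?_
    fun t => hMlim.mono fun ω hω => hω t⟩
  refine tendsto_of_tendsto_of_tendsto_of_le_of_le tendsto_const_nhds
    (h := fun n : ℕ => (1 / 4 : ℝ≥0∞) ^ n / 2) ?_ (fun _ => zero_le) fun n => ?_
  · have := ENNReal.Tendsto.div_const (b := 2) (ENNReal.tendsto_pow_atTop_nhds_zero_of_lt_one
      (r := (1 / 4 : ℝ≥0∞)) (by norm_num)) (Or.inr (by norm_num))
    simpa using this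
  · beta_reduce
    rw [eLpNorm_sub_comm]
    exact hle n

end Existence

/-! ### From the L² relation to `IsItoIntegral` -/

section Ito

variable {Ω : Type*} {mΩ : MeasurableSpace Ω} {P : Measure Ω} [IsProbabilityMeasure P] {T : ℝ≥0}
  {U : Type*} [NormedAddCommGroup U] [InnerProductSpace ℝ U] [CompleteSpace U]
  {H : Type*} [NormedAddCommGroup H] [InnerProductSpace ℝ H] [CompleteSpace H]
  {𝓕 : Filtration (Set.Iic T) mΩ} {Q : U →L[ℝ] U} {W : ℝ≥0 → Ω → U}
  {φ : Set.Iic T → Ω → HilbertSchmidt (RKSpace Q) H} {M : Set.Iic T → Ω → H}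

theorem ENNReal.tendsto_sq_zero_iff {α : Type*} {l : Filter α} {f : α → ℝ≥0∞} :
    Tendsto (fun a => f a ^ 2) l (𝓝 0) ↔ Tendsto f l (𝓝 0) := by
  constructor
  · intro h
    have h2 := (ENNReal.continuous_rpow_const (y := 1 / 2)).tendsto 0 |>.comp h
    rw [ENNReal.zero_rpow_of_pos (by norm_num)] at h2
    refine h2.congr fun a => ?_
    rw [Function.comp_apply, ← ENNReal.rpow_natCast, ← ENNReal.rpow_mul]
    norm_num
  · intro h
    simpa using ENNReal.Tendsto.pow (n := 2) h

theorem lintegral_energy (hφ : AEStronglyMeasurable (Function.uncurry φ)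
    ((timeMeasure T).prod P)) (t : Set.Iic T) :
    ∫⁻ ω, energy φ t ω ∂P =
      eLpNorm (Function.uncurry φ) 2 (((timeMeasure T).restrict (Set.Iic t)).prod P) ^ 2 := by
  rw [eLpNorm_two_sq, lintegral_prod_symm]
  · rfl
  · exact ((hφ.mono_measure
      (Measure.prod_mono Measure.restrict_le_self le_rfl)).enorm.pow_const 2)

theorem energy_top (φ : Set.Iic T → Ω → HilbertSchmidt (RKSpace Q) H) (ω : Ω) :
    energy φ ⊤ ω = ∫⁻ s, ‖φ s ω‖ₑ ^ 2 ∂timeMeasure T := by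
  rw [energy, Set.Iic_top, Measure.restrict_univ]

theorem MeasureTheory.IsStronglyPredictable.aestronglyMeasurable_uncurry (hφ : IsStronglyPredictable 𝓕 φ) :
    AEStronglyMeasurable (Function.uncurry φ) ((timeMeasure T).prod P) :=
  (StronglyMeasurable.mono hφ (predictable_le_prod 𝓕)).aestronglyMeasurable

theorem IsSqIntegrand.memLp (hφ : IsSqIntegrand 𝓕 φ P) :
    MemLp (Function.uncurry φ) 2 ((timeMeasure T).prod P) := by
  have hm : AEStronglyMeasurable (Function.uncurry φ) ((timeMeasure T).prod P) :=
    hφ.predictable.aestronglyMeasurable_uncurry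
  have h := hφ.energy_lt_top
  rw [lintegral_energy hm, Set.Iic_top, Measure.restrict_univ] at h
  exact ⟨hm, (ENNReal.pow_lt_top_iff.1 h).resolve_right (by norm_num)⟩

/-- By Tonelli the iterated integral is a squared L² norm on the product space. Replacing `eval` by
the sum over intervals changes it only at time 0, a null set. -/
theorem approximatedBy_iff (hQ : hsENormSq (RKSpace.incl Q) < ∞)
    (hφ : AEStronglyMeasurable (Function.uncurry φ) ((timeMeasure T).prod P))
    (ψ : ℕ → SimpleProcess 𝓕 U H) :
    ApproximatedBy φ ψ P ↔ Tendsto (fun n => eLpNorm (Function.uncurry φ - fun p =>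
      restrictHS hQ (∑ m : Fin ((ψ n).N + 1), (Set.Ioc ((ψ n).time m.castSucc)
        ((ψ n).time m.succ)).indicator (fun _ => (ψ n).value m p.2) p.1)) 2
      ((timeMeasure T).prod P)) atTop (𝓝 0) := by
  rw [← ENNReal.tendsto_sq_zero_iff, ApproximatedBy]
  refine iff_of_eq (congrArg (Tendsto · atTop (𝓝 0)) (funext fun n => ?_))
  -- Measurability of the integrand does not involve the integrator, so a dummy is inserted.
  have hm := ((ψ n).isElementary (W := fun _ _ => 0)).stronglyMeasurable_prod hQ
  rw [eLpNorm_two_sq, lintegral_prod_symm]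
  · refine lintegral_congr fun ω => lintegral_congr_ae ?_
    filter_upwards [ae_time_ne_bot] with s hs
    rw [HilbertSchmidt.enorm_sq]
    simp only [Pi.sub_apply, Function.uncurry_apply_pair]
    rw [map_sub, toCLM_restrictHS, ← (ψ n).eval_eq_sum hs]
  · exact (hφ.sub hm.aestronglyMeasurable).enorm.pow_const 2

theorem integralsTendsto_iff (ψ : ℕ → SimpleProcess 𝓕 U H) :
    IntegralsTendsto ψ W M P ↔
      Tendsto (fun n => ⨆ t, eLpNorm (M t - (ψ n).integral W t) 2 P) atTop (𝓝 0) := by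
  rw [← ENNReal.tendsto_sq_zero_iff, IntegralsTendsto]
  refine iff_of_eq (congrArg (Tendsto · atTop (𝓝 0)) (funext fun n => ?_))
  rw [ENNReal.iSup_pow]
  refine iSup_congr fun t => ?_
  rw [eLpNorm_sub_comm, eLpNorm_two_sq]
  rfl

theorem IsItoIntegral.isL2Integral (hQ : hsENormSq (RKSpace.incl Q) < ∞)
    (hφ : AEStronglyMeasurable (Function.uncurry φ) ((timeMeasure T).prod P))
    (h : IsItoIntegral 𝓕 W φ M P) : IsL2Integral hQ 𝓕 W (Function.uncurry φ) M P where
  aestronglyMeasurable := hφ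
  aestronglyMeasurable_integral t := (h.memLp t).1
  exists_approx ε hε := by
    obtain ⟨ψ, h1, h2⟩ := h.exists_approx
    have hε' := pos_iff_ne_zero.2 hε
    obtain ⟨n, hn1, hn2⟩ := ((((approximatedBy_iff hQ hφ ψ).1 h1).eventually_lt_const hε').and
      (((integralsTendsto_iff ψ).1 h2).eventually_lt_const hε')).exists
    exact ⟨_, _, (ψ n).isElementary, hn1.le, fun t => (le_iSup _ t).trans hn2.le⟩

variable (hW : IsWienerFor 𝓕 Q W H P) (hT : 0 < T)

include hT

theorem IsL2Integral.integralsTendsto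
    (h : IsL2Integral hW.incl_lt_top 𝓕 W (Function.uncurry φ) M P)
    {ψ : ℕ → SimpleProcess 𝓕 U H} (hψ : ApproximatedBy φ ψ P) : IntegralsTendsto ψ W M P := by
  rw [approximatedBy_iff hW.incl_lt_top h.aestronglyMeasurable] at hψ
  rw [integralsTendsto_iff]
  exact tendsto_of_tendsto_of_tendsto_of_le_of_le tendsto_const_nhds hψ (fun _ => zero_le)
    fun n => iSup_le fun t => h.eLpNorm_sub_elementary_le hW hT (ψ n).isElementary t

include hW

theorem exists_approximatedBy [SecondCountableTopology U] (hφ : IsSqIntegrand 𝓕 φ P) :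
    ∃ ψ : ℕ → SimpleProcess 𝓕 U H, ApproximatedBy φ ψ P := by
  choose Y J hY hle using fun n : ℕ => exists_isElementary_eLpNorm_sub_le (P := P) hW.incl_lt_top W
    hφ.predictable hφ.memLp (ε := (n : ℝ≥0∞)⁻¹) (by simp)
  choose ψ hψ _ using fun n => (hY n).exists_simple hT
  refine ⟨ψ, (approximatedBy_iff hW.incl_lt_top hφ.memLp.1 ψ).2 ?_⟩
  refine tendsto_of_tendsto_of_tendsto_of_le_of_le tendsto_const_nhds
    ENNReal.tendsto_inv_nat_nhds_zero (fun _ => zero_le) fun n => ?_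
  refine le_of_eq_of_le (eLpNorm_congr_ae ?_) (hle n)
  filter_upwards [ae_prod_time_ne_bot] with p hp
  simp only [Pi.sub_apply]
  rw [← (ψ n).eval_eq_sum hp, hψ n _ _ hp]

theorem IsL2Integral.isItoIntegral [SecondCountableTopology U]
    (h : IsL2Integral hW.incl_lt_top 𝓕 W (Function.uncurry φ) M P) (hφ : IsSqIntegrand 𝓕 φ P) :
    IsItoIntegral 𝓕 W φ M P where
  memLp := h.memLp_integral hW hT hφ.memLp
  exists_approx :=
    (exists_approximatedBy hW hT hφ).imp fun _ hψ => ⟨hψ, h.integralsTendsto hW hT hψ⟩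

/-- Existence, uniqueness, isometry and path regularity of the stochastic integral of square
integrable predictable processes. -/
theorem exists_isItoIntegral [SecondCountableTopology U] (hφ : IsSqIntegrand 𝓕 φ P) :
    ∃ M : Set.Iic T → Ω → H,
      (∀ ω, Continuous fun t => M t ω) ∧
      IsContSqIntMartingale 𝓕 M P ∧
      (∀ t, ∫⁻ ω, ‖M t ω‖ₑ ^ 2 ∂P = ∫⁻ ω, energy φ t ω ∂P) ∧
      IsItoIntegral 𝓕 W φ M P ∧
      (∀ ψ : ℕ → SimpleProcess 𝓕 U H, ApproximatedBy φ ψ P → IntegralsTendsto ψ W M P) ∧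
      (∀ M' : Set.Iic T → Ω → H, IsItoIntegral 𝓕 W φ M' P →
        (∀ t, M' t =ᵐ[P] M t) ∧
        ((∀ᵐ ω ∂P, Continuous fun t => M' t ω) → ∀ᵐ ω ∂P, ∀ t, M' t ω = M t ω)) := by
  obtain ⟨M, hMc, hMm, hM⟩ := exists_isL2Integral hW hT hφ.predictable hφ.memLp
  refine ⟨M, hMc, hM.isContSqIntMartingale hW hT hφ.memLp hMm (ae_of_all _ hMc), fun t => ?_,
    hM.isItoIntegral hW hT hφ, fun ψ hψ => hM.integralsTendsto hW hT hψ, fun M' hM' => ?_⟩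
  · rw [lintegral_energy hφ.memLp.1, ← hM.eLpNorm_integral hW hT, eLpNorm_two_sq]
  · have h := (hM'.isL2Integral hW.incl_lt_top hφ.memLp.1).unique hW hT hM
    exact ⟨h, fun hc => ae_forall_eq_of_continuous h hc (ae_of_all _ hMc)⟩

end Ito

/-! ### Stopping the stochastic integral -/

section Stopping

variable {Ω : Type*} {mΩ : MeasurableSpace Ω} {P : Measure Ω} [IsProbabilityMeasure P] {T : ℝ≥0}
  {U : Type*} [NormedAddCommGroup U] [InnerProductSpace ℝ U] [CompleteSpace U]
  {H : Type*} [NormedAddCommGroup H] [InnerProductSpace ℝ H] [CompleteSpace H]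
  {𝓕 : Filtration (Set.Iic T) mΩ} {Q : U →L[ℝ] U} {W : ℝ≥0 → Ω → U}
  {σ : Ω → WithTop (Set.Iic T)}

theorem exists_denseSeq_mem_Ioo {s t : Set.Iic T} (h : s < t) :
    ∃ n, s < TopologicalSpace.denseSeq (Set.Iic T) n ∧
      TopologicalSpace.denseSeq (Set.Iic T) n < t := by
  obtain ⟨n, hn⟩ := (TopologicalSpace.denseRange_denseSeq (Set.Iic T)).exists_mem_open
    (isOpen_Ioo (a := s) (b := t)) (exists_between h)
  exact ⟨n, hn.1, hn.2⟩

/-- The complement {σ < t} is the union over dense times q of (q, T] × {σ ≤ q}, a countable union of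
predictable rectangles. -/
theorem measurableSet_predictable_le (hσ : IsStoppingTime 𝓕 σ) :
    MeasurableSet[𝓕.predictable]
      {p : Set.Iic T × Ω | (p.1 : WithTop (Set.Iic T)) ≤ σ p.2} := by
  have h : {p : Set.Iic T × Ω | (p.1 : WithTop (Set.Iic T)) ≤ σ p.2}ᶜ =
      ⋃ n, Set.Ioi (TopologicalSpace.denseSeq (Set.Iic T) n) ×ˢ
        {ω | σ ω ≤ TopologicalSpace.denseSeq (Set.Iic T) n} := by
    ext ⟨t, ω⟩
    simp only [Set.mem_compl_iff, Set.mem_ofPred_eq, not_le, Set.mem_iUnion, Set.mem_prod,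
      Set.mem_Ioi]
    constructor
    · intro h
      obtain ⟨s, hs⟩ := WithTop.ne_top_iff_exists.1 h.ne_top
      rw [← hs, WithTop.coe_lt_coe] at h
      obtain ⟨n, h1, h2⟩ := exists_denseSeq_mem_Ioo h
      exact ⟨n, h2, by rw [← hs]; exact WithTop.coe_le_coe.2 h1.le⟩
    · rintro ⟨n, h1, h2⟩
      exact h2.trans_lt (WithTop.coe_lt_coe.2 h1)
  have h2 := MeasurableSet.iUnion fun n => measurableSet_predictable_Ioi_prod
    (hσ (TopologicalSpace.denseSeq (Set.Iic T) n))
  rw [← h] at h2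
  exact MeasurableSet.of_compl h2

theorem uncurry_truncate (φ : Set.Iic T → Ω → HilbertSchmidt (RKSpace Q) H)
    (σ : Ω → WithTop (Set.Iic T)) : Function.uncurry (truncate φ σ) =
      {p : Set.Iic T × Ω | (p.1 : WithTop (Set.Iic T)) ≤ σ p.2}.indicator (Function.uncurry φ) := by
  classical
  funext ⟨t, ω⟩
  by_cases h : (t : WithTop (Set.Iic T)) ≤ σ ω
  · rw [Function.uncurry_apply_pair, truncate, if_pos h, Set.indicator_of_mem (by exact h)]
    rfl
  · rw [Function.uncurry_apply_pair, truncate, if_neg h, Set.indicator_of_notMem (by exact h)]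

theorem MeasureTheory.IsStronglyPredictable.truncate
    {φ : Set.Iic T → Ω → HilbertSchmidt (RKSpace Q) H} (hφ : IsStronglyPredictable 𝓕 φ)
    (hσ : IsStoppingTime 𝓕 σ) : IsStronglyPredictable 𝓕 (truncate φ σ) := by
  rw [IsStronglyPredictable, uncurry_truncate]
  exact StronglyMeasurable.indicator hφ (measurableSet_predictable_le hσ)

/-- The elements of `S` satisfying `p` without smaller such elements. -/
def Finset.firstIn {ι : Type*} [LinearOrder ι] (S : Finset ι) (p : ι → Prop) : Set ι :=
  {g | p g ∧ ∀ g' ∈ S, g' < g → ¬ p g'}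

/-- At most one element of S is first, so the sum collapses to its term. With p g meaning σ ≤ g,
that element is the value of σ rounded up to S. -/
theorem Finset.sum_indicator_firstIn {ι G : Type*} [LinearOrder ι] [AddCommMonoid G]
    (S : Finset ι) (p : ι → Prop) (f : ι → G) :
    ((∀ g ∈ S, ¬ p g) ∧ ∑ g ∈ S, (S.firstIn p).indicator f g = 0) ∨
    ∃ g ∈ S, p g ∧ (∀ g' ∈ S, p g' → g ≤ g') ∧ ∑ g ∈ S, (S.firstIn p).indicator f g = f g := by
  classical
  by_cases h : ∃ g ∈ S, p g
  · right
    have hne : (S.filter p).Nonempty := h.imp fun g hg => Finset.mem_filter.2 hg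
    obtain ⟨hgS, hgp⟩ := Finset.mem_filter.1 ((S.filter p).min'_mem hne)
    have hmin : ∀ g' ∈ S, p g' → (S.filter p).min' hne ≤ g' := fun g' hg' hp =>
      (S.filter p).min'_le _ (Finset.mem_filter.2 ⟨hg', hp⟩)
    refine ⟨_, hgS, hgp, hmin, ?_⟩
    rw [Finset.sum_eq_single _ _ fun h => absurd hgS h, Set.indicator_of_mem]
    · exact ⟨hgp, fun g' hg' hlt hp => not_lt.2 (hmin g' hg' hp) hlt⟩
    · intro g hg hne'
      exact Set.indicator_of_notMem
        (fun hh => hh.2 _ hgS (lt_of_le_of_ne (hmin g hg hh.1) hne'.symm) hgp) _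
  · left
    push Not at h
    exact ⟨h, Finset.sum_eq_zero fun g hg => Set.indicator_of_notMem (fun hh => h g hg hh.1) _⟩

variable {φ : Set.Iic T × Ω → HilbertSchmidt (RKSpace Q) H} {M : Set.Iic T → Ω → H}

/-- When A g is the event that the rounded stopping time equals g, subtracting the cuts removes the
integrand after that time and freezes the integral there. -/
theorem IsL2Integral.sub_sum_cut (hW : IsWienerFor 𝓕 Q W H P) (hT : 0 < T)
    (h : IsL2Integral hW.incl_lt_top 𝓕 W φ M P) (S : Finset (Set.Iic T))
    {A : Set.Iic T → Set Ω} (hA : ∀ g, MeasurableSet[𝓕 g] (A g)) :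
    IsL2Integral hW.incl_lt_top 𝓕 W (φ - ∑ g ∈ S, (Set.Ioi g ×ˢ A g).indicator φ)
      (fun t => M t - ∑ g ∈ S, (A g).indicator (M t - M (min g t))) P := by
  classical
  induction S using Finset.induction_on with
  | empty => simpa using h
  | insert g S hg ih =>
    have h2 := ih.sub hW hT (h.cut hW hT g (hA g))
    simp only [sub_sub] at h2
    simp only [Finset.sum_insert hg]
    convert h2 using 2
    · rw [add_comm]
    · rw [add_comm]

theorem WithTop.untopA_coe_eq {α : Type*} [Nonempty α] (a : α) : (a : WithTop α).untopA = a :=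
  rfl

theorem MeasureTheory.stoppedProcess_of_le {u : Set.Iic T → Ω → H} {t : Set.Iic T} {ω : Ω}
    (h : (t : WithTop (Set.Iic T)) ≤ σ ω) : stoppedProcess u σ t ω = u t ω := by
  rw [stoppedProcess, min_eq_left h, WithTop.untopA_coe_eq]

theorem MeasureTheory.stoppedProcess_of_eq_coe {u : Set.Iic T → Ω → H} {s t : Set.Iic T} {ω : Ω}
    (h : σ ω = s) : stoppedProcess u σ t ω = u (min t s) ω := by
  rw [stoppedProcess, h, ← WithTop.coe_min, WithTop.untopA_coe_eq]

/-- The expression is x at min t g, where g is the first point of S k not before r, and x t if there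
is none. For t ≤ r it equals x t for every k; for r < t the points g approach r from above and
continuity applies. -/
theorem tendsto_sub_sum_first {x : Set.Iic T → H} (hx : Continuous x) (r : WithTop (Set.Iic T))
    (t : Set.Iic T) {S : ℕ → Finset (Set.Iic T)}
    (hS : ∀ k, S k = (Finset.range k).image (TopologicalSpace.denseSeq (Set.Iic T))) :
    Tendsto (fun k => x t - ∑ g ∈ S k,
      ((S k).firstIn fun g => r ≤ (g : WithTop (Set.Iic T))).indicator
        (fun g => x t - x (min g t)) g) atTop
      (𝓝 (x (min (t : WithTop (Set.Iic T)) r).untopA)) := by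
  rcases le_or_gt (t : WithTop (Set.Iic T)) r with htr | hrt
  · rw [min_eq_left htr, WithTop.untopA_coe_eq]
    refine tendsto_const_nhds.congr fun k => ?_
    rcases (S k).sum_indicator_firstIn
      (fun g => r ≤ (g : WithTop (Set.Iic T))) (fun g => x t - x (min g t)) with
      ⟨-, h⟩ | ⟨g, -, hg, -, h⟩
    · rw [h, sub_zero]
    · rw [h, min_eq_right (WithTop.coe_le_coe.1 (htr.trans hg)), sub_self, sub_zero]
  · obtain ⟨s, rfl⟩ := WithTop.ne_top_iff_exists.1 hrt.ne_top
    rw [min_eq_right hrt.le, WithTop.untopA_coe_eq]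
    rw [WithTop.coe_lt_coe] at hrt
    rw [Metric.tendsto_nhds]
    intro ε hε
    obtain ⟨u, hu, hsub⟩ := exists_Ico_subset_of_mem_nhds
      ((Metric.tendsto_nhds.1 (hx.tendsto s)) ε hε) ⟨t, hrt⟩
    -- Once this dense time is in S k, the first point g lies in [s, u) and before t.
    obtain ⟨n, hn1, hn2⟩ := exists_denseSeq_mem_Ioo (lt_min hu hrt)
    filter_upwards [eventually_gt_atTop n] with k hk
    have hmem : TopologicalSpace.denseSeq (Set.Iic T) n ∈ S k :=
      hS k ▸ Finset.mem_image_of_mem _ (Finset.mem_range.2 hk)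
    rcases (S k).sum_indicator_firstIn
      (fun g => (s : WithTop (Set.Iic T)) ≤ (g : WithTop (Set.Iic T)))
      (fun g => x t - x (min g t)) with ⟨h0, -⟩ | ⟨g, -, hg, hmin, h⟩
    · exact absurd (WithTop.coe_le_coe.2 hn1.le) (h0 _ hmem)
    · have hgn : g ≤ _ := hmin _ hmem (WithTop.coe_le_coe.2 hn1.le)
      have hgu := hgn.trans_lt hn2
      rw [h, sub_sub_cancel, min_eq_left (hgu.le.trans (min_le_right _ _))]
      exact hsub ⟨WithTop.coe_le_coe.1 hg, hgu.trans_le (min_le_left _ _)⟩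

theorem sub_sum_first_eq {E : Type*} [AddCommGroup E] (y : E) (S : Finset (Set.Iic T))
    (r : WithTop (Set.Iic T)) (t : Set.Iic T) :
    y - ∑ g ∈ S, (S.firstIn fun g => r ≤ (g : WithTop (Set.Iic T))).indicator
        (fun g => (Set.Ioi g).indicator (fun _ => y) t) g =
      {t | ∃ g ∈ S, r ≤ (g : WithTop (Set.Iic T)) ∧ g < t}ᶜ.indicator (fun _ => y) t := by
  rcases S.sum_indicator_firstIn (fun g => r ≤ (g : WithTop (Set.Iic T)))
    (fun g => (Set.Ioi g).indicator (fun _ => y) t) with ⟨h0, h⟩ | ⟨g, hgS, hg, hmin, h⟩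
  · rw [h, sub_zero, Set.indicator_of_mem]
    rintro ⟨g, hgS, hg, -⟩
    exact h0 g hgS hg
  · rw [h]
    by_cases hgt : g < t
    · rw [Set.indicator_of_mem (Set.mem_Ioi.2 hgt), Set.indicator_of_notMem, sub_self]
      exact fun hh => hh ⟨g, hgS, hg, hgt⟩
    · rw [Set.indicator_of_notMem (by simpa using hgt), Set.indicator_of_mem, sub_zero]
      rintro ⟨g', hgS', hg', hlt⟩
      exact hgt ((hmin g' hgS' hg').trans_lt hlt)

/-- The stopped stochastic integral is the integral of the truncated process. -/
theorem IsL2Integral.stopped_indicator (hW : IsWienerFor 𝓕 Q W H P) (hT : 0 < T)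
    (h : IsL2Integral hW.incl_lt_top 𝓕 W φ M P) (hφ : MemLp φ 2 ((timeMeasure T).prod P))
    (hc : ∀ᵐ ω ∂P, Continuous fun t => M t ω) (hσ : IsStoppingTime 𝓕 σ) :
    IsL2Integral hW.incl_lt_top 𝓕 W
      ({p : Set.Iic T × Ω | (p.1 : WithTop (Set.Iic T)) ≤ σ p.2}.indicator φ)
      (stoppedProcess M σ) P := by
  classical
  let S : ℕ → Finset (Set.Iic T) := fun k =>
    (Finset.range k).image (TopologicalSpace.denseSeq (Set.Iic T))
  let A : ℕ → Set.Iic T → Set Ω := fun k g =>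
    {ω | g ∈ (S k).firstIn fun g => σ ω ≤ (g : WithTop (Set.Iic T))}
  -- Being rounded up to g only involves the events {σ ≤ g'} with g' ≤ g, so the rounded time is
  -- again a stopping time.
  have hA : ∀ k g, MeasurableSet[𝓕 g] (A k g) := fun k g => by
    have : A k g = {ω | σ ω ≤ (g : WithTop (Set.Iic T))} ∩
        ⋂ g' ∈ (S k).filter (· < g), {ω | σ ω ≤ (g' : WithTop (Set.Iic T))}ᶜ := by
      ext ω
      simp [A, Finset.firstIn]
    rw [this]
    refine (hσ g).inter (Finset.measurableSet_biInter _ fun g' hg' => ?_)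
    exact (𝓕.mono (Finset.mem_filter.1 hg').2.le _ (hσ g')).compl
  have hind := hφ.1.indicator (predictable_le_prod 𝓕 _ (measurableSet_predictable_le hσ))
  have hk := fun k => h.sub_sum_cut hW hT (S k) (hA k)
  have heq : ∀ k, φ - ∑ g ∈ S k, (Set.Ioi g ×ˢ A k g).indicator φ = fun p =>
      {t | ∃ g ∈ S k, σ p.2 ≤ (g : WithTop (Set.Iic T)) ∧ g < t}ᶜ.indicator
        (fun _ => φ p) p.1 := by
    intro k
    funext p
    rw [← sub_sum_first_eq, Pi.sub_apply, Finset.sum_apply]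
    congr 1
    refine Finset.sum_congr rfl fun g _ => ?_
    by_cases h1 : p.2 ∈ A k g
    · rw [Set.indicator_of_mem (s := (S k).firstIn _) h1]
      by_cases h2 : g < p.1
      · rw [Set.indicator_of_mem (Set.mem_prod.2 ⟨h2, h1⟩), Set.indicator_of_mem (Set.mem_Ioi.2 h2)]
      · rw [Set.indicator_of_notMem fun hh => h2 (Set.mem_prod.1 hh).1,
          Set.indicator_of_notMem (by simpa using h2)]
    · rw [Set.indicator_of_notMem fun hh => h1 (Set.mem_prod.1 hh).2,
        Set.indicator_of_notMem (s := (S k).firstIn _) h1]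
  refine IsL2Integral.of_tendsto hW hT hk hind ?_ fun t => ?_
  · rw [← ENNReal.tendsto_sq_zero_iff]
    simp_rw [eLpNorm_two_sq]
    rw [← lintegral_zero (μ := (timeMeasure T).prod P)]
    -- At each point the difference is eventually zero: it vanishes up to σ, and after σ a dense
    -- time strictly between σ and t eventually enters S k.
    refine tendsto_lintegral_of_dominated_convergence' (fun p => ‖φ p‖ₑ ^ 2) (fun k =>
      ((hk k).aestronglyMeasurable.sub hind).enorm.pow_const 2) (fun k => ae_of_all _ fun p => ?_)
      ?_ (ae_of_all _ fun p => ?_)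
    · rw [heq]
      have : ‖({t | ∃ g ∈ S k, σ p.2 ≤ (g : WithTop (Set.Iic T)) ∧ g < t}ᶜ.indicator
          (fun _ => φ p) p.1 - {p : Set.Iic T × Ω |
            (p.1 : WithTop (Set.Iic T)) ≤ σ p.2}.indicator φ p)‖ₑ ≤ ‖φ p‖ₑ := by
        simp only [Set.indicator]
        split_ifs <;> simp
      exact pow_le_pow_left' this 2
    · rw [← eLpNorm_two_sq]
      exact (ENNReal.pow_lt_top hφ.2).ne
    · refine tendsto_const_nhds.congr' ?_
      rcases le_or_gt (p.1 : WithTop (Set.Iic T)) (σ p.2) with hle | hlt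
      · filter_upwards with k
        rw [heq, Pi.sub_apply, Set.indicator_of_mem, Set.indicator_of_mem (by exact hle)]
        · simp
        · rintro ⟨g, -, hg, hlt⟩
          exact absurd (WithTop.coe_le_coe.1 (hle.trans hg)) (not_le.2 hlt)
      · obtain ⟨s, hs⟩ := WithTop.ne_top_iff_exists.1 hlt.ne_top
        rw [← hs, WithTop.coe_lt_coe] at hlt
        obtain ⟨n, hn1, hn2⟩ := exists_denseSeq_mem_Ioo hlt
        filter_upwards [eventually_gt_atTop n] with k hk
        rw [heq, Pi.sub_apply, Set.indicator_of_notMem, Set.indicator_of_notMem]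
        · simp
        rotate_left
        · exact fun hh => hh ⟨_, Finset.mem_image_of_mem _ (Finset.mem_range.2 hk), by
            rw [← hs]; exact WithTop.coe_le_coe.2 hn1.le, hn2⟩
        · rw [Set.mem_ofPred_eq, ← hs, WithTop.coe_le_coe, not_le]
          exact hlt
  · filter_upwards [hc] with ω hω
    refine (tendsto_sub_sum_first hω (σ ω) t fun k => rfl).congr fun k => ?_
    rw [Pi.sub_apply, Finset.sum_apply]
    rfl

end Stopping

/-! ### Level crossing times of the energy -/

section HittingTime

variable {T : ℝ≥0}

/-- The infimum is formed in ℝ≥0, where it stays below T if the set is nonempty; the empty set gets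
⊤, that is, no stopping on [0, T]. -/
theorem exists_isGLB_withTop (p : Set.Iic T → Prop) :
    ∃ r : WithTop (Set.Iic T), IsGLB {t : WithTop (Set.Iic T) | ∃ s : Set.Iic T, t = s ∧ p s} r := by
  by_cases h : ∃ s, p s
  · obtain ⟨s₀, hs₀⟩ := h
    have hbdd : BddBelow (Subtype.val '' {s : Set.Iic T | p s}) := OrderBot.bddBelow _
    have hle : ∀ s, p s → sInf (Subtype.val '' {s : Set.Iic T | p s}) ≤ s.1 := fun s hs =>
      csInf_le hbdd ⟨s, hs, rfl⟩
    refine ⟨((⟨_, (hle s₀ hs₀).trans s₀.2⟩ : Set.Iic T) : WithTop (Set.Iic T)), ?_, ?_⟩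
    · rintro _ ⟨s, rfl, hs⟩
      exact WithTop.coe_le_coe.2 (hle s hs)
    · intro b hb
      obtain ⟨b, rfl⟩ := WithTop.ne_top_iff_exists.1
        ((hb ⟨s₀, rfl, hs₀⟩).trans_lt (WithTop.coe_lt_top _)).ne
      refine WithTop.coe_le_coe.2 (Subtype.coe_le_coe.1 (le_csInf ⟨s₀.1, s₀, hs₀, rfl⟩ ?_))
      rintro _ ⟨s, hs, rfl⟩
      exact Subtype.coe_le_coe.2 (WithTop.coe_le_coe.1 (hb ⟨s, rfl, hs⟩))
  · push Not at h
    refine ⟨⊤, ?_, fun _ _ => le_top⟩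
    rintro _ ⟨s, rfl, hs⟩
    exact absurd hs (h s)

variable {e : Set.Iic T → ℝ≥0∞} {c : ℝ≥0∞} {r : WithTop (Set.Iic T)}

/-- A countable description of {r ≤ t} that needs no continuity of e. Times after t are tested
because the infimum need not be attained; after ⊤ there are none, hence the second clause. -/
theorem isGLB_le_coe_iff (he : Monotone e)
    (hr : IsGLB {t : WithTop (Set.Iic T) | ∃ s : Set.Iic T, t = s ∧ c ≤ e s} r) (t : Set.Iic T) :
    r ≤ t ↔ (∀ n, t < TopologicalSpace.denseSeq (Set.Iic T) n →
      c ≤ e (TopologicalSpace.denseSeq (Set.Iic T) n)) ∧ (t = ⊤ → c ≤ e ⊤) := by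
  constructor
  · intro h
    constructor
    · intro n hn
      obtain ⟨_, ⟨s, rfl, hs⟩, hlt⟩ := (isGLB_lt_iff hr).1 (h.trans_lt (WithTop.coe_lt_coe.2 hn))
      exact hs.trans (he (WithTop.coe_lt_coe.1 hlt).le)
    · intro _
      obtain ⟨_, ⟨s, rfl, hs⟩, -⟩ := (isGLB_lt_iff hr).1 (h.trans_lt (WithTop.coe_lt_top _))
      exact hs.trans (he le_top)
  · rintro ⟨h1, h2⟩
    rcases eq_or_lt_of_le (le_top (a := t)) with rfl | ht
    · exact hr.1 ⟨_, rfl, h2 rfl⟩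
    · by_contra hlt
      rw [not_le] at hlt
      obtain ⟨u, htu, hur⟩ : ∃ u : Set.Iic T, t < u ∧ (u : WithTop (Set.Iic T)) ≤ r := by
        rcases eq_or_ne r ⊤ with rfl | hne
        · exact ⟨⊤, ht, le_top⟩
        · obtain ⟨s, rfl⟩ := WithTop.ne_top_iff_exists.1 hne
          exact ⟨s, WithTop.coe_lt_coe.1 hlt, le_rfl⟩
      obtain ⟨n, hn1, hn2⟩ := exists_denseSeq_mem_Ioo htu
      exact not_lt.2 (hr.1 ⟨_, rfl, h1 n hn1⟩) ((WithTop.coe_lt_coe.2 hn2).trans_le hur)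

end HittingTime

/-! ### The energy process and its level times -/

section Energy

variable {Ω : Type*} {mΩ : MeasurableSpace Ω} {P : Measure Ω} [IsProbabilityMeasure P] {T : ℝ≥0}
  {U : Type*} [NormedAddCommGroup U] [InnerProductSpace ℝ U] [CompleteSpace U]
  {H : Type*} [NormedAddCommGroup H] [InnerProductSpace ℝ H] [CompleteSpace H]
  {𝓕 : Filtration (Set.Iic T) mΩ} {Q : U →L[ℝ] U}
  {φ : Set.Iic T → Ω → HilbertSchmidt (RKSpace Q) H} {c : ℝ≥0∞} {r : WithTop (Set.Iic T)} {ω : Ω}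

theorem energy_mono (φ : Set.Iic T → Ω → HilbertSchmidt (RKSpace Q) H) (ω : Ω) :
    Monotone fun t => energy φ t ω :=
  fun _ _ h => lintegral_mono_set (Set.Iic_subset_Iic.2 h)

theorem energy_eq_withDensity (φ : Set.Iic T → Ω → HilbertSchmidt (RKSpace Q) H) (ω : Ω)
    (t : Set.Iic T) :
    energy φ t ω = (timeMeasure T).withDensity (fun s => ‖φ s ω‖ₑ ^ 2) (Set.Iic t) :=
  (withDensity_apply _ measurableSet_Iic).symm

/-- Right continuity of the energy: continuity from above of the measure with density ‖φ_s‖², which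
requires finite mass. -/
theorem le_energy_of_forall_gt (hfin : energy φ ⊤ ω ≠ ∞) {t : Set.Iic T} (ht : t < ⊤)
    (h : ∀ n, t < TopologicalSpace.denseSeq (Set.Iic T) n →
      c ≤ energy φ (TopologicalSpace.denseSeq (Set.Iic T) n) ω) : c ≤ energy φ t ω := by
  have hlim := tendsto_measure_biInter_gt
    (μ := (timeMeasure T).withDensity (fun s => ‖φ s ω‖ₑ ^ 2)) (s := fun u => Set.Iic u) (a := t)
    (fun u _ => measurableSet_Iic.nullMeasurableSet) (fun i j _ hij => Set.Iic_subset_Iic.2 hij)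
    ⟨⊤, ht, by rw [← energy_eq_withDensity]; exact hfin⟩
  have hinter : ⋂ u > t, Set.Iic u = Set.Iic t := by
    ext s
    simp only [Set.mem_iInter, Set.mem_Iic]
    exact ⟨fun h => le_of_forall_gt_imp_ge_of_dense fun u hu => h u hu,
      fun h u hu => h.trans (le_of_lt hu)⟩
  rw [hinter, ← energy_eq_withDensity] at hlim
  have : (𝓝[>] t).NeBot := nhdsGT_neBot_of_exists_gt ⟨⊤, ht⟩
  refine ge_of_tendsto hlim ?_
  filter_upwards [self_mem_nhdsWithin] with u hu
  obtain ⟨n, hn1, hn2⟩ := exists_denseSeq_mem_Ioo (Set.mem_Ioi.1 hu)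
  rw [Function.comp_apply, ← energy_eq_withDensity]
  exact (h n hn1).trans (energy_mono φ ω hn2.le)

theorem isGLB_energy_le_coe_iff (hfin : energy φ ⊤ ω ≠ ∞)
    (hr : IsGLB {t : WithTop (Set.Iic T) | ∃ s : Set.Iic T, t = s ∧ c ≤ energy φ s ω} r)
    (t : Set.Iic T) : r ≤ t ↔ c ≤ energy φ t ω := by
  refine ⟨fun h => ?_, fun h => hr.1 ⟨t, rfl, h⟩⟩
  obtain ⟨h1, h2⟩ := (isGLB_le_coe_iff (energy_mono φ ω) hr t).1 h
  rcases eq_or_lt_of_le (le_top (a := t)) with rfl | ht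
  · exact h2 rfl
  · exact le_energy_of_forall_gt hfin ht h1

/-- Before τ the energy is below c. The single time τ is null, so the energy up to τ is the supremum
of the energies at dense times before it. This holds on every path, even one whose energy jumps to
infinity. -/
theorem energy_truncate_le {τ : Ω → WithTop (Set.Iic T)}
    (hr : IsGLB {t : WithTop (Set.Iic T) | ∃ s : Set.Iic T, t = s ∧ c ≤ energy φ s ω} (τ ω)) :
    energy (truncate φ τ) ⊤ ω ≤ c := by
  rcases eq_or_ne (τ ω) ⊤ with htop | hne
  · have h1 : ∀ s, truncate φ τ s ω = φ s ω := fun s => by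
      rw [truncate, htop, if_pos le_top]
    simp only [energy, h1]
    by_contra hlt
    have h2 := hr.1 ⟨⊤, rfl, (not_le.1 hlt).le⟩
    rw [htop] at h2
    exact absurd (h2.trans_lt (WithTop.coe_lt_top _)) (lt_irrefl _)
  · obtain ⟨s₀, hs₀⟩ := WithTop.ne_top_iff_exists.1 hne
    rw [← hs₀] at hr
    have h1 : ∀ s, ‖truncate φ τ s ω‖ₑ ^ 2 =
        (Set.Iic s₀).indicator (fun s => ‖φ s ω‖ₑ ^ 2) s := fun s => by
      rw [truncate, ← hs₀]
      by_cases hs : s ≤ s₀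
      · rw [if_pos (WithTop.coe_le_coe.2 hs), Set.indicator_of_mem (Set.mem_Iic.2 hs)]
      · rw [if_neg (by rwa [WithTop.coe_le_coe]), Set.indicator_of_notMem (by simpa using hs)]
        simp
    rw [energy_top, lintegral_congr h1, lintegral_indicator measurableSet_Iic,
      ← setLIntegral_congr (Iio_ae_eq_Iic (μ := timeMeasure T)),
      ← withDensity_apply _ measurableSet_Iio]
    have hunion : Set.Iio s₀ = ⋃ n : {n // TopologicalSpace.denseSeq (Set.Iic T) n < s₀},
        Set.Iic (TopologicalSpace.denseSeq (Set.Iic T) n) := by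
      ext s
      simp only [Set.mem_Iio, Set.mem_iUnion, Set.mem_Iic]
      constructor
      · intro hs
        obtain ⟨n, hn1, hn2⟩ := exists_denseSeq_mem_Ioo hs
        exact ⟨⟨n, hn2⟩, hn1.le⟩
      · rintro ⟨n, hn⟩
        exact hn.trans_lt n.2
    rw [hunion, Directed.measure_iUnion]
    · refine iSup_le fun n => ?_
      rw [← energy_eq_withDensity]
      by_contra hlt
      exact absurd (WithTop.coe_le_coe.1 (hr.1 ⟨_, rfl, (not_le.1 hlt).le⟩)) (not_le.2 n.2)
    · intro m n
      rcases le_total (TopologicalSpace.denseSeq (Set.Iic T) m)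
        (TopologicalSpace.denseSeq (Set.Iic T) n) with h | h
      · exact ⟨n, Set.Iic_subset_Iic.2 h, le_rfl⟩
      · exact ⟨m, le_rfl, Set.Iic_subset_Iic.2 h⟩

/-- Predictable processes are progressive, so Tonelli on [0, t] × Ω can be applied with the
σ-algebra 𝓕_t. -/
theorem MeasureTheory.IsStronglyPredictable.measurable_energy (hφ : IsStronglyPredictable 𝓕 φ)
    (t : Set.Iic T) : Measurable[𝓕 t] (energy φ t) := by
  have h1 := hφ.isStronglyProgressive t
  have h2 : energy φ t = fun ω => ∫⁻ s : Set.Iic t, ‖φ s ω‖ₑ ^ 2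
      ∂((timeMeasure T).comap Subtype.val) := by
    funext ω
    rw [lintegral_subtype_comap (f := fun s => ‖φ s ω‖ₑ ^ 2) measurableSet_Iic]
    rfl
  rw [h2]
  exact @Measurable.lintegral_prod_left' _ _ _ (𝓕 t) _ _ _ (h1.enorm.pow_const 2)

/-- On paths of finite energy the infimum is attained, so {τ ≤ t} is {c ≤ energy at t}, an event of
𝓕_t. The other paths form a null set Z, absorbed by the augmentation. -/
theorem isStoppingTime_energy (hnull : ∀ t A, MeasurableSet A → P A = 0 → MeasurableSet[𝓕 t] A)
    (hφ : IsLocalIntegrand 𝓕 φ P) {τ : Ω → WithTop (Set.Iic T)}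
    (hτ : ∀ ω, IsGLB {t : WithTop (Set.Iic T) | ∃ s : Set.Iic T, t = s ∧ c ≤ energy φ s ω}
      (τ ω)) : IsStoppingTime 𝓕 τ := by
  intro t
  have hm := fun s => hφ.predictable.measurable_energy s
  set Z := {ω | energy φ ⊤ ω = ∞} with hZ
  have hZm : MeasurableSet Z := ((hm ⊤).mono (𝓕.le ⊤) le_rfl) (measurableSet_singleton ∞)
  have hZ0 : P Z = 0 := by
    rw [hZ, measure_eq_zero_iff_ae_notMem]
    filter_upwards [hφ.energy_lt_top] with ω hω using hω.ne
  -- The augmentation contains only measurable null sets, so the part of {τ ≤ t} inside Z must first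
  -- be shown measurable.
  have hB : MeasurableSet {ω | τ ω ≤ t} := by
    have : {ω | τ ω ≤ t} = (⋂ n, {ω | t < TopologicalSpace.denseSeq (Set.Iic T) n →
        c ≤ energy φ (TopologicalSpace.denseSeq (Set.Iic T) n) ω}) ∩
        {ω | t = ⊤ → c ≤ energy φ ⊤ ω} := by
      ext ω
      simp only [Set.mem_inter_iff, Set.mem_iInter]
      exact isGLB_le_coe_iff (energy_mono φ ω) (hτ ω) t
    rw [this]
    refine (MeasurableSet.iInter fun n => ?_).inter ?_
    · by_cases hn : t < TopologicalSpace.denseSeq (Set.Iic T) n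
      · simpa only [hn, true_imp_iff] using
          measurableSet_le measurable_const ((hm _).mono (𝓕.le _) le_rfl)
      · simp [hn]
    · by_cases hn : t = ⊤
      · simpa only [hn, true_imp_iff] using
          measurableSet_le measurable_const ((hm _).mono (𝓕.le _) le_rfl)
      · simp [hn]
  have hsplit : {ω | τ ω ≤ t} = ({ω | c ≤ energy φ t ω} ∩ Zᶜ) ∪ ({ω | τ ω ≤ t} ∩ Z) := by
    ext ω
    by_cases hω : ω ∈ Z
    · simp [hω]
    · simpa [hω] using isGLB_energy_le_coe_iff hω (hτ ω) t
  rw [hsplit]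
  exact ((@measurableSet_le _ _ _ _ _ (𝓕 t) _ _ _ _ _ measurable_const (hm t)).inter
    (hnull t Z hZm hZ0).compl).union
    (hnull t _ (hB.inter hZm) (measure_mono_null Set.inter_subset_right hZ0))

theorem isLocalizingSequence_energy
    (hnull : ∀ t A, MeasurableSet A → P A = 0 → MeasurableSet[𝓕 t] A)
    (hφ : IsLocalIntegrand 𝓕 φ P) {τ : ℕ → Ω → WithTop (Set.Iic T)}
    (hτ : ∀ (n : ℕ) ω, IsGLB {t : WithTop (Set.Iic T) | ∃ s : Set.Iic T, t = s ∧
      n ≤ energy φ s ω} (τ n ω)) : IsLocalizingSequence 𝓕 τ P where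
  isStoppingTime n := isStoppingTime_energy hnull hφ (hτ n)
  mono := ae_of_all _ fun ω m n hmn => (hτ n ω).mono (hτ m ω) (by
    rintro _ ⟨s, rfl, hs⟩
    exact ⟨s, rfl, le_trans (by exact_mod_cast hmn) hs⟩)
  tendsto_top := by
    filter_upwards [hφ.energy_lt_top] with ω hω
    obtain ⟨N, hN⟩ := ENNReal.exists_nat_gt hω.ne
    refine tendsto_const_nhds.congr' ?_
    filter_upwards [eventually_ge_atTop N] with n hn
    have hempty : {t : WithTop (Set.Iic T) | ∃ s : Set.Iic T, t = s ∧ n ≤ energy φ s ω} = ∅ := by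
      refine Set.eq_empty_of_forall_notMem ?_
      rintro _ ⟨s, -, hs⟩
      have h1 : (N : ℝ≥0∞) ≤ n := by exact_mod_cast hn
      exact absurd (h1.trans (hs.trans (energy_mono φ ω le_top))) (not_le.2 hN)
    have := hτ n ω
    rw [hempty, isGLB_empty_iff] at this
    exact (this.eq_top).symm

theorem isSqIntegrand_truncate_energy
    (hnull : ∀ t A, MeasurableSet A → P A = 0 → MeasurableSet[𝓕 t] A)
    (hφ : IsLocalIntegrand 𝓕 φ P) {τ : Ω → WithTop (Set.Iic T)} (hc : c ≠ ∞)
    (hτ : ∀ ω, IsGLB {t : WithTop (Set.Iic T) | ∃ s : Set.Iic T, t = s ∧ c ≤ energy φ s ω}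
      (τ ω)) : IsSqIntegrand 𝓕 (truncate φ τ) P where
  predictable := hφ.predictable.truncate (isStoppingTime_energy hnull hφ hτ)
  energy_lt_top := by
    refine (lintegral_mono fun ω => energy_truncate_le (hτ ω)).trans_lt ?_
    rw [lintegral_const, measure_univ, mul_one]
    exact hc.lt_top

end Energy

/-! ### Localization -/

section Localization

variable {Ω : Type*} {mΩ : MeasurableSpace Ω} {P : Measure Ω} [IsProbabilityMeasure P] {T : ℝ≥0}
  {U : Type*} [NormedAddCommGroup U] [InnerProductSpace ℝ U] [CompleteSpace U]
  {H : Type*} [NormedAddCommGroup H] [InnerProductSpace ℝ H] [CompleteSpace H]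
  {𝓕 : Filtration (Set.Iic T) mΩ} {Q : U →L[ℝ] U} {W : ℝ≥0 → Ω → U}
  {φ : Set.Iic T → Ω → HilbertSchmidt (RKSpace Q) H} {M : Set.Iic T → Ω → H}
  {σ : Ω → WithTop (Set.Iic T)} {τ : ℕ → Ω → WithTop (Set.Iic T)}

theorem MeasureTheory.continuous_stoppedProcess {ω : Ω} (h : Continuous fun t => M t ω) :
    Continuous fun t => stoppedProcess M σ t ω := by
  rcases eq_or_ne (σ ω) ⊤ with htop | hne
  · simpa only [stoppedProcess_of_le (htop.symm ▸ le_top)] using h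
  · obtain ⟨s, hs⟩ := WithTop.ne_top_iff_exists.1 hne
    simp only [stoppedProcess_of_eq_coe hs.symm]
    exact h.comp (continuous_id.min continuous_const)

theorem MeasureTheory.stronglyAdapted_stoppedProcess_of_continuous
    (hM : ∀ t, StronglyMeasurable[𝓕 t] (M t)) (hc : ∀ ω, Continuous fun t => M t ω)
    (hσ : IsStoppingTime 𝓕 σ) (t : Set.Iic T) :
    StronglyMeasurable[𝓕 t] (stoppedProcess M σ t) :=
  IsStronglyProgressive.stronglyAdapted_stoppedProcess
    (StronglyAdapted.isStronglyProgressive_of_continuous (f := 𝓕) hM hc) hσ t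

/-- The end point T lies strictly below the added ⊤, which is therefore isolated: convergence to ⊤
means being eventually equal to it. -/
theorem ProbabilityTheory.IsLocalizingSequence.ae_eventually_eq_top
    (hτ : IsLocalizingSequence 𝓕 τ P) : ∀ᵐ ω ∂P, ∀ᶠ n in atTop, τ n ω = ⊤ := by
  filter_upwards [hτ.tendsto_top] with ω hω
  filter_upwards [hω.eventually_const_lt (WithTop.coe_lt_top (⊤ : Set.Iic T))] with n hn
  by_contra hne
  obtain ⟨s, hs⟩ := WithTop.ne_top_iff_exists.1 hne
  rw [← hs, WithTop.coe_lt_coe] at hn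
  exact not_top_lt hn

variable (hW : IsWienerFor 𝓕 Q W H P) (hT : 0 < T)

include hT

theorem IsL2Integral.stopped_truncate
    (h : IsL2Integral hW.incl_lt_top 𝓕 W (Function.uncurry φ) M P) (hφ : IsSqIntegrand 𝓕 φ P)
    (hc : ∀ᵐ ω ∂P, Continuous fun t => M t ω) (hσ : IsStoppingTime 𝓕 σ) :
    IsL2Integral hW.incl_lt_top 𝓕 W (Function.uncurry (truncate φ σ))
      (stoppedProcess M σ) P := by
  rw [uncurry_truncate]
  exact h.stopped_indicator hW hT hφ.memLp hc hσ

/-- The stochastic integral of a process which is locally in `ℋ²`. -/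
theorem exists_isL2Integral_along [SecondCountableTopology U] (hτ : IsLocalizingSequence 𝓕 τ P)
    (hφ : ∀ n, IsSqIntegrand 𝓕 (truncate φ (τ n)) P) :
    ∃ M : Set.Iic T → Ω → H, (∀ ω, Continuous fun t => M t ω) ∧
      (∀ t, StronglyMeasurable[𝓕 t] (M t)) ∧
      ∀ n, IsL2Integral hW.incl_lt_top 𝓕 W (Function.uncurry (truncate φ (τ n)))
        (stoppedProcess M (τ n)) P := by
  choose N hNc hNm hN using fun n => exists_isL2Integral (P := P) hW hT (hφ n).predictable
    (hφ n).memLp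
  -- Stopping the m-th integral at τₙ integrates 1_{[0,τₙ]} φ, since τₙ ≤ τₘ almost surely;
  -- uniqueness and path continuity identify it with the n-th integral.
  have hcompat : ∀ n m, n ≤ m → ∀ᵐ ω ∂P, ∀ t, stoppedProcess (N m) (τ n) t ω = N n t ω := by
    intro n m hnm
    have h1 := (hN m).stopped_truncate hW hT (hφ m) (ae_of_all _ (hNc m))
      (hτ.isStoppingTime n)
    have h2 : Function.uncurry (truncate (truncate φ (τ m)) (τ n)) =ᵐ[(timeMeasure T).prod P]
        Function.uncurry (truncate φ (τ n)) := by
      have hmono : ∀ᵐ p : Set.Iic T × Ω ∂(timeMeasure T).prod P, Monotone (τ · p.2) :=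
        Measure.quasiMeasurePreserving_snd.ae hτ.mono
      filter_upwards [hmono] with p hp
      simp only [Function.uncurry, truncate]
      by_cases hle : (p.1 : WithTop (Set.Iic T)) ≤ τ n p.2
      · rw [if_pos hle, if_pos hle, if_pos (hle.trans (hp hnm))]
      · rw [if_neg hle, if_neg hle]
    have h3 := (h1.congr h2 fun _ => EventuallyEq.rfl).unique hW hT (hN n)
    exact ae_forall_eq_of_continuous h3
      (ae_of_all _ fun ω => continuous_stoppedProcess (hNc m ω)) (ae_of_all _ (hNc n))
  have hcompat' : ∀ᵐ ω ∂P, ∀ n m, n ≤ m → ∀ t, stoppedProcess (N m) (τ n) t ω = N n t ω :=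
    ae_all_iff.2 fun n => ae_all_iff.2 fun m => by
      by_cases hnm : n ≤ m
      · exact (hcompat n m hnm).mono fun _ h _ => h
      · exact ae_of_all _ fun _ h => absurd h hnm
  -- Along almost every path the N m are eventually constant in m, namely once τₙ = ⊤ for some n ≤
  -- m, so their limit glues them.
  obtain ⟨M, hMc, hMm, hMlim⟩ := exists_continuous_adapted_limit (P := P) hW.null hNm (by
    filter_upwards [hcompat', hτ.ae_eventually_eq_top] with ω h1 h2
    obtain ⟨n, hn⟩ := h2.exists
    refine ⟨fun t => N n t ω, hNc n ω, fun t => tendsto_const_nhds.congr' ?_⟩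
    filter_upwards [eventually_ge_atTop n] with m hm
    rw [← h1 n m hm, stoppedProcess_of_le (by rw [hn]; exact le_top)])
  refine ⟨M, hMc, hMm, fun n => (hN n).congr EventuallyEq.rfl fun t => ?_⟩
  filter_upwards [hcompat', hMlim] with ω h1 h2
  refine tendsto_nhds_unique (tendsto_const_nhds.congr' ?_) (h2 _)
  filter_upwards [eventually_ge_atTop n] with m hm
  exact (h1 n m hm t).symm

/-- Independence of the localizing sequence. -/
theorem IsL2Integral.of_along [SecondCountableTopology U] (hτ : IsLocalizingSequence 𝓕 τ P)
    (hφ : ∀ n, IsSqIntegrand 𝓕 (truncate φ (τ n)) P) (hc : ∀ᵐ ω ∂P, Continuous fun t => M t ω)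
    (h : ∀ n, IsL2Integral hW.incl_lt_top 𝓕 W (Function.uncurry (truncate φ (τ n)))
        (stoppedProcess M (τ n)) P)
    (hσ : IsStoppingTime 𝓕 σ) (hφσ : IsSqIntegrand 𝓕 (truncate φ σ) P) :
    IsL2Integral hW.incl_lt_top 𝓕 W (Function.uncurry (truncate φ σ))
      (stoppedProcess M σ) P := by
  obtain ⟨N, hNc, -, hN⟩ := exists_isL2Integral hW hT hφσ.predictable hφσ.memLp
  refine hN.congr EventuallyEq.rfl fun t => ?_
  have h1 : ∀ n, stoppedProcess N (τ n) t =ᵐ[P]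
      stoppedProcess (stoppedProcess M (τ n)) σ t := fun n => by
    have h2 := hN.stopped_truncate hW hT hφσ (ae_of_all _ hNc) (hτ.isStoppingTime n)
    have h3 := (h n).stopped_truncate hW hT (hφ n)
      (hc.mono fun ω hω => continuous_stoppedProcess hω) hσ
    -- Truncations commute, so the integral of the doubly truncated process is obtained both from M
    -- and from N; letting τₙ reach ⊤ gives the claim.
    have h4 : truncate (truncate φ (τ n)) σ = truncate (truncate φ σ) (τ n) := by
      funext s ω
      simp only [truncate]
      split_ifs <;> rfl
    rw [h4] at h3
    exact h2.unique hW hT h3 t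
  filter_upwards [ae_all_iff.2 h1, hτ.ae_eventually_eq_top] with ω h1 h2
  obtain ⟨n, hn⟩ := h2.exists
  have h3 := h1 n
  have hle : ∀ s : Set.Iic T, (s : WithTop (Set.Iic T)) ≤ τ n ω := fun s => by
    rw [hn]
    exact le_top
  rw [stoppedProcess_of_le (hle t)] at h3
  rw [h3]
  exact stoppedProcess_of_le (hle _)

theorem ae_eq_of_isL2Integral_along {M' : Set.Iic T → Ω → H} (hτ : IsLocalizingSequence 𝓕 τ P)
    (h : ∀ n, IsL2Integral hW.incl_lt_top 𝓕 W (Function.uncurry (truncate φ (τ n)))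
        (stoppedProcess M (τ n)) P)
    (h' : ∀ n, IsL2Integral hW.incl_lt_top 𝓕 W (Function.uncurry (truncate φ (τ n)))
        (stoppedProcess M' (τ n)) P) (t : Set.Iic T) : M t =ᵐ[P] M' t := by
  filter_upwards [ae_all_iff.2 fun n => (h n).unique hW hT (h' n) t, hτ.ae_eventually_eq_top]
    with ω h1 h2
  obtain ⟨n, hn⟩ := h2.exists
  have h3 := h1 n
  have hle : (t : WithTop (Set.Iic T)) ≤ τ n ω := by
    rw [hn]
    exact le_top
  rwa [stoppedProcess_of_le hle, stoppedProcess_of_le hle] at h3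

include hW

/-- Existence, uniqueness and localization of the stochastic integral of predictable processes with
almost surely square integrable paths. -/
theorem exists_localIntegral [SecondCountableTopology U] (hφ : IsLocalIntegrand 𝓕 φ P) :
    ∃ (τ : ℕ → Ω → WithTop (Set.Iic T)) (M : Set.Iic T → Ω → H),
      (∀ (n : ℕ) ω, IsGLB {t : WithTop (Set.Iic T) | ∃ s : Set.Iic T, t = s ∧ n ≤ energy φ s ω}
        (τ n ω)) ∧
      IsLocalizingSequence 𝓕 τ P ∧
      (∀ ω, Continuous fun t => M t ω) ∧
      IsContLocalMartingale 𝓕 M P ∧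
      IsItoIntegralAlong 𝓕 W φ M τ P ∧
      (∀ n, IsContSqIntMartingale 𝓕 (stoppedProcess M (τ n)) P) ∧
      (∀ σ : Ω → WithTop (Set.Iic T), IsStoppingTime 𝓕 σ →
        IsSqIntegrand 𝓕 (truncate φ σ) P →
        IsItoIntegral 𝓕 W (truncate φ σ) (stoppedProcess M σ) P) ∧
      (∀ (M' : Set.Iic T → Ω → H) (σ : ℕ → Ω → WithTop (Set.Iic T)),
        IsLocalizingSequence 𝓕 σ P → (∀ᵐ ω ∂P, Continuous fun t => M' t ω) →
        IsItoIntegralAlong 𝓕 W φ M' σ P → ∀ᵐ ω ∂P, ∀ t, M' t ω = M t ω) := by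
  choose τ hτ using fun (n : ℕ) ω => exists_isGLB_withTop fun s : Set.Iic T => n ≤ energy φ s ω
  have hloc := isLocalizingSequence_energy hW.null hφ hτ
  have hsq := fun n => isSqIntegrand_truncate_energy hW.null hφ (ENNReal.natCast_ne_top n) (hτ n)
  obtain ⟨M, hMc, hMm, hM⟩ := exists_isL2Integral_along hW hT hloc hsq
  have hmart : ∀ n, IsContSqIntMartingale 𝓕 (stoppedProcess M (τ n)) P := fun n =>
    (hM n).isContSqIntMartingale hW hT (hsq n).memLp
      (stronglyAdapted_stoppedProcess_of_continuous hMm hMc (hloc.isStoppingTime n))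
      (ae_of_all _ fun ω => continuous_stoppedProcess (hMc ω))
  have h_stopped : ∀ σ : Ω → WithTop (Set.Iic T), IsStoppingTime 𝓕 σ →
      IsSqIntegrand 𝓕 (truncate φ σ) P → IsL2Integral hW.incl_lt_top 𝓕 W
        (Function.uncurry (truncate φ σ)) (stoppedProcess M σ) P := fun σ hσ hφσ =>
    IsL2Integral.of_along hW hT hloc hsq (ae_of_all _ hMc) hM hσ hφσ
  refine ⟨τ, M, hτ, hloc, hMc, ⟨hMm, ae_of_all _ hMc, ?_, τ, hloc, fun n => (hmart n).martingale⟩,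
    fun n => ⟨hsq n, (hM n).isItoIntegral hW hT (hsq n)⟩, hmart,
    fun σ hσ hφσ => (h_stopped σ hσ hφσ).isItoIntegral hW hT hφσ, fun M' σ hσ hc' hM' => ?_⟩
  · filter_upwards [(hmart 0).zero] with ω hω
    rwa [stoppedProcess_of_le (by exact bot_le)] at hω
  -- By `h_stopped`, M also has the stopping property along the foreign sequence σ, so both
  -- processes can be compared along the same times.
  · refine ae_forall_eq_of_continuous (fun t => ?_) hc' (ae_of_all _ hMc)
    exact ae_eq_of_isL2Integral_along hW hT hσ
      (fun n => (hM' n).2.isL2Integral hW.incl_lt_top (hM' n).1.memLp.1)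
      (fun n => h_stopped (σ n) (hσ.isStoppingTime n) (hM' n).1) t

end Localization

end

/-! ### The main theorem -/

theorem mainTheorem5
    {Ω : Type*} [mΩ : MeasurableSpace Ω] (P : Measure Ω) [IsProbabilityMeasure P]
    {U : Type*} [NormedAddCommGroup U] [InnerProductSpace ℝ U] [CompleteSpace U]
    [SecondCountableTopology U] [MeasurableSpace U] [BorelSpace U]
    {H : Type*} [NormedAddCommGroup H] [InnerProductSpace ℝ H] [CompleteSpace H]
    [SecondCountableTopology H]
    (T : ℝ≥0) (hT : 0 < T)
    (Q : U →L[ℝ] U) (hQ : Q.IsPositive) (hQtr : IsTraceClass Q)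
    (W : ℝ≥0 → Ω → U) (hW : IsQWiener Q W P)
    (𝓕 : Filtration (Set.Iic T) mΩ) (h𝓕 : 𝓕 = wienerFiltration W hW.stronglyMeasurable P T) :
    -- the Itô isometry for simple processes
    (∀ ψ : SimpleProcess 𝓕 U H,
      IsContSqIntMartingale 𝓕 (ψ.integral W) P ∧
      ∀ t : Set.Iic T, ∫⁻ ω, ‖ψ.integral W t ω‖ₑ ^ 2 ∂P =
        ∫⁻ ω, ∫⁻ s in Set.Iic t, hsENormSq (ψ.eval s ω ∘L RKSpace.incl Q) ∂timeMeasure T ∂P) ∧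
    -- integrands in `ℋ²_T(W)`
    (∀ φ : Set.Iic T → Ω → HilbertSchmidt (RKSpace Q) H, IsSqIntegrand 𝓕 φ P →
      (∃ ψ : ℕ → SimpleProcess 𝓕 U H, ApproximatedBy φ ψ P) ∧
      ∃ M : Set.Iic T → Ω → H,
        (∀ ω, Continuous fun t => M t ω) ∧
        IsContSqIntMartingale 𝓕 M P ∧
        (∀ t, ∫⁻ ω, ‖M t ω‖ₑ ^ 2 ∂P = ∫⁻ ω, energy φ t ω ∂P) ∧
        IsItoIntegral 𝓕 W φ M P ∧
        (∀ ψ : ℕ → SimpleProcess 𝓕 U H, ApproximatedBy φ ψ P → IntegralsTendsto ψ W M P) ∧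
        (∀ M' : Set.Iic T → Ω → H, IsItoIntegral 𝓕 W φ M' P →
          (∀ t, M' t =ᵐ[P] M t) ∧
          ((∀ᵐ ω ∂P, Continuous fun t => M' t ω) → ∀ᵐ ω ∂P, ∀ t, M' t ω = M t ω))) ∧
    -- integrands in `ℋ_T(W)`
    (∀ φ : Set.Iic T → Ω → HilbertSchmidt (RKSpace Q) H, IsLocalIntegrand 𝓕 φ P →
      ∃ (τ : ℕ → Ω → WithTop (Set.Iic T)) (M : Set.Iic T → Ω → H),
        (∀ (n : ℕ) ω, IsGLB {t : WithTop (Set.Iic T) | ∃ s : Set.Iic T, t = s ∧ n ≤ energy φ s ω}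
          (τ n ω)) ∧
        IsLocalizingSequence 𝓕 τ P ∧
        (∀ ω, Continuous fun t => M t ω) ∧
        IsContLocalMartingale 𝓕 M P ∧
        IsItoIntegralAlong 𝓕 W φ M τ P ∧
        (∀ n, IsContSqIntMartingale 𝓕 (stoppedProcess M (τ n)) P) ∧
        -- independence of the localization, and consistency with the first part
        (∀ σ : Ω → WithTop (Set.Iic T), IsStoppingTime 𝓕 σ →
          IsSqIntegrand 𝓕 (truncate φ σ) P →
          IsItoIntegral 𝓕 W (truncate φ σ) (stoppedProcess M σ) P) ∧
        (∀ (M' : Set.Iic T → Ω → H) (σ : ℕ → Ω → WithTop (Set.Iic T)),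
          IsLocalizingSequence 𝓕 σ P → (∀ᵐ ω ∂P, Continuous fun t => M' t ω) →
          IsItoIntegralAlong 𝓕 W φ M' σ P → ∀ᵐ ω ∂P, ∀ t, M' t ω = M t ω)) := by
  subst h𝓕
  have hWF := hW.isWienerFor hQ hQtr H (T := T)
  exact ⟨fun ψ => ⟨ψ.isContSqIntMartingale hWF, fun t => ψ.lintegral_integral_sq hWF t⟩,
    fun φ hφ => ⟨exists_approximatedBy hWF hT hφ, exists_isItoIntegral hWF hT hφ⟩,
    fun φ hφ => exists_localIntegral hWF hT hφ⟩
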